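/- Let $k$ be a commutative ring and fix a universe $\mathcal U$ containing $k$. A ($\mathcal U$-small) $k$-linear site is a small $k$-linear category $\mathcal A$ with a $k$-linear topology $\mathcal T_{\mathcal A}$: a family of covering sieves (a sieve on $A$ is a subobject of $\mathcal A(-,A)$ in $\mathrm{Mod}(\mathcal A)=\mathrm{Fun}_k(\mathcal A^{op},\mathrm{Mod}(k))$) satisfying the identity, pullback and glueing axioms. A sheaf is an $F\in\mathrm{Mod}(\mathcal A)$ such that $F(A)\to\mathrm{Mod}(\mathcal A)(R,F)$ is bijective for every covering sieve $R$ on any object $A$. A $k$-linear functor $f$ between sites is continuous if $F\mapsto F\circ f$ preserves sheaves. Let $\mathsf{Site}$ be the 2-category of $k$-linear sites, continuous $k$-linear functors and natural transformations. A family of morphisms with target $A$ is covering if the sieve it generates is covering. A 1-morphism $f:\mathcal A\to\mathcal C$ of $\mathsf{Site}$ is an LC morphism if - (G) every $C\in\mathcal C$ has a covering family of the form $(f(A_i)\to C)_i$; - (F) for every $c:f(A)\to f(A')$ there are a covering family $a_i:A_i\to A$ and $f_i:A_i\to A'$ with $c\,f(a_i)=f(f_i)$; - (FF) for every $a:A\to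 A'$ with $f(a)=0$ there is a covering family $a_i:A_i\to A$ with $a a_i=0$; - $\mathcal T_{\mathcal A}=f^{-1}\mathcal T_{\mathcal C}$, i.e. a sieve $R$ on $A$ is covering if and only if the sieve on $f(A)$ generated by $\{f(r): r\in R\}$ is covering. Then the class $\mathsf W=\mathrm{LC}$ of LC morphisms admits a left calculus of fractions in $\mathsf{Site}$ in the sense of Pronk, that is: - (LF1) all (adjoint) equivalences of $\mathsf{Site}$ belong to $\mathsf W$; - (LF2) $\mathsf W$ is closed under composition; - (LF3) for all $f:C\to A$ and $w:C\to B$ with $w\in\mathsf W$ there are $v:A\to D$ in $\mathsf W$, $g:B\to D$ and an invertible 2-morphism $g\circ w\cong v\circ f$; - (LF4) for all $f,g:B\to A$, $w:B'\to B$ in $\mathsf W$ and $\alpha:f\circ w\Rightarrow g\circ w$, there are $v:A\to A'$ in $\mathsf W$ and $\beta:v\circ f\Rightarrow v\circ g$ with $v\circ\alpha=\beta\circ w$, where $\beta$ is invertible if $\alpha$ is; and whenever $(v:A\to A_1,\beta)$ and $(v':A\to A_2,\beta')$ are two pairs with $v,v'\in\mathsf W$, $v\circ\alpha=\beta\circ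 w$ and $v'\circ\alpha=\beta'\circ w$, there are $u:A_1\to A_3$, $u':A_2\to A_3$ with $u\circ v,\,u'\circ v'\in\mathsf W$ and an invertible $\varepsilon:u\circ v\Rightarrow u'\circ v'$ such that $(\varepsilon\circ g)\bullet(u\circ\beta)=(u'\circ\beta')\bullet(\varepsilon\circ f)$, where $\bullet$ is vertical composition; - (LF5) if $f\cong g$ and $f\in\mathsf W$, then $g\in\mathsf W$. Moreover the bilocalization $\mathsf{Site}[\mathrm{LC}^{-1}]$ exists: there are a bicategory $\mathsf{Site}[\mathrm{LC}^{-1}]$ and a pseudofunctor $\Psi:\mathsf{Site}\to\mathsf{Site}[\mathrm{LC}^{-1}]$ which sends LC morphisms to equivalences, such that for every bicategory $\mathcal D$ composition with $\Psi$ is an equivalence of bicategories (essentially surjective on objects, essentially full, fully faithful on 2-morphisms) $\mathrm{Hom}(\mathsf{Site}[\mathrm{LC}^{-1}],\mathcal D)\to\mathrm{Hom}_{\mathrm{LC}}(\mathsf{Site},\mathcal D)$. Here $\mathrm{Hom}$ is the bicategory of pseudofunctors, pseudonatural transformations and modifications, and $\mathrm{Hom}_{\mathrm{LC}}$ is its full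 sub-bicategory on the pseudofunctors which send LC morphisms to equivalences. -/

import Mathlib

open CategoryTheory Opposite
open scoped CategoryTheory.Bicategory CategoryTheory.Pseudofunctor.StrongTrans

universe u v w w₁ w₂ w₃ v₁ v₂ v₃ u₁ u₂ u₃

/-! ## Linear sites -/

section LinearSites

/-- A `k`-linear sieve on `X`: a subobject of the representable module `C(-, X)` in `Mod(C)`, that
is, a `k`-submodule of `C(Y, X)` for every `Y`, stable under precomposition. -/
@[ext]
structure LinSieve (k : Type u) [CommRing k] {C : Type v} [Category.{w} C] [Preadditive C]
    [Linear k C] (X : C) where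
  arrows : ∀ Y : C, Submodule k (Y ⟶ X)
  precomp_mem : ∀ {Y Z : C} (g : Z ⟶ Y) {f : Y ⟶ X}, f ∈ arrows Y → g ≫ f ∈ arrows Z

namespace LinSieve

variable {k : Type u} [CommRing k] {C : Type v} [Category.{w} C] [Preadditive C] [Linear k C]

/-- The maximal sieve, i.e. the whole representable module. -/
def maximal (k : Type u) [CommRing k] {C : Type v} [Category.{w} C] [Preadditive C] [Linear k C]
    (X : C) : LinSieve k X where
  arrows _ := ⊤
  precomp_mem _ _ _ := Submodule.mem_top

/-- The pullback `f⁻¹ R = {g | g ≫ f ∈ R}` of a sieve. -/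
def pullback {X X' : C} (f : X' ⟶ X) (R : LinSieve k X) : LinSieve k X' where
  arrows Y := (R.arrows Y).comap (Linear.rightComp k Y f)
  precomp_mem g h hh := by
    simp only [Submodule.mem_comap, Linear.rightComp_apply, Category.assoc] at hh ⊢
    exact R.precomp_mem g hh

/-- The sieve `⟨a i⟩` generated by a family of morphisms `a i : A i ⟶ X`. -/
def generate {I : Type v₁} {X : C} {A : I → C} (a : ∀ i, A i ⟶ X) : LinSieve k X where
  arrows Y := Submodule.span k {f | ∃ (i : I) (g : Y ⟶ A i), f = g ≫ a i}
  precomp_mem {Y Z} g f hf := by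
    have h : Submodule.span k {f | ∃ (i : I) (g : Y ⟶ A i), f = g ≫ a i} ≤
        (Submodule.span k {f | ∃ (i : I) (g : Z ⟶ A i), f = g ≫ a i}).comap
          (Linear.leftComp k X g) := by
      rw [Submodule.span_le]
      rintro _ ⟨i, g', rfl⟩
      exact Submodule.subset_span ⟨i, g ≫ g', by simp⟩
    exact h hf

/-- `generate a` is the smallest sieve containing all the `a i`. -/
theorem generate_le_iff {I : Type v₁} {X : C} {A : I → C} (a : ∀ i, A i ⟶ X) (R : LinSieve k X) :
    (∀ Y, (generate (k := k) a).arrows Y ≤ R.arrows Y) ↔ ∀ i, a i ∈ R.arrows (A i) := by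
  constructor
  · intro h i
    exact h _ (Submodule.subset_span ⟨i, 𝟙 _, by simp⟩)
  · intro h Y
    refine Submodule.span_le.2 ?_
    rintro _ ⟨i, g, rfl⟩
    exact R.precomp_mem g (h i)

/-- The image `f R` of a sieve under a functor: the sieve generated by all `f a`, `a ∈ R`. -/
def image {D : Type u₂} [Category.{v₂} D] [Preadditive D] [Linear k D] (f : C ⥤ D) {X : C}
    (R : LinSieve k X) : LinSieve k (f.obj X) :=
  generate (I := Σ Y : C, R.arrows Y) (A := fun i => f.obj i.1) fun i => f.map (i.2 : i.1 ⟶ X)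

end LinSieve

/-- A cover system: a family of (covering) sieves on every object. -/
abbrev CoverSystem (k : Type u) [CommRing k] (C : Type v) [Category.{w} C] [Preadditive C]
    [Linear k C] :=
  ∀ X : C, Set (LinSieve k X)

/-- A `k`-linear topology: a cover system satisfying the identity, pullback and glueing axioms. -/
structure LinTopology (k : Type u) [CommRing k] (C : Type v) [Category.{w} C] [Preadditive C]
    [Linear k C] where
  covers : CoverSystem k C
  maximal_mem : ∀ X : C, LinSieve.maximal k X ∈ covers X
  pullback_mem : ∀ {X X' : C} (f : X' ⟶ X) {R : LinSieve k X}, R ∈ covers X →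
    R.pullback f ∈ covers X'
  glue : ∀ {X : C} {R : LinSieve k X} (S : LinSieve k X), R ∈ covers X →
    (∀ (Y : C) (f : Y ⟶ X), f ∈ R.arrows Y → S.pullback f ∈ covers Y) → S ∈ covers X

/-- A presheaf of `k`-modules is `k`-linear, i.e. belongs to `Mod(C) = Fun_k(Cᵒᵖ, Mod(k))`. -/
structure IsLinPresheaf {k : Type u} [CommRing k] {C : Type v} [Category.{w} C] [Preadditive C]
    [Linear k C] (F : Cᵒᵖ ⥤ ModuleCat.{w} k) : Prop where
  map_add : ∀ {X Y : C} (f g : X ⟶ Y), F.map (f + g).op = F.map f.op + F.map g.op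
  map_smul : ∀ {X Y : C} (r : k) (f : X ⟶ Y), F.map (r • f).op = r • F.map f.op

/-- A `k`-linear presheaf `F` is a sheaf if `F(X) → Mod(C)(R, F)` is bijective for every covering
sieve `R` on `X`. Morphisms `x : R ⟶ F` in `Mod(C)` are spelled out as natural families of
`k`-linear maps, and the map sends `s` to `f ↦ F(f)(s)`. -/
structure IsLinSheaf {k : Type u} [CommRing k] {C : Type v} [Category.{w} C] [Preadditive C]
    [Linear k C] (T : CoverSystem k C) (F : Cᵒᵖ ⥤ ModuleCat.{w} k) : Prop where
  linear : IsLinPresheaf F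
  existsUnique : ∀ (X : C) (R : LinSieve k X), R ∈ T X →
    ∀ x : ∀ Y : C, R.arrows Y →ₗ[k] F.obj (op Y),
      (∀ {Y Z : C} (g : Z ⟶ Y) (f : R.arrows Y),
        x Z ⟨g ≫ f, R.precomp_mem g f.2⟩ = F.map g.op (x Y f)) →
      ∃! s : F.obj (op X), ∀ (Y : C) (f : R.arrows Y), x Y f = F.map (f : Y ⟶ X).op s

/-- A functor is continuous if precomposition with it preserves sheaves. -/
def IsContinuousLin {k : Type u} [CommRing k] {C : Type v} [Category.{w} C] [Preadditive C]
    [Linear k C] {D : Type v₁} [Category.{w} D] [Preadditive D] [Linear k D]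
    (S : CoverSystem k C) (T : CoverSystem k D) (f : C ⥤ D) : Prop :=
  ∀ F : Dᵒᵖ ⥤ ModuleCat.{w} k, IsLinSheaf T F → IsLinSheaf S (f.op ⋙ F)

end LinearSites

/-! ## The 2-category of linear sites -/

/-- A small `k`-linear site. -/
structure LinSite (k : Type u) [CommRing k] where
  carrier : Type u
  [category : SmallCategory carrier]
  [preadditive : Preadditive carrier]
  [linear : Linear k carrier]
  topology : LinTopology k carrier

namespace LinSite

variable {k : Type u} [CommRing k]

attribute [instance] category preadditive linear

/-- A 1-morphism of sites: a `k`-linear continuous functor. -/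
structure Hom (A B : LinSite k) where
  functor : A.carrier ⥤ B.carrier
  additive : functor.Additive
  linear : functor.Linear k
  continuous : IsContinuousLin A.topology.covers B.topology.covers functor

/-- A 2-morphism of sites: a natural transformation. -/
@[ext]
structure Hom₂ {A B : LinSite k} (f g : Hom A B) where
  natTrans : f.functor ⟶ g.functor

@[simps]
instance homCategory (A B : LinSite k) : Category (Hom A B) where
  Hom f g := Hom₂ f g
  id f := ⟨𝟙 f.functor⟩
  comp α β := ⟨α.natTrans ≫ β.natTrans⟩

@[ext]
theorem hom₂_ext {A B : LinSite k} {f g : Hom A B} {α β : f ⟶ g}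
    (h : α.natTrans = β.natTrans) : α = β :=
  Hom₂.ext h

/-- The identity 1-morphism. -/
@[simps functor]
def Hom.id (A : LinSite k) : Hom A A where
  functor := 𝟭 _
  additive := inferInstance
  linear := inferInstance
  continuous _ hF := hF

/-- Composition of 1-morphisms (in diagrammatic order). -/
@[simps functor]
def Hom.comp {A B C : LinSite k} (f : Hom A B) (g : Hom B C) : Hom A C where
  functor := f.functor ⋙ g.functor
  additive := by
    have := f.additive
    have := g.additive
    infer_instance
  linear := by
    have := f.linear
    have := g.linear
    infer_instance
  continuous F hF := f.continuous _ (g.continuous F hF)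

/-- A natural isomorphism of the underlying functors gives an invertible 2-morphism. -/
@[simps]
def isoMk {A B : LinSite k} {f g : Hom A B} (e : f.functor ≅ g.functor) : f ≅ g where
  hom := ⟨e.hom⟩
  inv := ⟨e.inv⟩

/-- The 2-category of `k`-linear sites, continuous `k`-linear functors and natural
transformations. -/
instance bicategory : Bicategory (LinSite k) where
  Hom A B := Hom A B
  id A := Hom.id A
  comp f g := Hom.comp f g
  homCategory A B := homCategory A B
  whiskerLeft f _ _ α := ⟨Functor.whiskerLeft f.functor α.natTrans⟩
  whiskerRight α h := ⟨Functor.whiskerRight α.natTrans h.functor⟩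
  associator f g h := isoMk (Functor.associator f.functor g.functor h.functor)
  leftUnitor f := isoMk (Functor.leftUnitor f.functor)
  rightUnitor f := isoMk (Functor.rightUnitor f.functor)
  id_whiskerLeft α := Hom₂.ext <| NatTrans.ext <| funext fun X => by
    change α.natTrans.app X = 𝟙 _ ≫ α.natTrans.app X ≫ 𝟙 _
    simp
  comp_whiskerLeft f g _ _ α := Hom₂.ext <| NatTrans.ext <| funext fun X => by
    change α.natTrans.app (g.functor.obj (f.functor.obj X)) = 𝟙 _ ≫ α.natTrans.app _ ≫ 𝟙 _
    simp
  whiskerRight_id α := Hom₂.ext <| NatTrans.ext <| funext fun X => by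
    change α.natTrans.app X = 𝟙 _ ≫ α.natTrans.app X ≫ 𝟙 _
    simp
  whiskerRight_comp α g h := Hom₂.ext <| NatTrans.ext <| funext fun X => by
    change h.functor.map (g.functor.map (α.natTrans.app X)) = 𝟙 _ ≫ h.functor.map _ ≫ 𝟙 _
    simp
  whisker_assoc f _ _ α h := Hom₂.ext <| NatTrans.ext <| funext fun X => by
    change h.functor.map (α.natTrans.app (f.functor.obj X)) = 𝟙 _ ≫ h.functor.map _ ≫ 𝟙 _
    simp
  whisker_exchange {_ _ _ f g h i} α β := Hom₂.ext <| NatTrans.ext <| funext fun X => by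
    change β.natTrans.app (f.functor.obj X) ≫ i.functor.map (α.natTrans.app X) =
      h.functor.map (α.natTrans.app X) ≫ β.natTrans.app (g.functor.obj X)
    simp
  pentagon f g h i := Hom₂.ext <| NatTrans.ext <| funext fun X => by
    change i.functor.map (𝟙 _) ≫ 𝟙 _ ≫ 𝟙 _ = 𝟙 _ ≫ 𝟙 _
    simp
  triangle f g := Hom₂.ext <| NatTrans.ext <| funext fun X => by
    change 𝟙 _ ≫ 𝟙 _ = g.functor.map (𝟙 _)
    simp

end LinSite

/-! ## LC morphisms -/

section LC

variable {k : Type u} [CommRing k] {C : Type u} [SmallCategory C] [Preadditive C] [Linear k C]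
  {D : Type u} [SmallCategory D] [Preadditive D] [Linear k D]

/-- (G): every object `X` of `D` has a covering family `(f (A i) ⟶ X)`. -/
def SatisfiesG (T : CoverSystem k D) (f : C ⥤ D) : Prop :=
  ∀ X : D, ∃ (I : Type u) (A : I → C) (c : ∀ i, f.obj (A i) ⟶ X), LinSieve.generate c ∈ T X

/-- (F): every `c : f A ⟶ f A'` lifts along some covering family of `A`. -/
def SatisfiesF (S : CoverSystem k C) (f : C ⥤ D) : Prop :=
  ∀ (A A' : C) (c : f.obj A ⟶ f.obj A'),
    ∃ (I : Type u) (B : I → C) (a : ∀ i, B i ⟶ A) (b : ∀ i, B i ⟶ A'),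
      LinSieve.generate a ∈ S A ∧ ∀ i, f.map (a i) ≫ c = f.map (b i)

/-- (FF): every `a : A ⟶ A'` with `f a = 0` vanishes on some covering family of `A`. -/
def SatisfiesFF (S : CoverSystem k C) (f : C ⥤ D) : Prop :=
  ∀ (A A' : C) (a : A ⟶ A'), f.map a = 0 →
    ∃ (I : Type u) (B : I → C) (b : ∀ i, B i ⟶ A),
      LinSieve.generate b ∈ S A ∧ ∀ i, b i ≫ a = 0

/-- (LC): (G), (F), (FF) and `S = f⁻¹ T`, i.e. `R` is covering if and only if `f R` is. -/
structure SatisfiesLC (S : CoverSystem k C) (T : CoverSystem k D) (f : C ⥤ D) : Prop where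
  G : SatisfiesG T f
  F : SatisfiesF S f
  FF : SatisfiesFF S f
  covers_iff : ∀ (X : C) (R : LinSieve k X), R ∈ S X ↔ R.image f ∈ T (f.obj X)

/-- The class of LC morphisms in the 2-category of `k`-linear sites. -/
def LinSite.LC (k : Type u) [CommRing k] : MorphismProperty (LinSite k) := fun A B f =>
  SatisfiesLC A.topology.covers B.topology.covers (LinSite.Hom.functor f)

end LC

/-! ## Left calculus of fractions in a bicategory -/

section Fractions

open Bicategory

variable {B : Type u₁} [Bicategory.{w₁, v₁} B]

/-- A 1-morphism is an equivalence if it is part of an adjoint equivalence. -/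
def IsEquivalence₁ {a b : B} (f : a ⟶ b) : Prop := ∃ e : a ≌ b, e.hom = f

/-- Pronk's axioms for a left calculus of fractions (`f ≫ g` is `g ∘ f`). -/
structure AdmitsLeftCalculusOfFractions (W : MorphismProperty B) : Prop where
  LF1 : ∀ {a b : B} (f : a ⟶ b), IsEquivalence₁ f → W f
  LF2 : ∀ {a b c : B} (f : a ⟶ b) (g : b ⟶ c), W f → W g → W (f ≫ g)
  LF3 : ∀ {a b c : B} (f : c ⟶ a) (w : c ⟶ b), W w →
    ∃ (d : B) (v : a ⟶ d) (g : b ⟶ d), W v ∧ Nonempty (w ≫ g ≅ f ≫ v)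
  /-- Parts (1) and (2). -/
  LF4_exists : ∀ {a b b' : B} (f g : b ⟶ a) (w : b' ⟶ b), W w → ∀ α : w ≫ f ⟶ w ≫ g,
    ∃ (a' : B) (v : a ⟶ a') (β : f ≫ v ⟶ g ≫ v), W v ∧
      α ▷ v = (α_ w f v).hom ≫ w ◁ β ≫ (α_ w g v).inv ∧ (IsIso α → IsIso β)
  /-- Part (3). -/
  LF4_unique : ∀ {a b b' : B} (f g : b ⟶ a) (w : b' ⟶ b), W w → ∀ α : w ≫ f ⟶ w ≫ g,
    ∀ {a₁ a₂ : B} (v : a ⟶ a₁) (β : f ≫ v ⟶ g ≫ v) (v' : a ⟶ a₂) (β' : f ≫ v' ⟶ g ≫ v'),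
      W v → α ▷ v = (α_ w f v).hom ≫ w ◁ β ≫ (α_ w g v).inv →
      W v' → α ▷ v' = (α_ w f v').hom ≫ w ◁ β' ≫ (α_ w g v').inv →
      ∃ (a₃ : B) (u : a₁ ⟶ a₃) (u' : a₂ ⟶ a₃) (e : v ≫ u ≅ v' ≫ u'),
        W (v ≫ u) ∧ W (v' ≫ u') ∧
        ((α_ f v u).inv ≫ β ▷ u ≫ (α_ g v u).hom) ≫ g ◁ e.hom =
          f ◁ e.hom ≫ ((α_ f v' u').inv ≫ β' ▷ u' ≫ (α_ g v' u').hom)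
  LF5 : ∀ {a b : B} {f g : a ⟶ b}, (f ≅ g) → W f → W g

end Fractions

/-! ## Bilocalizations -/

section Bilocalization

open Bicategory

variable {B : Type u₁} [Bicategory.{w₁, v₁} B] {C : Type u₂} [Bicategory.{w₂, v₂} C]
  {D : Type u₃} [Bicategory.{w₃, v₃} D]

/-- A pseudofunctor is an equivalence of bicategories if it is essentially surjective on objects,
essentially full, and fully faithful on 2-morphisms. -/
structure IsEquivalenceOfBicategories (F : B ⥤ᵖ C) : Prop where
  essSurj : ∀ c : C, ∃ b : B, Nonempty (F.obj b ≌ c)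
  essFull : ∀ a b : B, (F.mapFunctor a b).EssSurj
  full : ∀ a b : B, (F.mapFunctor a b).Full
  faithful : ∀ a b : B, (F.mapFunctor a b).Faithful

/-- `F` sends the 1-morphisms in `W` to equivalences. -/
def SendsToEquivalences (W : MorphismProperty B) (F : B ⥤ᵖ C) : Prop :=
  ∀ ⦃a b : B⦄ (f : a ⟶ b), W f → IsEquivalence₁ (F.map f)

theorem IsEquivalence₁.map (F : B ⥤ᵖ C) {a b : B} {f : a ⟶ b} (hf : IsEquivalence₁ f) :
    IsEquivalence₁ (F.map f) := by
  obtain ⟨e, rfl⟩ := hf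
  exact ⟨Equivalence.mkOfAdjointifyCounit (g := F.map e.inv)
    ((F.mapId a).symm ≪≫ F.map₂Iso e.unit ≪≫ F.mapComp _ _)
    ((F.mapComp _ _).symm ≪≫ F.map₂Iso e.counit ≪≫ F.mapId b), rfl⟩

theorem strongTrans_naturality_id_aux {F G : C ⥤ᵖ D} (η : F ⟶ G) {x : C} {h : x ⟶ x}
    (φ : h ⟶ 𝟙 x) :
    (η.naturality h).hom ≫ η.app x ◁ (G.map₂ φ ≫ (G.mapId x).hom) =
      (F.map₂ φ ≫ (F.mapId x).hom) ▷ η.app x ≫ (λ_ (η.app x)).hom ≫ (ρ_ (η.app x)).inv := by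
  rw [Bicategory.whiskerLeft_comp, Bicategory.comp_whiskerRight, Category.assoc,
    ← η.naturality_id, ← η.naturality_naturality_assoc]

theorem strongTrans_naturality_comp_aux {F G : C ⥤ᵖ D} (η : F ⟶ G) {x y z : C} {h : x ⟶ z}
    (f : x ⟶ y) (g : y ⟶ z) (φ : h ⟶ f ≫ g) :
    (η.naturality h).hom ≫ η.app x ◁ (G.map₂ φ ≫ (G.mapComp f g).hom) =
      (F.map₂ φ ≫ (F.mapComp f g).hom) ▷ η.app z ≫ (α_ _ _ _).hom ≫
        F.map f ◁ (η.naturality g).hom ≫ (α_ _ _ _).inv ≫ (η.naturality f).hom ▷ G.map g ≫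
          (α_ _ _ _).hom := by
  rw [Bicategory.whiskerLeft_comp, Bicategory.comp_whiskerRight, Category.assoc,
    ← η.naturality_comp, ← η.naturality_naturality_assoc]

theorem whisker_id_comm_aux {x y z t : D} {f : x ⟶ y} {g : y ⟶ z} {h : x ⟶ t} {i : t ⟶ z}
    (φ : f ≫ g ⟶ h ≫ i) : f ◁ 𝟙 g ≫ φ = φ ≫ 𝟙 h ▷ i := by
  simp

/-- The whiskering `η ∘ Ψ` of a strong transformation with a pseudofunctor. -/
@[simps]
def precompTrans (Ψ : B ⥤ᵖ C) {F G : C ⥤ᵖ D} (η : F ⟶ G) :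
    Pseudofunctor.StrongTrans (Ψ.comp F) (Ψ.comp G) where
  app a := η.app (Ψ.obj a)
  naturality f := η.naturality (Ψ.map f)
  naturality_naturality β := η.naturality_naturality (Ψ.map₂ β)
  naturality_id a := strongTrans_naturality_id_aux η (Ψ.mapId a).hom
  naturality_comp f g := strongTrans_naturality_comp_aux η _ _ (Ψ.mapComp f g).hom

/-- The whiskering `Γ ∘ Ψ` of a modification with a pseudofunctor. -/
@[simps]
def precompModification (Ψ : B ⥤ᵖ C) {F G : C ⥤ᵖ D} {η θ : F ⟶ G} (Γ : η ⟶ θ) :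
    (show Ψ.comp F ⟶ Ψ.comp G from precompTrans Ψ η) ⟶
      (show Ψ.comp F ⟶ Ψ.comp G from precompTrans Ψ θ) where
  as :=
    { app a := Γ.as.app (Ψ.obj a)
      naturality f := Γ.as.naturality (Ψ.map f) }

/-- Composition with `Ψ`, as a pseudofunctor between bicategories of pseudofunctors, strong
transformations and modifications. -/
def precomp (Ψ : B ⥤ᵖ C) (D : Type u₃) [Bicategory.{w₃, v₃} D] : (C ⥤ᵖ D) ⥤ᵖ (B ⥤ᵖ D) where
  obj F := Ψ.comp F
  map η := precompTrans Ψ η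
  map₂ Γ := precompModification Ψ Γ
  mapId F := Pseudofunctor.StrongTrans.isoMk (fun a => Iso.refl (𝟙 (F.obj (Ψ.obj a))))
    (fun _ => whisker_id_comm_aux _)
  mapComp η θ := Pseudofunctor.StrongTrans.isoMk
    (fun a => Iso.refl (η.app (Ψ.obj a) ≫ θ.app (Ψ.obj a))) (fun _ => whisker_id_comm_aux _)
  map₂_id _ := rfl
  map₂_comp _ _ := rfl
  map₂_whisker_left η _ _ Γ := Pseudofunctor.StrongTrans.homCategory.ext fun b => by
    change η.app (Ψ.obj b) ◁ Γ.as.app (Ψ.obj b) =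
      𝟙 _ ≫ η.app (Ψ.obj b) ◁ Γ.as.app (Ψ.obj b) ≫ 𝟙 _
    simp
  map₂_whisker_right Γ θ := Pseudofunctor.StrongTrans.homCategory.ext fun b => by
    change Γ.as.app (Ψ.obj b) ▷ θ.app (Ψ.obj b) =
      𝟙 _ ≫ Γ.as.app (Ψ.obj b) ▷ θ.app (Ψ.obj b) ≫ 𝟙 _
    simp
  map₂_associator η θ ι := Pseudofunctor.StrongTrans.homCategory.ext fun b => by
    change (α_ (η.app (Ψ.obj b)) (θ.app (Ψ.obj b)) (ι.app (Ψ.obj b))).hom =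
      𝟙 _ ≫ 𝟙 (η.app (Ψ.obj b) ≫ θ.app (Ψ.obj b)) ▷ ι.app (Ψ.obj b) ≫
        (α_ (η.app (Ψ.obj b)) (θ.app (Ψ.obj b)) (ι.app (Ψ.obj b))).hom ≫
          η.app (Ψ.obj b) ◁ 𝟙 (θ.app (Ψ.obj b) ≫ ι.app (Ψ.obj b)) ≫ 𝟙 _
    simp
  map₂_left_unitor η := Pseudofunctor.StrongTrans.homCategory.ext fun b => by
    change (λ_ (η.app (Ψ.obj b))).hom =
      𝟙 _ ≫ 𝟙 (𝟙 _) ▷ η.app (Ψ.obj b) ≫ (λ_ (η.app (Ψ.obj b))).hom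
    simp
  map₂_right_unitor η := Pseudofunctor.StrongTrans.homCategory.ext fun b => by
    change (ρ_ (η.app (Ψ.obj b))).hom =
      𝟙 _ ≫ η.app (Ψ.obj b) ◁ 𝟙 (𝟙 _) ≫ (ρ_ (η.app (Ψ.obj b))).hom
    simp

/-- The full sub-bicategory of the bicategory of pseudofunctors `B ⥤ᵖ D` on those which send the
1-morphisms in `W` to equivalences. -/
abbrev InvertingPseudofunctor (W : MorphismProperty B) (D : Type u₃) [Bicategory.{w₃, v₃} D] :=
  InducedBicategory (B ⥤ᵖ D) (Subtype.val : {F : B ⥤ᵖ D // SendsToEquivalences W F} → B ⥤ᵖ D)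

/-- Composition with a pseudofunctor `Ψ` which sends `W` to equivalences, as a pseudofunctor to
the bicategory of pseudofunctors which send `W` to equivalences. -/
def precompInverting (W : MorphismProperty B) (Ψ : B ⥤ᵖ C) (hΨ : SendsToEquivalences W Ψ)
    (D : Type u₃) [Bicategory.{w₃, v₃} D] : (C ⥤ᵖ D) ⥤ᵖ InvertingPseudofunctor W D where
  obj F := ⟨(precomp Ψ D).obj F, fun _ _ f hf => (hΨ f hf).map F⟩
  map η := InducedBicategory.mkHom ((precomp Ψ D).map η)
  map₂ Γ := InducedBicategory.mkHom₂ ((precomp Ψ D).map₂ Γ)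
  mapId F := InducedBicategory.isoMk ((precomp Ψ D).mapId F)
  mapComp η θ := InducedBicategory.isoMk ((precomp Ψ D).mapComp η θ)
  map₂_id η := InducedBicategory.hom₂_ext ((precomp Ψ D).map₂_id η)
  map₂_comp Γ Γ' := InducedBicategory.hom₂_ext ((precomp Ψ D).map₂_comp Γ Γ')
  map₂_whisker_left η _ _ Γ :=
    InducedBicategory.hom₂_ext ((precomp Ψ D).map₂_whisker_left η Γ)
  map₂_whisker_right Γ θ :=
    InducedBicategory.hom₂_ext ((precomp Ψ D).map₂_whisker_right Γ θ)
  map₂_associator η θ ι := InducedBicategory.hom₂_ext ((precomp Ψ D).map₂_associator η θ ι)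
  map₂_left_unitor η := InducedBicategory.hom₂_ext ((precomp Ψ D).map₂_left_unitor η)
  map₂_right_unitor η := InducedBicategory.hom₂_ext ((precomp Ψ D).map₂_right_unitor η)

/-- `(C, Ψ)` is a bilocalization of `B` along `W`: `Ψ` sends `W` to equivalences, and for every
bicategory `D` composition with `Ψ` is an equivalence of bicategories
`Hom(C, D) ⟶ Hom_W(B, D)`. -/
def IsBilocalization (W : MorphismProperty B) (Ψ : B ⥤ᵖ C) : Prop :=
  ∃ hΨ : SendsToEquivalences W Ψ, ∀ (D : Type u₃) [Bicategory.{w₃, v₃} D],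
    IsEquivalenceOfBicategories (precompInverting W Ψ hΨ D)

end Bilocalization

/-! The two halves of the theorem are independent. The bilocalization is formal and exists for every
class `W` of 1-morphisms in every bicategory: adjoin an adjoint inverse of each member of `W`
freely. A pseudofunctor inverting `W` extends by evaluating words, after a choice of adjoint
inverses (`lift`). A strong transformation extends by recursion on words, its square at a formal
inverse being the mate of the inverse of the given square (`extNaturality`, `invSquare`). A
modification has components on objects only, so it remains to see that its naturality passes to
formal inverses, which is a cancellation (`ModNat.of_comp`). The calculus of fractions rests on the
fact that an LC functor does not change the sheaves. If `v` is LC and `G` is a sheaf on its target,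
then `G` restricts to a sheaf and every morphism `M ∘ v → G ∘ v` extends to `M → G`
(`IsLC.isSheaf_pull`, `IsLC.exists_hom_pull`). Morphisms into sheaves are mostly built from
relations: a subpresheaf of `M × F` which is single-valued and densely defined is contained in the
graph of a morphism `M → F` when `F` is a sheaf (`IsSheaf.exists_hom`). Any family of sheaves on a
site `A` can be adjoined as new objects (`SheafExt`); the result is subcanonical and the functor
from `A` to it is LC. For LF3, with `f : C → A` and `w : C → B` LC, adjoin to `A` the inverse images
along `f` of the presheaves `B(w -, b)`, and send `b` to the corresponding new object. The square
commutes because `B(w -, w c)` is locally isomorphic to `C(-, c)`, whose inverse image is the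
sheafification of `A(-, f c)` (`OreSquare.isIso_leg`). The functor on `B` is continuous because
restricting a sheaf along it amounts to restricting it to `C` and taking the direct image along `w`
(`OreSquare.isSheaf_pull_right`). For LF4, let `P` be continuous with subcanonical target `E`. Then
the presheaves `E(P -, e)` are sheaves, so 2-morphisms out of `P` extend uniquely along LC functors
(`IsLC.exists_natTrans`, `IsLC.natTrans_ext`); it suffices to pass to subcanonical sites. LF1 needs
that continuous functors preserve covering sieves (`LinTopology.image_mem_of_continuous`). -/

/-! ## The free bilocalization of a bicategory at a class of 1-morphisms -/

/-- The localization of a bicategory at a class `W` of 1-morphisms: it has the same objects, its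
1-morphisms are words in the 1-morphisms of `B` and formal inverses of those in `W`, and its
2-morphisms are freely generated by those of `B`, the coherence isomorphisms of a bicategory and of
a pseudofunctor, and invertible units and counits which exhibit the formal inverses as adjoint
inverses. -/
def BiLocalization {B : Type u₁} [Bicategory.{w₁, v₁} B] (_W : MorphismProperty B) := B

namespace BiLocalization

open Bicategory

section Construction

variable {B : Type u₁} [Bicategory.{w₁, v₁} B] (W : MorphismProperty B)

/-- 1-morphisms of the localization. -/
inductive Word : B → B → Type max u₁ v₁
  | of {a b : B} (f : a ⟶ b) : Word a b
  | inv {a b : B} (f : a ⟶ b) (hf : W f) : Word b a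
  | id (a : B) : Word a a
  | comp {a b c : B} (p : Word a b) (q : Word b c) : Word a c

/-- Representatives of the 2-morphisms of the localization. -/
inductive Term : ∀ {a b : B}, Word W a b → Word W a b → Type max u₁ v₁ w₁
  | id {a b} (p : Word W a b) : Term p p
  | vcomp {a b} {p q r : Word W a b} (s : Term p q) (t : Term q r) : Term p r
  | whiskerLeft {a b c} (p : Word W a b) {q r : Word W b c} (s : Term q r) :
      Term (p.comp q) (p.comp r)
  | whiskerRight {a b c} {p q : Word W a b} (r : Word W b c) (s : Term p q) :
      Term (p.comp r) (q.comp r)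
  | assoc {a b c d} (p : Word W a b) (q : Word W b c) (r : Word W c d) :
      Term ((p.comp q).comp r) (p.comp (q.comp r))
  | assocInv {a b c d} (p : Word W a b) (q : Word W b c) (r : Word W c d) :
      Term (p.comp (q.comp r)) ((p.comp q).comp r)
  | right {a b} (p : Word W a b) : Term (p.comp (.id b)) p
  | rightInv {a b} (p : Word W a b) : Term p (p.comp (.id b))
  | left {a b} (p : Word W a b) : Term ((Word.id a).comp p) p
  | leftInv {a b} (p : Word W a b) : Term p ((Word.id a).comp p)
  | of {a b : B} {f g : a ⟶ b} (α : f ⟶ g) : Term (.of f) (.of g)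
  | mapId (a : B) : Term (.of (𝟙 a)) (.id a)
  | mapIdInv (a : B) : Term (.id a) (.of (𝟙 a))
  | mapComp {a b c : B} (f : a ⟶ b) (g : b ⟶ c) : Term (.of (f ≫ g)) (.comp (.of f) (.of g))
  | mapCompInv {a b c : B} (f : a ⟶ b) (g : b ⟶ c) : Term (.comp (.of f) (.of g)) (.of (f ≫ g))
  | unit {a b : B} (f : a ⟶ b) (hf : W f) : Term (.id a) (.comp (.of f) (.inv f hf))
  | unitInv {a b : B} (f : a ⟶ b) (hf : W f) : Term (.comp (.of f) (.inv f hf)) (.id a)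
  | counit {a b : B} (f : a ⟶ b) (hf : W f) : Term (.comp (.inv f hf) (.of f)) (.id b)
  | counitInv {a b : B} (f : a ⟶ b) (hf : W f) : Term (.id b) (.comp (.inv f hf) (.of f))

section

local infixr:80 " ⊚ " => Term.vcomp
local infixr:81 " ◁' " => Term.whiskerLeft
local notation:81 s:81 " ▷' " r:82 => Term.whiskerRight r s

/-- Relations between 2-morphisms of the localization. -/
inductive Rel : ∀ {a b : B} {p q : Word W a b}, Term W p q → Term W p q → Prop
  | vcomp_right {a b} {p q r : Word W a b} (s : Term W p q) (t₁ t₂ : Term W q r) :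
      Rel t₁ t₂ → Rel (s ⊚ t₁) (s ⊚ t₂)
  | vcomp_left {a b} {p q r : Word W a b} (s₁ s₂ : Term W p q) (t : Term W q r) :
      Rel s₁ s₂ → Rel (s₁ ⊚ t) (s₂ ⊚ t)
  | id_comp {a b} {p q : Word W a b} (s : Term W p q) : Rel (.id p ⊚ s) s
  | comp_id {a b} {p q : Word W a b} (s : Term W p q) : Rel (s ⊚ .id q) s
  | assoc {a b} {p q r t : Word W a b} (s : Term W p q) (s' : Term W q r) (s'' : Term W r t) :
      Rel ((s ⊚ s') ⊚ s'') (s ⊚ s' ⊚ s'')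
  | whiskerLeft {a b c} (p : Word W a b) (q r : Word W b c) (s s' : Term W q r) :
      Rel s s' → Rel (p ◁' s) (p ◁' s')
  | whiskerLeft_id {a b c} (p : Word W a b) (q : Word W b c) : Rel (p ◁' .id q) (.id (p.comp q))
  | whiskerLeft_comp {a b c} (p : Word W a b) {q r t : Word W b c} (s : Term W q r)
      (s' : Term W r t) : Rel (p ◁' (s ⊚ s')) (p ◁' s ⊚ p ◁' s')
  | id_whiskerLeft {a b} {p q : Word W a b} (s : Term W p q) :
      Rel (Word.id a ◁' s) (.left p ⊚ s ⊚ .leftInv q)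
  | comp_whiskerLeft {a b c d} (p : Word W a b) (q : Word W b c) {r r' : Word W c d}
      (s : Term W r r') : Rel (p.comp q ◁' s) (.assoc p q r ⊚ p ◁' q ◁' s ⊚ .assocInv p q r')
  | whiskerRight {a b c} (p q : Word W a b) (r : Word W b c) (s s' : Term W p q) :
      Rel s s' → Rel (s ▷' r) (s' ▷' r)
  | id_whiskerRight {a b c} (p : Word W a b) (q : Word W b c) : Rel (.id p ▷' q) (.id (p.comp q))
  | comp_whiskerRight {a b c} {p q r : Word W a b} (t : Word W b c) (s : Term W p q)
      (s' : Term W q r) : Rel ((s ⊚ s') ▷' t) (s ▷' t ⊚ s' ▷' t)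
  | whiskerRight_id {a b} {p q : Word W a b} (s : Term W p q) :
      Rel (s ▷' Word.id b) (.right p ⊚ s ⊚ .rightInv q)
  | whiskerRight_comp {a b c d} {p p' : Word W a b} (q : Word W b c) (r : Word W c d)
      (s : Term W p p') : Rel (s ▷' q.comp r) (.assocInv p q r ⊚ s ▷' q ▷' r ⊚ .assoc p' q r)
  | whisker_assoc {a b c d} (p : Word W a b) {q q' : Word W b c} (s : Term W q q')
      (r : Word W c d) : Rel ((p ◁' s) ▷' r) (.assoc p q r ⊚ p ◁' (s ▷' r) ⊚ .assocInv p q' r)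
  | whisker_exchange {a b c} {p q : Word W a b} {r t : Word W b c} (s : Term W p q)
      (s' : Term W r t) : Rel (p ◁' s' ⊚ s ▷' t) (s ▷' r ⊚ q ◁' s')
  | assoc_assocInv {a b c d} (p : Word W a b) (q : Word W b c) (r : Word W c d) :
      Rel (.assoc p q r ⊚ .assocInv p q r) (.id _)
  | assocInv_assoc {a b c d} (p : Word W a b) (q : Word W b c) (r : Word W c d) :
      Rel (.assocInv p q r ⊚ .assoc p q r) (.id _)
  | left_leftInv {a b} (p : Word W a b) : Rel (.left p ⊚ .leftInv p) (.id _)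
  | leftInv_left {a b} (p : Word W a b) : Rel (.leftInv p ⊚ .left p) (.id _)
  | right_rightInv {a b} (p : Word W a b) : Rel (.right p ⊚ .rightInv p) (.id _)
  | rightInv_right {a b} (p : Word W a b) : Rel (.rightInv p ⊚ .right p) (.id _)
  | pentagon {a b c d e} (p : Word W a b) (q : Word W b c) (r : Word W c d) (t : Word W d e) :
      Rel (.assoc p q r ▷' t ⊚ .assoc p (q.comp r) t ⊚ p ◁' .assoc q r t)
        (.assoc (p.comp q) r t ⊚ .assoc p q (r.comp t))
  | triangle {a b c} (p : Word W a b) (q : Word W b c) :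
      Rel (.assoc p (.id b) q ⊚ p ◁' .left q) (.right p ▷' q)
  | of_id {a b : B} (f : a ⟶ b) : Rel (.of (𝟙 f)) (.id (.of f))
  | of_comp {a b : B} {f g h : a ⟶ b} (α : f ⟶ g) (β : g ⟶ h) : Rel (.of (α ≫ β)) (.of α ⊚ .of β)
  | of_whiskerLeft {a b c : B} (f : a ⟶ b) {g h : b ⟶ c} (α : g ⟶ h) :
      Rel (.of (f ◁ α)) (.mapComp f g ⊚ .of f ◁' .of α ⊚ .mapCompInv f h)
  | of_whiskerRight {a b c : B} {f g : a ⟶ b} (α : f ⟶ g) (h : b ⟶ c) :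
      Rel (.of (α ▷ h)) (.mapComp f h ⊚ .of α ▷' .of h ⊚ .mapCompInv g h)
  | of_assoc {a b c d : B} (f : a ⟶ b) (g : b ⟶ c) (h : c ⟶ d) :
      Rel (.of (α_ f g h).hom) (.mapComp (f ≫ g) h ⊚ .mapComp f g ▷' .of h ⊚ .assoc _ _ _ ⊚
        .of f ◁' .mapCompInv g h ⊚ .mapCompInv f (g ≫ h))
  | of_left {a b : B} (f : a ⟶ b) :
      Rel (.of (λ_ f).hom) (.mapComp (𝟙 a) f ⊚ .mapId a ▷' .of f ⊚ .left _)
  | of_right {a b : B} (f : a ⟶ b) :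
      Rel (.of (ρ_ f).hom) (.mapComp f (𝟙 b) ⊚ .of f ◁' .mapId b ⊚ .right _)
  | mapId_mapIdInv (a : B) : Rel (.mapId a ⊚ .mapIdInv a) (.id _)
  | mapIdInv_mapId (a : B) : Rel (.mapIdInv a ⊚ .mapId a) (.id _)
  | mapComp_mapCompInv {a b c : B} (f : a ⟶ b) (g : b ⟶ c) :
      Rel (.mapComp f g ⊚ .mapCompInv f g) (.id _)
  | mapCompInv_mapComp {a b c : B} (f : a ⟶ b) (g : b ⟶ c) :
      Rel (.mapCompInv f g ⊚ .mapComp f g) (.id _)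
  | unit_unitInv {a b : B} (f : a ⟶ b) (hf : W f) : Rel (.unit f hf ⊚ .unitInv f hf) (.id _)
  | unitInv_unit {a b : B} (f : a ⟶ b) (hf : W f) : Rel (.unitInv f hf ⊚ .unit f hf) (.id _)
  | counit_counitInv {a b : B} (f : a ⟶ b) (hf : W f) :
      Rel (.counit f hf ⊚ .counitInv f hf) (.id _)
  | counitInv_counit {a b : B} (f : a ⟶ b) (hf : W f) :
      Rel (.counitInv f hf ⊚ .counit f hf) (.id _)
  -- One triangle identity suffices: as unit and counit are invertible, the other one follows.
  | zigzag {a b : B} (f : a ⟶ b) (hf : W f) :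
      Rel (.unit f hf ▷' .of f ⊚ .assoc _ _ _ ⊚ .of f ◁' .counit f hf)
        (.left (.of f) ⊚ .rightInv (.of f))

end

instance : CategoryStruct (BiLocalization W) where
  Hom a b := Word (B := B) W a b
  id a := Word.id (B := B) a
  comp p q := Word.comp p q

instance homCategory (a b : BiLocalization W) : Category (a ⟶ b) where
  Hom p q := Quot (Rel (a := a) (b := b) (p := p) (q := q) W)
  id p := Quot.mk _ (Term.id p)
  comp := Quot.map₂ Term.vcomp Rel.vcomp_right Rel.vcomp_left
  id_comp := by
    rintro p q ⟨s⟩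
    exact Quot.sound (Rel.id_comp s)
  comp_id := by
    rintro p q ⟨s⟩
    exact Quot.sound (Rel.comp_id s)
  assoc := by
    rintro p q r t ⟨s⟩ ⟨s'⟩ ⟨s''⟩
    exact Quot.sound (Rel.assoc s s' s'')

/-- Bicategory structure on the localization. -/
instance bicategory : Bicategory (BiLocalization W) where
  homCategory a b := homCategory W a b
  whiskerLeft p q r s := Quot.map (Term.whiskerLeft p) (Rel.whiskerLeft p q r) s
  whiskerLeft_id p q := Quot.sound (Rel.whiskerLeft_id p q)
  associator p q r :=
    { hom := Quot.mk _ (Term.assoc p q r)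
      inv := Quot.mk _ (Term.assocInv p q r)
      hom_inv_id := Quot.sound (Rel.assoc_assocInv p q r)
      inv_hom_id := Quot.sound (Rel.assocInv_assoc p q r) }
  leftUnitor p :=
    { hom := Quot.mk _ (Term.left p)
      inv := Quot.mk _ (Term.leftInv p)
      hom_inv_id := Quot.sound (Rel.left_leftInv p)
      inv_hom_id := Quot.sound (Rel.leftInv_left p) }
  rightUnitor p :=
    { hom := Quot.mk _ (Term.right p)
      inv := Quot.mk _ (Term.rightInv p)
      hom_inv_id := Quot.sound (Rel.right_rightInv p)
      inv_hom_id := Quot.sound (Rel.rightInv_right p) }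
  whiskerLeft_comp := by
    rintro a b c p q r t ⟨s⟩ ⟨s'⟩
    exact Quot.sound (Rel.whiskerLeft_comp p s s')
  id_whiskerLeft := by
    rintro a b p q ⟨s⟩
    exact Quot.sound (Rel.id_whiskerLeft s)
  comp_whiskerLeft := by
    rintro a b c d p q r r' ⟨s⟩
    exact Quot.sound (Rel.comp_whiskerLeft p q s)
  whiskerRight {_ _ _} p q s r := Quot.map (Term.whiskerRight r) (Rel.whiskerRight p q r) s
  id_whiskerRight p q := Quot.sound (Rel.id_whiskerRight p q)
  comp_whiskerRight := by
    rintro a b c p q r ⟨s⟩ ⟨s'⟩ t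
    exact Quot.sound (Rel.comp_whiskerRight t s s')
  whiskerRight_id := by
    rintro a b p q ⟨s⟩
    exact Quot.sound (Rel.whiskerRight_id s)
  whiskerRight_comp := by
    rintro a b c d p p' ⟨s⟩ q r
    exact Quot.sound (Rel.whiskerRight_comp q r s)
  whisker_assoc := by
    rintro a b c d p q q' ⟨s⟩ r
    exact Quot.sound (Rel.whisker_assoc p s r)
  whisker_exchange := by
    rintro a b c p q r t ⟨s⟩ ⟨s'⟩
    exact Quot.sound (Rel.whisker_exchange s s')
  pentagon p q r t := Quot.sound (Rel.pentagon p q r t)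
  triangle p q := Quot.sound (Rel.triangle p q)

variable {W}

/-- The 2-morphism represented by a term. -/
def mk₂ {a b : BiLocalization W} {p q : a ⟶ b} (s : Term (B := B) W p q) : p ⟶ q := Quot.mk _ s

variable (W)

/-- An object of the localization. -/
def ofObj (a : B) : BiLocalization W := a

/-- A 1-morphism of the localization. -/
def ofHom {a b : B} (f : a ⟶ b) : ofObj W a ⟶ ofObj W b := Word.of f

/-- The canonical pseudofunctor to the localization. -/
def toLocalization : B ⥤ᵖ BiLocalization W where
  obj a := ofObj W a
  map f := ofHom W f
  map₂ α := mk₂ (Term.of α)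
  map₂_id f := Quot.sound (Rel.of_id f)
  map₂_comp α β := Quot.sound (Rel.of_comp α β)
  mapId a :=
    { hom := mk₂ (Term.mapId a)
      inv := mk₂ (Term.mapIdInv a)
      hom_inv_id := Quot.sound (Rel.mapId_mapIdInv a)
      inv_hom_id := Quot.sound (Rel.mapIdInv_mapId a) }
  mapComp f g :=
    { hom := mk₂ (Term.mapComp f g)
      inv := mk₂ (Term.mapCompInv f g)
      hom_inv_id := Quot.sound (Rel.mapComp_mapCompInv f g)
      inv_hom_id := Quot.sound (Rel.mapCompInv_mapComp f g) }
  map₂_whisker_left f _ _ α := Quot.sound (Rel.of_whiskerLeft f α)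
  map₂_whisker_right α h := Quot.sound (Rel.of_whiskerRight α h)
  map₂_associator f g h := Quot.sound (Rel.of_assoc f g h)
  map₂_left_unitor f := Quot.sound (Rel.of_left f)
  map₂_right_unitor f := Quot.sound (Rel.of_right f)

/-- The formal inverse of a 1-morphism in `W`. -/
def formalInv {a b : B} (f : a ⟶ b) (hf : W f) :
    (toLocalization W).obj b ⟶ (toLocalization W).obj a := Word.inv f hf

/-- The unit of a formal inverse. -/
def unitIso {a b : B} (f : a ⟶ b) (hf : W f) :
    𝟙 ((toLocalization W).obj a) ≅ (toLocalization W).map f ≫ formalInv W f hf where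
  hom := mk₂ (Term.unit f hf)
  inv := mk₂ (Term.unitInv f hf)
  hom_inv_id := Quot.sound (Rel.unit_unitInv f hf)
  inv_hom_id := Quot.sound (Rel.unitInv_unit f hf)

/-- The counit of a formal inverse. -/
def counitIso {a b : B} (f : a ⟶ b) (hf : W f) :
    formalInv W f hf ≫ (toLocalization W).map f ≅ 𝟙 ((toLocalization W).obj b) where
  hom := mk₂ (Term.counit f hf)
  inv := mk₂ (Term.counitInv f hf)
  hom_inv_id := Quot.sound (Rel.counit_counitInv f hf)
  inv_hom_id := Quot.sound (Rel.counitInv_counit f hf)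

theorem zigzag {a b : B} (f : a ⟶ b) (hf : W f) :
    (unitIso W f hf).hom ▷ (toLocalization W).map f ≫ (α_ _ _ _).hom ≫
        (toLocalization W).map f ◁ (counitIso W f hf).hom =
      (λ_ _).hom ≫ (ρ_ _).inv :=
  Quot.sound (Rel.zigzag f hf)

theorem sendsToEquivalences_toLocalization : SendsToEquivalences W (toLocalization W) :=
  fun _ _ f hf => ⟨Equivalence.mkOfAdjointifyCounit (g := formalInv W f hf)
    (unitIso W f hf) (counitIso W f hf), rfl⟩

end Construction

/-! ### Extension of pseudofunctors to the localization -/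

section Lift

variable {B : Type u₁} [Bicategory.{w₁, v₁} B] {W : MorphismProperty B}
  {D : Type u₃} [Bicategory.{w₃, v₃} D]

/-- An adjoint inverse of a 1-morphism. -/
structure AdjointInverse {x y : D} (f : x ⟶ y) where
  inv : y ⟶ x
  unit : 𝟙 x ≅ f ≫ inv
  counit : inv ≫ f ≅ 𝟙 y
  zigzag : unit.hom ▷ f ≫ (α_ _ _ _).hom ≫ f ◁ counit.hom = (λ_ _).hom ≫ (ρ_ _).inv

theorem nonempty_adjointInverse {x y : D} {f : x ⟶ y} (hf : IsEquivalence₁ f) :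
    Nonempty (AdjointInverse f) := by
  obtain ⟨e, rfl⟩ := hf
  refine ⟨⟨e.inv, e.unit, e.counit, ?_⟩⟩
  have := congrArg Iso.hom e.left_triangle
  simpa [leftZigzagIso, leftZigzag, bicategoricalComp] using this

variable (F : B ⥤ᵖ D) (E : ∀ {a b : B} (f : a ⟶ b), W f → AdjointInverse (F.map f))

/-- Evaluation of words. -/
def wordInterp : ∀ {a b : B}, Word W a b → (F.obj a ⟶ F.obj b)
  | _, _, .of f => F.map f
  | _, _, .inv f hf => (E f hf).inv
  | _, _, .id a => 𝟙 (F.obj a)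
  | _, _, .comp p q => wordInterp p ≫ wordInterp q

/-- Evaluation of terms. -/
def termInterp : ∀ {a b : B} {p q : Word W a b}, Term W p q → (wordInterp F E p ⟶ wordInterp F E q)
  | _, _, _, _, .id _ => 𝟙 _
  | _, _, _, _, .vcomp s t => termInterp s ≫ termInterp t
  | _, _, _, _, .whiskerLeft p s => wordInterp F E p ◁ termInterp s
  | _, _, _, _, .whiskerRight r s => termInterp s ▷ wordInterp F E r
  | _, _, _, _, .assoc _ _ _ => (α_ _ _ _).hom
  | _, _, _, _, .assocInv _ _ _ => (α_ _ _ _).inv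
  | _, _, _, _, .right _ => (ρ_ _).hom
  | _, _, _, _, .rightInv _ => (ρ_ _).inv
  | _, _, _, _, .left _ => (λ_ _).hom
  | _, _, _, _, .leftInv _ => (λ_ _).inv
  | _, _, _, _, .of α => F.map₂ α
  | _, _, _, _, .mapId a => (F.mapId a).hom
  | _, _, _, _, .mapIdInv a => (F.mapId a).inv
  | _, _, _, _, .mapComp f g => (F.mapComp f g).hom
  | _, _, _, _, .mapCompInv f g => (F.mapComp f g).inv
  | _, _, _, _, .unit f hf => (E f hf).unit.hom
  | _, _, _, _, .unitInv f hf => (E f hf).unit.inv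
  | _, _, _, _, .counit f hf => (E f hf).counit.hom
  | _, _, _, _, .counitInv f hf => (E f hf).counit.inv

/-- Every generating relation is an axiom of the bicategory `D`, of the pseudofunctor `F` or of the
chosen adjoint inverses, or a congruence. -/
theorem termInterp_congr {a b : B} {p q : Word W a b} {s t : Term W p q} (h : Rel W s t) :
    termInterp F E s = termInterp F E t := by
  induction h with
  | vcomp_right s t₁ t₂ _ ih => simp only [termInterp, ih]
  | vcomp_left s₁ s₂ t _ ih => simp only [termInterp, ih]
  | whiskerLeft p q r s s' _ ih => exact congrArg (wordInterp F E p ◁ ·) ih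
  | whiskerRight p q r s s' _ ih => exact congrArg (· ▷ wordInterp F E r) ih
  | whisker_exchange s s' => exact whisker_exchange _ _
  | zigzag f hf => exact (E f hf).zigzag
  | _ => simp [termInterp, wordInterp]

/-- The extension of an inverting pseudofunctor to the localization. -/
def lift : BiLocalization W ⥤ᵖ D where
  obj a := F.obj a
  map p := wordInterp F E p
  map₂ := Quot.lift (termInterp F E) fun _ _ h => termInterp_congr F E h
  map₂_id _ := rfl
  map₂_comp := by
    rintro a b p q r ⟨s⟩ ⟨t⟩
    rfl
  mapId a := Iso.refl _
  mapComp p q := Iso.refl _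
  map₂_whisker_left := by
    rintro a b c p q r ⟨s⟩
    exact (Category.comp_id _).symm.trans (Category.id_comp _).symm
  map₂_whisker_right := by
    rintro a b c p q ⟨s⟩ r
    exact (Category.comp_id _).symm.trans (Category.id_comp _).symm
  map₂_associator p q r := by
    change (α_ (wordInterp F E p) (wordInterp F E q) (wordInterp F E r)).hom = 𝟙 _ ≫
      𝟙 (wordInterp F E p ≫ wordInterp F E q) ▷ wordInterp F E r ≫ (α_ _ _ _).hom ≫
        wordInterp F E p ◁ 𝟙 (wordInterp F E q ≫ wordInterp F E r) ≫ 𝟙 _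
    simp
  map₂_left_unitor p := by
    change (λ_ (wordInterp F E p)).hom = 𝟙 _ ≫ 𝟙 (𝟙 _) ▷ wordInterp F E p ≫ (λ_ _).hom
    simp
  map₂_right_unitor p := by
    change (ρ_ (wordInterp F E p)).hom = 𝟙 _ ≫ wordInterp F E p ◁ 𝟙 (𝟙 _) ≫ (ρ_ _).hom
    simp

/-- Words compose formally, so the constraints of `lift` are identities and the extension is strict:
an equality of pseudofunctors, not only an equivalence. -/
theorem toLocalization_comp_lift : (toLocalization W).comp (lift F E) = F := by
  have h₁ : ((toLocalization W).comp (lift F E)).mapId = F.mapId := by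
    funext a
    exact Iso.ext (Category.comp_id (F.mapId a).hom)
  have h₂ : @Pseudofunctor.mapComp _ _ _ _ ((toLocalization W).comp (lift F E)) =
      @Pseudofunctor.mapComp _ _ _ _ F := by
    funext a b c f g
    exact Iso.ext (Category.comp_id (F.mapComp f g).hom)
  change Pseudofunctor.mk F.toPrelaxFunctor _ _ _ _ _ _ _ = Pseudofunctor.mk _ _ _ _ _ _ _ _
  congr 1

end Lift

end BiLocalization
/-! ### Squares in a bicategory -/

namespace BicategorySquare

open Bicategory BiLocalization

variable {D : Type u₃} [Bicategory.{w₃, v₃} D]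

section

variable {x y z t x' y' z' t' : D} {f f₁ f₂ f₃ : x ⟶ y} {f' f₁' f₂' f₃' : y ⟶ z} {f'' : z ⟶ t}
  {g g₁ g₂ g₃ : x' ⟶ y'} {g' g₁' g₂' g₃' : y' ⟶ z'} {g'' : z' ⟶ t'}
  {φ : x ⟶ x'} {χ : y ⟶ y'} {ψ : z ⟶ z'} {ω : t ⟶ t'}

/-- The pair `(α, β)` of 2-morphisms is compatible with the squares `σ₁` and `σ₂`. -/
def Compat (σ₁ : f₁ ≫ χ ≅ φ ≫ g₁) (σ₂ : f₂ ≫ χ ≅ φ ≫ g₂) (α : f₁ ⟶ f₂) (β : g₁ ⟶ g₂) : Prop :=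
  α ▷ χ ≫ σ₂.hom = σ₁.hom ≫ φ ◁ β

/-- Horizontal composition of invertible squares. -/
def hcomp (σ : f ≫ χ ≅ φ ≫ g) (τ : f' ≫ ψ ≅ χ ≫ g') : (f ≫ f') ≫ ψ ≅ φ ≫ g ≫ g' :=
  α_ _ _ _ ≪≫ whiskerLeftIso f τ ≪≫ (α_ _ _ _).symm ≪≫ whiskerRightIso σ g' ≪≫ α_ _ _ _

/-- The identity square. -/
def idSquare (φ : x ⟶ x') : 𝟙 x ≫ φ ≅ φ ≫ 𝟙 x' := λ_ φ ≪≫ (ρ_ φ).symm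

/-- Transport of a square along isomorphisms. -/
def conj (σ : f₂ ≫ χ ≅ φ ≫ g₂) (α : f₁ ≅ f₂) (β : g₁ ≅ g₂) : f₁ ≫ χ ≅ φ ≫ g₁ :=
  whiskerRightIso α χ ≪≫ σ ≪≫ whiskerLeftIso φ β.symm

theorem compat_conj (σ : f₂ ≫ χ ≅ φ ≫ g₂) (α : f₁ ≅ f₂) (β : g₁ ≅ g₂) :
    Compat (conj σ α β) σ α.hom β.hom := by
  simp [Compat, conj]

theorem Compat.id (σ : f ≫ χ ≅ φ ≫ g) : Compat σ σ (𝟙 f) (𝟙 g) := by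
  simp [Compat]

theorem Compat.congr {σ₁ : f₁ ≫ χ ≅ φ ≫ g₁} {σ₂ : f₂ ≫ χ ≅ φ ≫ g₂} {α α' : f₁ ⟶ f₂}
    {β β' : g₁ ⟶ g₂} (h : Compat σ₁ σ₂ α β) (hα : α' = α) (hβ : β' = β) :
    Compat σ₁ σ₂ α' β' := by
  rwa [hα, hβ]

theorem Compat.comp {σ₁ : f₁ ≫ χ ≅ φ ≫ g₁} {σ₂ : f₂ ≫ χ ≅ φ ≫ g₂} {σ₃ : f₃ ≫ χ ≅ φ ≫ g₃}
    {α : f₁ ⟶ f₂} {β : g₁ ⟶ g₂} {α' : f₂ ⟶ f₃} {β' : g₂ ⟶ g₃} (h : Compat σ₁ σ₂ α β)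
    (h' : Compat σ₂ σ₃ α' β') : Compat σ₁ σ₃ (α ≫ α') (β ≫ β') := by
  unfold Compat at *
  rw [comp_whiskerRight, Category.assoc, h', reassoc_of% h, Bicategory.whiskerLeft_comp]

theorem Compat.inv {σ₁ : f₁ ≫ χ ≅ φ ≫ g₁} {σ₂ : f₂ ≫ χ ≅ φ ≫ g₂}
    {α : f₁ ≅ f₂} {β : g₁ ≅ g₂} (h : Compat σ₁ σ₂ α.hom β.hom) : Compat σ₂ σ₁ α.inv β.inv := by
  unfold Compat at *
  rw [← cancel_mono (φ ◁ β.hom), Category.assoc, ← h]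
  simp

theorem Compat.whiskerLeft (σ : f ≫ χ ≅ φ ≫ g) {τ₁ : f₁' ≫ ψ ≅ χ ≫ g₁'} {τ₂ : f₂' ≫ ψ ≅ χ ≫ g₂'}
    {α : f₁' ⟶ f₂'} {β : g₁' ⟶ g₂'} (h : Compat τ₁ τ₂ α β) :
    Compat (hcomp σ τ₁) (hcomp σ τ₂) (f ◁ α) (g ◁ β) := by
  unfold Compat at *
  simp only [hcomp, Iso.trans_hom, whiskerLeftIso_hom, Iso.symm_hom, whiskerRightIso_hom,
    whisker_assoc, Category.assoc, Iso.inv_hom_id_assoc]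
  rw [← Bicategory.whiskerLeft_comp_assoc, h]
  simp only [Bicategory.whiskerLeft_comp, Category.assoc]
  rw [associator_inv_naturality_right_assoc, whisker_exchange_assoc]
  simp

theorem Compat.whiskerRight {σ₁ : f₁ ≫ χ ≅ φ ≫ g₁} {σ₂ : f₂ ≫ χ ≅ φ ≫ g₂} (τ : f' ≫ ψ ≅ χ ≫ g')
    {α : f₁ ⟶ f₂} {β : g₁ ⟶ g₂} (h : Compat σ₁ σ₂ α β) :
    Compat (hcomp σ₁ τ) (hcomp σ₂ τ) (α ▷ f') (β ▷ g') := by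
  unfold Compat at *
  simp only [hcomp, Iso.trans_hom, whiskerLeftIso_hom, Iso.symm_hom, whiskerRightIso_hom,
    Category.assoc]
  rw [associator_naturality_left_assoc, ← whisker_exchange_assoc,
    associator_inv_naturality_left_assoc, ← comp_whiskerRight_assoc, h]
  simp

theorem compat_associator (σ : f ≫ χ ≅ φ ≫ g) (τ : f' ≫ ψ ≅ χ ≫ g') (ρ : f'' ≫ ω ≅ ψ ≫ g'') :
    Compat (hcomp (hcomp σ τ) ρ) (hcomp σ (hcomp τ ρ)) (α_ _ _ _).hom (α_ _ _ _).hom := by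
  simp only [Compat, hcomp, Iso.trans_hom, whiskerLeftIso_hom, Iso.symm_hom, whiskerRightIso_hom]
  bicategory

theorem compat_leftUnitor (σ : f ≫ χ ≅ φ ≫ g) :
    Compat (hcomp (idSquare φ) σ) σ (λ_ _).hom (λ_ _).hom := by
  simp only [Compat, hcomp, idSquare, Iso.trans_hom, whiskerLeftIso_hom, Iso.symm_hom,
    whiskerRightIso_hom]
  bicategory

theorem compat_rightUnitor (σ : f ≫ χ ≅ φ ≫ g) :
    Compat (hcomp σ (idSquare χ)) σ (ρ_ _).hom (ρ_ _).hom := by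
  simp only [Compat, hcomp, idSquare, Iso.trans_hom, whiskerLeftIso_hom, Iso.symm_hom,
    whiskerRightIso_hom]
  bicategory

/-- The square on adjoint inverses induced by an invertible square. -/
def invSquare (X : AdjointInverse f) (Y : AdjointInverse g) (σ : f ≫ χ ≅ φ ≫ g) :
    X.inv ≫ φ ≅ χ ≫ Y.inv :=
  -- The mate of the inverse of `σ`: create `g ≫ Y.inv` with the unit of `Y`, replace `φ ≫ g` by `f
  -- ≫ χ`, and remove `X.inv ≫ f` with the counit of `X`.
  whiskerLeftIso X.inv ((ρ_ φ).symm ≪≫ whiskerLeftIso φ Y.unit ≪≫ (α_ _ _ _).symm ≪≫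
      whiskerRightIso σ.symm Y.inv ≪≫ α_ _ _ _) ≪≫
    (α_ _ _ _).symm ≪≫ whiskerRightIso X.counit _ ≪≫ λ_ _

/-- The triangle identity of `X` cancels its unit against the counit inside the mate; what remains
is `σ.inv ≫ σ.hom`. -/
theorem compat_unit (X : AdjointInverse f) (Y : AdjointInverse g) (σ : f ≫ χ ≅ φ ≫ g) :
    Compat (idSquare φ) (hcomp σ (invSquare X Y σ)) X.unit.hom Y.unit.hom := by
  simp only [Compat, hcomp, idSquare, invSquare, Iso.trans_hom, whiskerLeftIso_hom, Iso.symm_hom,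
    whiskerRightIso_hom]
  calc
    _ = 𝟙 _ ⊗≫ (X.unit.hom ▷ φ ≫ (f ≫ X.inv) ◁ ((ρ_ φ).inv ≫ φ ◁ Y.unit.hom ≫ (α_ _ _ _).inv ≫
          σ.inv ▷ Y.inv)) ⊗≫ f ◁ X.counit.hom ▷ (χ ≫ Y.inv) ⊗≫ σ.hom ▷ Y.inv ⊗≫ 𝟙 _ := by
      bicategory
    _ = 𝟙 _ ⊗≫ φ ◁ Y.unit.hom ⊗≫ σ.inv ▷ Y.inv ⊗≫ (X.unit.hom ▷ f ⊗≫ f ◁ X.counit.hom) ▷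
          (χ ≫ Y.inv) ⊗≫ σ.hom ▷ Y.inv ⊗≫ 𝟙 _ := by
      rw [← whisker_exchange]
      bicategory
    _ = 𝟙 _ ⊗≫ φ ◁ Y.unit.hom ⊗≫ (σ.inv ≫ σ.hom) ▷ Y.inv ⊗≫ 𝟙 _ := by
      have := X.zigzag
      rw [show X.unit.hom ▷ f ⊗≫ f ◁ X.counit.hom = (λ_ _).hom ≫ (ρ_ _).inv by
        rw [← this]; bicategory]
      bicategory
    _ = _ := by
      rw [Iso.inv_hom_id]
      bicategory

/-- Dual to `compat_unit`: two interchanges bring the unit and counit of `Y` together, the triangle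
identity of `Y` cancels them, and `σ.hom ≫ σ.inv` remains. -/
theorem compat_counit (X : AdjointInverse f) (Y : AdjointInverse g) (σ : f ≫ χ ≅ φ ≫ g) :
    Compat (hcomp (invSquare X Y σ) σ) (idSquare χ) X.counit.hom Y.counit.hom := by
  simp only [Compat, hcomp, idSquare, invSquare, Iso.trans_hom, whiskerLeftIso_hom, Iso.symm_hom,
    whiskerRightIso_hom]
  symm
  calc
    _ = 𝟙 _ ⊗≫ X.inv ◁ σ.hom ⊗≫ X.inv ◁ φ ◁ Y.unit.hom ▷ g ⊗≫ X.inv ◁ σ.inv ▷ (Y.inv ≫ g) ⊗≫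
          (X.counit.hom ▷ (χ ≫ (Y.inv ≫ g)) ≫ 𝟙 _ ◁ (χ ◁ Y.counit.hom)) ⊗≫ 𝟙 _ := by
      bicategory
    _ = 𝟙 _ ⊗≫ X.inv ◁ σ.hom ⊗≫ X.inv ◁ φ ◁ Y.unit.hom ▷ g ⊗≫ X.inv ◁ (σ.inv ▷ (Y.inv ≫ g) ≫
          (f ≫ χ) ◁ Y.counit.hom) ⊗≫ X.counit.hom ▷ χ ⊗≫ 𝟙 _ := by
      rw [← whisker_exchange]
      bicategory
    _ = 𝟙 _ ⊗≫ X.inv ◁ σ.hom ⊗≫ X.inv ◁ φ ◁ (Y.unit.hom ▷ g ⊗≫ g ◁ Y.counit.hom) ⊗≫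
          X.inv ◁ σ.inv ⊗≫ X.counit.hom ▷ χ ⊗≫ 𝟙 _ := by
      rw [← whisker_exchange]
      bicategory
    _ = 𝟙 _ ⊗≫ X.inv ◁ (σ.hom ≫ σ.inv) ⊗≫ X.counit.hom ▷ χ ⊗≫ 𝟙 _ := by
      have := Y.zigzag
      rw [show Y.unit.hom ▷ g ⊗≫ g ◁ Y.counit.hom = (λ_ _).hom ≫ (ρ_ _).inv by
        rw [← this]; bicategory]
      bicategory
    _ = _ := by
      rw [Iso.hom_inv_id]
      bicategory

/-- The pair `(γ, δ)` of 2-morphisms is a modification of the squares `σ` and `σ'`. -/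
def ModCompat {φ₁ φ₂ : x ⟶ x'} {χ₁ χ₂ : y ⟶ y'} (σ₁ : f ≫ χ₁ ≅ φ₁ ≫ g) (σ₂ : f ≫ χ₂ ≅ φ₂ ≫ g)
    (γ : φ₁ ⟶ φ₂) (δ : χ₁ ⟶ χ₂) : Prop :=
  f ◁ δ ≫ σ₂.hom = σ₁.hom ≫ γ ▷ g

section

variable {φ₁ φ₂ : x ⟶ x'} {χ₁ χ₂ : y ⟶ y'} {ψ₁ ψ₂ : z ⟶ z'}
  {γ : φ₁ ⟶ φ₂} {δ : χ₁ ⟶ χ₂} {ζ : ψ₁ ⟶ ψ₂}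

theorem modCompat_idSquare (γ : φ₁ ⟶ φ₂) : ModCompat (idSquare φ₁) (idSquare φ₂) γ γ := by
  simp [ModCompat, idSquare]

theorem ModCompat.conj {σ₁ : f₂ ≫ χ₁ ≅ φ₁ ≫ g₂} {σ₂ : f₂ ≫ χ₂ ≅ φ₂ ≫ g₂}
    (h : ModCompat σ₁ σ₂ γ δ) (α : f₁ ≅ f₂) (β : g₁ ≅ g₂) :
    ModCompat (conj σ₁ α β) (conj σ₂ α β) γ δ := by
  unfold ModCompat at *
  simp only [BicategorySquare.conj, Iso.trans_hom, whiskerRightIso_hom, whiskerLeftIso_hom,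
    Iso.symm_hom, Category.assoc]
  rw [whisker_exchange_assoc, reassoc_of% h, whisker_exchange]

theorem ModCompat.hcomp {σ₁ : f ≫ χ₁ ≅ φ₁ ≫ g} {σ₂ : f ≫ χ₂ ≅ φ₂ ≫ g}
    {τ₁ : f' ≫ ψ₁ ≅ χ₁ ≫ g'} {τ₂ : f' ≫ ψ₂ ≅ χ₂ ≫ g'} (h : ModCompat σ₁ σ₂ γ δ)
    (h' : ModCompat τ₁ τ₂ δ ζ) : ModCompat (hcomp σ₁ τ₁) (hcomp σ₂ τ₂) γ ζ := by
  unfold ModCompat at *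
  simp only [BicategorySquare.hcomp, Iso.trans_hom, whiskerLeftIso_hom, Iso.symm_hom,
    whiskerRightIso_hom, Category.assoc]
  rw [associator_naturality_right_assoc, ← Bicategory.whiskerLeft_comp_assoc, h',
    Bicategory.whiskerLeft_comp_assoc, associator_inv_naturality_middle_assoc,
    ← comp_whiskerRight_assoc, h, comp_whiskerRight_assoc, associator_naturality_left]

/-- Half of a two-out-of-three property: from the left square and the composite one gets the right
square only after whiskering with `f`. When `f` has an adjoint inverse the whiskering can be
removed. -/
theorem ModCompat.of_hcomp {σ₁ : f ≫ χ₁ ≅ φ₁ ≫ g} {σ₂ : f ≫ χ₂ ≅ φ₂ ≫ g}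
    {τ₁ : f' ≫ ψ₁ ≅ χ₁ ≫ g'} {τ₂ : f' ≫ ψ₂ ≅ χ₂ ≫ g'} (h : ModCompat σ₁ σ₂ γ δ)
    (h' : ModCompat (BicategorySquare.hcomp σ₁ τ₁) (BicategorySquare.hcomp σ₂ τ₂) γ ζ) :
    f ◁ (f' ◁ ζ ≫ τ₂.hom) = f ◁ (τ₁.hom ≫ δ ▷ g') := by
  unfold ModCompat at *
  simp only [BicategorySquare.hcomp, Iso.trans_hom, whiskerLeftIso_hom, Iso.symm_hom,
    whiskerRightIso_hom, Category.assoc] at h'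
  rw [← associator_naturality_left, ← comp_whiskerRight_assoc, ← h, comp_whiskerRight_assoc,
    ← associator_inv_naturality_middle_assoc, associator_naturality_right_assoc,
    cancel_epi, ← Bicategory.whiskerLeft_comp_assoc, ← Bicategory.whiskerLeft_comp_assoc] at h'
  simpa only [← Category.assoc, cancel_mono] using h'

end

end

end BicategorySquare
/-! ### The universal property of the localization -/

namespace BiLocalization

open Bicategory BicategorySquare

section Equivalence

variable {C : Type u₂} [Bicategory.{w₂, v₂} C] {D : Type u₃} [Bicategory.{w₃, v₃} D]

/-- The image of an adjoint inverse under a pseudofunctor. -/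
def AdjointInverse.map (F : C ⥤ᵖ D) {x y : C} {f : x ⟶ y} (X : AdjointInverse f) :
    AdjointInverse (F.map f) where
  inv := F.map X.inv
  unit := (F.mapId x).symm ≪≫ F.map₂Iso X.unit ≪≫ F.mapComp _ _
  counit := (F.mapComp _ _).symm ≪≫ F.map₂Iso X.counit ≪≫ F.mapId y
  zigzag := by
    have h := congrArg F.map₂ X.zigzag
    simp only [PrelaxFunctor.map₂_comp, Pseudofunctor.map₂_whisker_right,
      Pseudofunctor.map₂_associator, Pseudofunctor.map₂_whisker_left,
      Pseudofunctor.map₂_left_unitor, Category.assoc, Iso.inv_hom_id_assoc, cancel_epi] at h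
    -- Composing with the unit constraints of `F` at both ends makes those coming from the unitors
    -- cancel.
    have h' := congrArg (fun t => (F.mapId x).inv ▷ F.map f ≫ t ≫ (F.mapComp f (𝟙 y)).hom ≫
      F.map f ◁ (F.mapId y).hom) h
    simp only [Category.assoc, F.mapComp_id_right_hom, ← F.map₂_comp_assoc,
      Iso.inv_hom_id, PrelaxFunctor.map₂_id, Category.id_comp, inv_hom_whiskerRight_assoc] at h'
    simpa using h'

/-- A 2-morphism is recovered from its whiskering with `f` by whiskering further with the inverse
and conjugating with the counit. -/
theorem AdjointInverse.whiskerLeft_injective {x y z : D} {f : x ⟶ y} (X : AdjointInverse f)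
    {g h : y ⟶ z} {α β : g ⟶ h} (e : f ◁ α = f ◁ β) : α = β := by
  have h₁ : ∀ γ : g ⟶ h, γ = (λ_ g).inv ≫ X.counit.inv ▷ g ≫ (α_ _ _ _).hom ≫ X.inv ◁ f ◁ γ ≫
      (α_ _ _ _).inv ≫ X.counit.hom ▷ h ≫ (λ_ h).hom := by
    intro γ
    rw [associator_inv_naturality_right_assoc, whisker_exchange_assoc]
    simp
  rw [h₁ α, h₁ β, e]

section

variable (F : C ⥤ᵖ D) {a b c d : C}

/-- This expansion and the next four are bracketed like the chains of `Compat.comp` in which they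
are used. -/
theorem map₂_whiskerLeft_eq (p : a ⟶ b) {q r : b ⟶ c} (s : q ⟶ r) :
    F.map₂ (p ◁ s) = ((F.mapComp p q).hom ≫ F.map p ◁ F.map₂ s) ≫ (F.mapComp p r).inv := by
  simp

theorem map₂_whiskerRight_eq {p q : a ⟶ b} (s : p ⟶ q) (r : b ⟶ c) :
    F.map₂ (s ▷ r) = ((F.mapComp p r).hom ≫ F.map₂ s ▷ F.map r) ≫ (F.mapComp q r).inv := by
  simp

theorem map₂_associator_eq (p : a ⟶ b) (q : b ⟶ c) (r : c ⟶ d) :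
    F.map₂ (α_ p q r).hom = ((((F.mapComp (p ≫ q) r).hom ≫ (F.mapComp p q).hom ▷ F.map r) ≫
      (α_ _ _ _).hom) ≫ F.map p ◁ (F.mapComp q r).inv) ≫ (F.mapComp p (q ≫ r)).inv := by
  simp

theorem map₂_leftUnitor_eq (p : a ⟶ b) : F.map₂ (λ_ p).hom =
    ((F.mapComp (𝟙 a) p).hom ≫ (F.mapId a).hom ▷ F.map p) ≫ (λ_ _).hom := by
  simp

theorem map₂_rightUnitor_eq (p : a ⟶ b) : F.map₂ (ρ_ p).hom =
    ((F.mapComp p (𝟙 b)).hom ≫ F.map p ◁ (F.mapId b).hom) ≫ (ρ_ _).hom := by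
  simp

end

end Equivalence

/-! ### Extension of strong transformations to the localization -/

section Extension

variable {B : Type u₁} [Bicategory.{w₁, v₁} B] (W : MorphismProperty B)
  {D : Type u₃} [Bicategory.{w₃, v₃} D]

/-- The formal inverse as an adjoint inverse. -/
def adjointInverse {a b : B} (f : a ⟶ b) (hf : W f) :
    AdjointInverse ((toLocalization W).map f) where
  inv := formalInv W f hf
  unit := unitIso W f hf
  counit := counitIso W f hf
  zigzag := zigzag W f hf

variable {W} {F G : BiLocalization W ⥤ᵖ D}
  (η : (toLocalization W).comp F ⟶ (toLocalization W).comp G)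

/-- The extension of the naturality isomorphisms of a strong transformation to words. -/
def extNaturality : ∀ {a b : B} (p : Word W a b),
    F.map (X := ofObj W a) (Y := ofObj W b) p ≫ η.app b ≅
      η.app a ≫ G.map (X := ofObj W a) (Y := ofObj W b) p
  | _, _, .of f => η.naturality f
  -- The choice for which the units and counits of the formal inverses are natural, by `compat_unit`
  -- and `compat_counit`.
  | _, _, .inv f hf => invSquare ((adjointInverse W f hf).map F) ((adjointInverse W f hf).map G)
      (η.naturality f)
  | _, _, .id a => conj (idSquare (η.app a)) (F.mapId (ofObj W a)) (G.mapId (ofObj W a))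
  | _, _, .comp (a := a) (b := b) (c := c) p q =>
      conj (hcomp (extNaturality p) (extNaturality q))
        (F.mapComp (a := ofObj W a) (b := ofObj W b) (c := ofObj W c) p q)
        (G.mapComp (a := ofObj W a) (b := ofObj W b) (c := ofObj W c) p q)

/-- Compatibility of the extended naturality isomorphisms with a 2-morphism. -/
abbrev NatCompat {a b : BiLocalization W} {p q : a ⟶ b} (s : p ⟶ q) : Prop :=
  Compat (extNaturality η p) (extNaturality η q) (F.map₂ s) (G.map₂ s)

theorem natCompat_id {a b : BiLocalization W} (p : a ⟶ b) : NatCompat η (𝟙 p) :=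
  (Compat.id (extNaturality η p)).congr (F.map₂_id p) (G.map₂_id p)

variable {η}

theorem NatCompat.comp {a b : BiLocalization W} {p q r : a ⟶ b} {s : p ⟶ q} {t : q ⟶ r}
    (h : NatCompat η s) (h' : NatCompat η t) : NatCompat η (s ≫ t) :=
  (Compat.comp h h').congr (F.map₂_comp s t) (G.map₂_comp s t)

theorem NatCompat.inv {a b : BiLocalization W} {p q : a ⟶ b} {s : p ≅ q}
    (h : NatCompat η s.hom) : NatCompat η s.inv :=
  Compat.inv (α := F.map₂Iso s) (β := G.map₂Iso s) h

variable (η) in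
theorem natCompat_mapComp {a b c : BiLocalization W} (p : a ⟶ b) (q : b ⟶ c) :
    Compat (extNaturality η (p ≫ q)) (hcomp (extNaturality η p) (extNaturality η q))
      (F.mapComp p q).hom (G.mapComp p q).hom :=
  compat_conj _ _ _

variable (η) in
theorem natCompat_mapId (a : BiLocalization W) :
    Compat (extNaturality η (𝟙 a)) (idSquare (η.app a)) (F.mapId a).hom (G.mapId a).hom :=
  compat_conj _ _ _

theorem NatCompat.whiskerLeft {a b c : BiLocalization W} (p : a ⟶ b) {q r : b ⟶ c} {s : q ⟶ r}
    (h : NatCompat η s) : NatCompat η (p ◁ s) :=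
  (((natCompat_mapComp η p q).comp (Compat.whiskerLeft (extNaturality η p) h)).comp
    (natCompat_mapComp η p r).inv).congr (map₂_whiskerLeft_eq F p s) (map₂_whiskerLeft_eq G p s)

theorem NatCompat.whiskerRight {a b c : BiLocalization W} {p q : a ⟶ b} {s : p ⟶ q}
    (h : NatCompat η s) (r : b ⟶ c) : NatCompat η (s ▷ r) :=
  (((natCompat_mapComp η p r).comp (Compat.whiskerRight (extNaturality η r) h)).comp
    (natCompat_mapComp η q r).inv).congr (map₂_whiskerRight_eq F s r) (map₂_whiskerRight_eq G s r)

variable (η)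

theorem natCompat_associator {a b c d : BiLocalization W} (p : a ⟶ b) (q : b ⟶ c) (r : c ⟶ d) :
    NatCompat η (α_ p q r).hom :=
  (((((natCompat_mapComp η (p ≫ q) r).comp (Compat.whiskerRight (extNaturality η r)
    (natCompat_mapComp η p q))).comp (compat_associator _ _ _)).comp
    (Compat.whiskerLeft (extNaturality η p) (natCompat_mapComp η q r).inv)).comp
    (natCompat_mapComp η p (q ≫ r)).inv).congr (map₂_associator_eq F p q r)
    (map₂_associator_eq G p q r)

theorem natCompat_leftUnitor {a b : BiLocalization W} (p : a ⟶ b) :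
    NatCompat η (λ_ p).hom :=
  (((natCompat_mapComp η (𝟙 a) p).comp (Compat.whiskerRight (extNaturality η p)
    (natCompat_mapId η a))).comp (compat_leftUnitor _)).congr (map₂_leftUnitor_eq F p)
    (map₂_leftUnitor_eq G p)

theorem natCompat_rightUnitor {a b : BiLocalization W} (p : a ⟶ b) :
    NatCompat η (ρ_ p).hom :=
  (((natCompat_mapComp η p (𝟙 b)).comp (Compat.whiskerLeft (extNaturality η p)
    (natCompat_mapId η b))).comp (compat_rightUnitor _)).congr (map₂_rightUnitor_eq F p)
    (map₂_rightUnitor_eq G p)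

/-- The unit axiom of `η` concerns the unit constraint of the composite of `toLocalization W` with
`F` or `G`; the constraints of `F` and `G` themselves are then stripped off with `natCompat_mapId`.
-/
theorem natCompat_toLocalization_mapId (a : B) :
    NatCompat η ((toLocalization W).mapId a).hom := by
  have h : Compat (extNaturality η (Word.of (𝟙 a))) (idSquare (η.app a))
      (F.map₂ ((toLocalization W).mapId a).hom ≫ (F.mapId _).hom)
      (G.map₂ ((toLocalization W).mapId a).hom ≫ (G.mapId _).hom) := η.naturality_id a |>.symm
  refine (h.comp (natCompat_mapId η (ofObj W a)).inv).congr ?_ ?_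
  · exact ((Category.assoc _ _ _).trans
      ((congrArg _ (Iso.hom_inv_id _)).trans (Category.comp_id _))).symm
  · exact ((Category.assoc _ _ _).trans
      ((congrArg _ (Iso.hom_inv_id _)).trans (Category.comp_id _))).symm

theorem natCompat_toLocalization_mapComp {a b c : B} (f : a ⟶ b) (g : b ⟶ c) :
    NatCompat η ((toLocalization W).mapComp f g).hom := by
  have h : Compat (extNaturality η (Word.of (f ≫ g)))
      (hcomp (extNaturality η (Word.of f)) (extNaturality η (Word.of g)))
      (F.map₂ ((toLocalization W).mapComp f g).hom ≫ (F.mapComp _ _).hom)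
      (G.map₂ ((toLocalization W).mapComp f g).hom ≫ (G.mapComp _ _).hom) :=
    (η.naturality_comp f g).symm
  refine (h.comp (natCompat_mapComp η (ofHom W f) (ofHom W g)).inv).congr ?_ ?_
  · exact ((Category.assoc _ _ _).trans
      ((congrArg _ (Iso.hom_inv_id _)).trans (Category.comp_id _))).symm
  · exact ((Category.assoc _ _ _).trans
      ((congrArg _ (Iso.hom_inv_id _)).trans (Category.comp_id _))).symm

theorem AdjointInverse.map₂_unit (F : BiLocalization W ⥤ᵖ D) {x y : BiLocalization W} {f : x ⟶ y}
    (X : AdjointInverse f) : F.map₂ X.unit.hom =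
      ((F.mapId x).hom ≫ (X.map F).unit.hom) ≫ (F.mapComp f X.inv).inv := by
  simp [AdjointInverse.map]

theorem AdjointInverse.map₂_counit (F : BiLocalization W ⥤ᵖ D) {x y : BiLocalization W} {f : x ⟶ y}
    (X : AdjointInverse f) : F.map₂ X.counit.hom =
      ((F.mapComp X.inv f).hom ≫ (X.map F).counit.hom) ≫ (F.mapId y).inv := by
  simp [AdjointInverse.map]

theorem natCompat_unit {a b : B} (f : a ⟶ b) (hf : W f) : NatCompat η (unitIso W f hf).hom :=
  (((natCompat_mapId η (ofObj W a)).comp (compat_unit ((adjointInverse W f hf).map F)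
    ((adjointInverse W f hf).map G) (η.naturality f))).comp
    (natCompat_mapComp η (ofHom W f) (formalInv W f hf)).inv).congr
    ((adjointInverse W f hf).map₂_unit F) ((adjointInverse W f hf).map₂_unit G)

theorem natCompat_counit {a b : B} (f : a ⟶ b) (hf : W f) :
    NatCompat η (counitIso W f hf).hom :=
  (((natCompat_mapComp η (formalInv W f hf) (ofHom W f)).comp
    (compat_counit ((adjointInverse W f hf).map F)
    ((adjointInverse W f hf).map G) (η.naturality f))).comp
    (natCompat_mapId η (ofObj W b)).inv).congr
    ((adjointInverse W f hf).map₂_counit F) ((adjointInverse W f hf).map₂_counit G)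

/-- Naturality is a property of a 2-morphism, stable under composition and whiskering, so it is
checked on the generating terms; the relations play no role. -/
theorem natCompat_term {a b : B} {p q : Word W a b} (s : Term W p q) :
    NatCompat (a := ofObj W a) (b := ofObj W b) η (mk₂ s) := by
  induction s with
  | id p => exact natCompat_id η (a := ofObj W _) (b := ofObj W _) p
  | vcomp s t hs ht => exact hs.comp ht
  | whiskerLeft p s hs => exact hs.whiskerLeft _
  | whiskerRight r s hs => exact hs.whiskerRight _
  | assoc p q r =>
    exact natCompat_associator η (a := ofObj W _) (b := ofObj W _) (c := ofObj W _)
      (d := ofObj W _) p q r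
  | assocInv p q r =>
    exact (natCompat_associator η (a := ofObj W _) (b := ofObj W _) (c := ofObj W _)
      (d := ofObj W _) p q r).inv
  | right p => exact natCompat_rightUnitor η (a := ofObj W _) (b := ofObj W _) p
  | rightInv p => exact (natCompat_rightUnitor η (a := ofObj W _) (b := ofObj W _) p).inv
  | left p => exact natCompat_leftUnitor η (a := ofObj W _) (b := ofObj W _) p
  | leftInv p => exact (natCompat_leftUnitor η (a := ofObj W _) (b := ofObj W _) p).inv
  | of α => exact η.naturality_naturality α
  | mapId a => exact natCompat_toLocalization_mapId η a
  | mapIdInv a => exact (natCompat_toLocalization_mapId η a).inv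
  | mapComp f g => exact natCompat_toLocalization_mapComp η f g
  | mapCompInv f g => exact (natCompat_toLocalization_mapComp η f g).inv
  | unit f hf => exact natCompat_unit η f hf
  | unitInv f hf => exact (natCompat_unit η f hf).inv
  | counit f hf => exact natCompat_counit η f hf
  | counitInv f hf => exact (natCompat_counit η f hf).inv

/-- The extension of a strong transformation to the localization. -/
def extTrans : Pseudofunctor.StrongTrans F G where
  app a := η.app a
  naturality p := extNaturality η p
  naturality_naturality := by
    rintro a b p q ⟨s⟩
    exact natCompat_term η s
  naturality_id a := (natCompat_mapId η a).symm
  naturality_comp p q := (natCompat_mapComp η p q).symm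

end Extension

/-! ### Extension of modifications to the localization -/

section Modification

variable {B : Type u₁} [Bicategory.{w₁, v₁} B] {W : MorphismProperty B}
  {D : Type u₃} [Bicategory.{w₃, v₃} D] {F G : BiLocalization W ⥤ᵖ D} {η θ : F ⟶ G}
  (Γ : ∀ a : BiLocalization W, η.app a ⟶ θ.app a)

/-- The naturality condition of a modification at a 1-morphism. -/
def ModNat {a b : BiLocalization W} (p : a ⟶ b) : Prop :=
  F.map p ◁ Γ b ≫ (θ.naturality p).hom = (η.naturality p).hom ≫ Γ a ▷ G.map p

/-- The axioms force the squares of any strong transformation at identities, and below at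
composites, to be given by the formulas used in `extNaturality`. -/
theorem naturality_id_eq (η : F ⟶ G) (a : BiLocalization W) :
    η.naturality (𝟙 a) = conj (idSquare (η.app a)) (F.mapId a) (G.mapId a) := by
  ext
  simp [η.naturality_id_hom, conj, idSquare]

theorem naturality_comp_eq (η : F ⟶ G) {a b c : BiLocalization W} (p : a ⟶ b) (q : b ⟶ c) :
    η.naturality (p ≫ q) = conj (hcomp (η.naturality p) (η.naturality q)) (F.mapComp p q)
      (G.mapComp p q) := by
  ext
  simp [η.naturality_comp_hom, conj, hcomp]

theorem modNat_id (a : BiLocalization W) : ModNat Γ (𝟙 a) := by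
  unfold ModNat
  rw [naturality_id_eq, naturality_id_eq]
  exact (modCompat_idSquare (Γ a)).conj (F.mapId a) (G.mapId a)

variable {Γ}

theorem ModNat.comp {a b c : BiLocalization W} {p : a ⟶ b} {q : b ⟶ c} (hp : ModNat Γ p)
    (hq : ModNat Γ q) : ModNat Γ (p ≫ q) := by
  unfold ModNat
  rw [naturality_comp_eq, naturality_comp_eq]
  exact (ModCompat.hcomp hp hq).conj (F.mapComp p q) (G.mapComp p q)

theorem ModNat.of_iso {a b : BiLocalization W} {p q : a ⟶ b} (hp : ModNat Γ p) (s : p ≅ q) :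
    ModNat Γ q := by
  unfold ModNat
  rw [η.naturality_naturality_iso s, θ.naturality_naturality_iso s]
  exact ModCompat.conj hp (F.map₂Iso s.symm) (G.map₂Iso s.symm)

/-- The image of `p` under `F` has an adjoint inverse, so the whiskering left over in
`ModCompat.of_hcomp` can be cancelled. -/
theorem ModNat.of_comp {a b c : BiLocalization W} {p : a ⟶ b} {q : b ⟶ c} (hp : ModNat Γ p)
    (X : AdjointInverse p) (hpq : ModNat Γ (p ≫ q)) : ModNat Γ q := by
  unfold ModNat at hpq
  rw [naturality_comp_eq, naturality_comp_eq] at hpq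
  have h := ModCompat.conj hpq (F.mapComp p q).symm (G.mapComp p q).symm
  exact (X.map F).whiskerLeft_injective (ModCompat.of_hcomp hp (by
    simpa [ModCompat, BicategorySquare.conj, BicategorySquare.hcomp] using h))

/-- The only point is a formal inverse `q` of `f`: the composite `f ≫ q` is isomorphic to an
identity, where naturality is automatic, and `f` is cancelled. -/
theorem modNat_of_toLocalization (h : ∀ {a b : B} (f : a ⟶ b), ModNat Γ ((toLocalization W).map f))
    {a b : B} (p : Word W a b) : ModNat (a := ofObj W a) (b := ofObj W b) Γ p := by
  induction p with
  | of f => exact h f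
  | inv f hf =>
    exact (h f).of_comp (adjointInverse W f hf) ((modNat_id Γ _).of_iso (unitIso W f hf))
  | id a => exact modNat_id Γ (ofObj W a)
  | comp p q hp hq => exact ModNat.comp hp hq

end Modification

section Main

variable {B : Type u₁} [Bicategory.{w₁, v₁} B] (W : MorphismProperty B)

theorem isEquivalenceOfBicategories (D : Type u₃) [Bicategory.{w₃, v₃} D] :
    IsEquivalenceOfBicategories
      (precompInverting W (toLocalization W) (sendsToEquivalences_toLocalization W) D) where
  essSurj := by
    rintro ⟨F, hF⟩
    let E : ∀ {a b : B} (f : a ⟶ b), W f → AdjointInverse (F.map f) := fun f hf =>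
      (nonempty_adjointInverse (hF f hf)).some
    have h : (precompInverting W (toLocalization W) (sendsToEquivalences_toLocalization W) D).obj
        (lift F E) = ⟨F, hF⟩ := Subtype.ext (toLocalization_comp_lift F E)
    exact ⟨lift F E, ⟨h ▸ Equivalence.id _⟩⟩
  -- On a word `Word.of f` the extension is `η.naturality f` itself, so its restriction agrees with
  -- `η` through identity isomorphisms.
  essFull F G :=
    { mem_essImage η := ⟨extTrans η.hom, ⟨InducedBicategory.isoMk
        (Pseudofunctor.StrongTrans.isoMk (fun a => Iso.refl (η.hom.app a))
          fun f => whisker_id_comm_aux _)⟩⟩ }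
  -- The localization has the objects of `B`, so the components are already there; for the same
  -- reason a modification is determined by its restriction.
  full F G :=
    { map_surjective {η θ} Γ := ⟨⟨⟨fun a => Γ.hom.as.app a,
        fun p => modNat_of_toLocalization (Γ := fun a => Γ.hom.as.app a)
          (fun f => Γ.hom.as.naturality f) p⟩⟩, rfl⟩ }
  faithful F G :=
    { map_injective {η θ} Γ Γ' h := by
        refine Pseudofunctor.StrongTrans.homCategory.ext fun a => ?_
        have h' := congrArg InducedBicategory.Hom₂.hom h
        have e : precompModification (toLocalization W) Γ =
            precompModification (toLocalization W) Γ' := h'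
        exact congrArg (fun X => X.as.app a) e }

/-- The free localization is a bilocalization. -/
theorem isBilocalization_toLocalization :
    IsBilocalization.{w₁, max u₁ v₁ w₁, w₃, v₁, max u₁ v₁, v₃, u₁, u₁, u₃} W (toLocalization W) :=
  ⟨sendsToEquivalences_toLocalization W, fun D _ => isEquivalenceOfBicategories W D⟩

end Main

end BiLocalization
/-! ## Linear presheaves and sheaves on linear sites -/

/-- A `k`-linear presheaf of `k`-modules, in unbundled form. -/
structure LinPsh (k : Type u) [CommRing k] (C : Type u) [SmallCategory C] [Preadditive C]
    [Linear k C] where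
  obj : C → Type u
  [addCommGroup : ∀ X, AddCommGroup (obj X)]
  [module : ∀ X, Module k (obj X)]
  res : ∀ {X Y : C}, (Y ⟶ X) → (obj X →ₗ[k] obj Y)
  res_id : ∀ {X : C} (x : obj X), res (𝟙 X) x = x
  res_comp : ∀ {X Y Z : C} (g : Z ⟶ Y) (f : Y ⟶ X) (x : obj X), res (g ≫ f) x = res g (res f x)
  res_add : ∀ {X Y : C} (f g : Y ⟶ X) (x : obj X), res (f + g) x = res f x + res g x
  res_smul : ∀ {X Y : C} (c : k) (f : Y ⟶ X) (x : obj X), res (c • f) x = c • res f x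

namespace LinPsh

attribute [instance] addCommGroup module
attribute [simp] res_id res_comp res_add res_smul

variable {k : Type u} [CommRing k] {C : Type u} [SmallCategory C] [Preadditive C] [Linear k C]
  {D : Type u} [SmallCategory D] [Preadditive D] [Linear k D]

/-- `f ↦ f^* x` as a linear map. -/
@[simps]
def resAt (M : LinPsh k C) {X : C} (x : M.obj X) (Y : C) : (Y ⟶ X) →ₗ[k] M.obj Y where
  toFun f := M.res f x
  map_add' f g := M.res_add f g x
  map_smul' c f := M.res_smul c f x

/-- The `k`-module of natural transformations, as a submodule. -/
def homSubmodule (M N : LinPsh k C) : Submodule k (∀ X, M.obj X →ₗ[k] N.obj X) where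
  carrier := {φ | ∀ (X Y : C) (f : Y ⟶ X) (x : M.obj X), φ Y (M.res f x) = N.res f (φ X x)}
  add_mem' hφ hψ X Y f x := by simp [hφ X Y f x, hψ X Y f x]
  zero_mem' X Y f x := by simp
  smul_mem' c φ hφ X Y f x := by simp [hφ X Y f x]

/-- The `k`-module of natural transformations. -/
def Hom (M N : LinPsh k C) : Type u := homSubmodule M N

instance (M N : LinPsh k C) : AddCommGroup (Hom M N) :=
  inferInstanceAs (AddCommGroup (homSubmodule M N))

instance (M N : LinPsh k C) : Module k (Hom M N) := inferInstanceAs (Module k (homSubmodule M N))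

namespace Hom

variable {M N P Q : LinPsh k C}

/-- The components of a natural transformation. -/
def app (φ : Hom M N) (X : C) : M.obj X →ₗ[k] N.obj X := φ.1 X

theorem naturality (φ : Hom M N) {X Y : C} (f : Y ⟶ X) (x : M.obj X) :
    φ.app Y (M.res f x) = N.res f (φ.app X x) := φ.2 X Y f x

@[ext]
theorem ext {φ ψ : Hom M N} (h : ∀ X x, φ.app X x = ψ.app X x) : φ = ψ :=
  Subtype.ext (funext fun X => LinearMap.ext (h X))

/-- Constructor for natural transformations. -/
def mk (app : ∀ X, M.obj X →ₗ[k] N.obj X)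
    (h : ∀ {X Y : C} (f : Y ⟶ X) (x : M.obj X), app Y (M.res f x) = N.res f (app X x)) :
    Hom M N := ⟨app, fun _ _ => h⟩

/-- The identity transformation. -/
def id (M : LinPsh k C) : Hom M M := mk (fun _ => LinearMap.id) fun _ _ => rfl

/-- Composition of natural transformations, in diagrammatic order. -/
def comp (φ : Hom M N) (ψ : Hom N P) : Hom M P :=
  mk (fun X => (ψ.app X).comp (φ.app X)) fun f x => by simp [naturality]

end Hom

/-- A subpresheaf. -/
structure Sub (M : LinPsh k C) where
  carrier : ∀ X, Submodule k (M.obj X)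
  res_mem : ∀ {X Y : C} (f : Y ⟶ X) {x : M.obj X}, x ∈ carrier X → M.res f x ∈ carrier Y

/-- The sieve of all `f` such that `f^* x` belongs to a subpresheaf. -/
def Sub.colon {M : LinPsh k C} (N : M.Sub) {X : C} (x : M.obj X) : LinSieve k X where
  arrows Y := (N.carrier Y).comap (M.resAt x Y)
  precomp_mem g f hf := by
    have := N.res_mem g hf
    simpa using this

theorem Sub.mem_colon {M : LinPsh k C} (N : M.Sub) {X Y : C} (x : M.obj X) (f : Y ⟶ X) :
    f ∈ (N.colon x).arrows Y ↔ M.res f x ∈ N.carrier Y := Iff.rfl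

/-- The representable presheaf. -/
abbrev yoneda (X : C) : LinPsh k C where
  obj Y := Y ⟶ X
  res f := Linear.leftComp k X f
  res_id x := Category.id_comp x
  res_comp g f x := Category.assoc g f x
  res_add f g x := Preadditive.add_comp _ _ _ f g x
  res_smul c f x := Linear.smul_comp _ _ _ c f x

theorem yoneda_res {X Y Z : C} (f : Z ⟶ Y) (x : Y ⟶ X) :
    (yoneda (k := k) X).res f x = f ≫ x := rfl

/-- The natural transformation corresponding to an element. -/
def yonedaHom (M : LinPsh k C) {X : C} (x : M.obj X) : Hom (yoneda X) M :=
  Hom.mk (fun Y => M.resAt x Y) fun f g => M.res_comp f g x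

/-- The product of two presheaves. -/
abbrev prod (M N : LinPsh k C) : LinPsh k C where
  obj X := M.obj X × N.obj X
  res f := (M.res f).prodMap (N.res f)
  res_id x := by simp
  res_comp g f x := by simp
  res_add f g x := by simp
  res_smul c f x := by simp

/-- The first projection. -/
def fst (M N : LinPsh k C) : Hom (M.prod N) M := Hom.mk (fun _ => LinearMap.fst k _ _) fun _ _ => rfl

/-- The restriction of a presheaf along a linear functor. -/
abbrev pull (v : C ⥤ D) [v.Additive] [v.Linear k] (M : LinPsh k D) : LinPsh k C where
  obj X := M.obj (v.obj X)
  res f := M.res (v.map f)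
  res_id x := by simp
  res_comp g f x := by simp
  res_add f g x := by simp [v.map_add]
  res_smul c f x := by simp [v.map_smul]

theorem pull_res (v : C ⥤ D) [v.Additive] [v.Linear k] (M : LinPsh k D) {X Y : C} (f : Y ⟶ X)
    (x : M.obj (v.obj X)) : (pull v M).res f x = M.res (v.map f) x := rfl

/-- The restriction of a natural transformation. -/
def Hom.pull (v : C ⥤ D) [v.Additive] [v.Linear k] {M N : LinPsh k D} (φ : Hom M N) :
    Hom (pull v M) (pull v N) := Hom.mk (fun X => φ.app (v.obj X)) fun _ _ => φ.naturality _ _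

namespace Sub

variable {M N : LinPsh k C}

/-- The image of a subpresheaf. -/
def map (φ : Hom M N) (P : M.Sub) : N.Sub where
  carrier X := (P.carrier X).map (φ.app X)
  res_mem := by
    rintro X Y f _ ⟨x, hx, rfl⟩
    exact ⟨M.res f x, P.res_mem f hx, φ.naturality f x⟩

/-- The zero subpresheaf. -/
def zero (M : LinPsh k C) : M.Sub where
  carrier _ := ⊥
  res_mem f x hx := by
    rw [Submodule.mem_bot] at hx ⊢
    simp [hx]

/-- The image of a natural transformation. -/
def range (φ : Hom M N) : N.Sub where
  carrier X := LinearMap.range (φ.app X)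
  res_mem := by
    rintro X Y f _ ⟨x, rfl⟩
    exact ⟨M.res f x, φ.naturality f x⟩

/-- A subpresheaf as a presheaf. -/
abbrev toPsh (N : M.Sub) : LinPsh k C where
  obj X := N.carrier X
  res f := (M.res f).restrict fun _ hx => N.res_mem f hx
  res_id _ := Subtype.ext (M.res_id _)
  res_comp g f _ := Subtype.ext (M.res_comp g f _)
  res_add f g _ := Subtype.ext (M.res_add f g _)
  res_smul c f _ := Subtype.ext (M.res_smul c f _)

end Sub

end LinPsh

/-! ### Order, images and intersections of sieves -/

namespace LinSieve

variable {k : Type u} [CommRing k] {C : Type u} [SmallCategory C] [Preadditive C] [Linear k C]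
  {D : Type u} [SmallCategory D] [Preadditive D] [Linear k D]

instance (X : C) : LE (LinSieve k X) := ⟨fun R S => ∀ ⦃Y⦄ ⦃f : Y ⟶ X⦄, f ∈ R.arrows Y → f ∈ S.arrows Y⟩

theorem mem_pullback {X X' Y : C} (f : X' ⟶ X) (R : LinSieve k X) (g : Y ⟶ X') :
    g ∈ (R.pullback f).arrows Y ↔ g ≫ f ∈ R.arrows Y := Iff.rfl

theorem generate_le {I : Type v₁} {X : C} {A : I → C} {a : ∀ i, A i ⟶ X} {R : LinSieve k X}
    (h : ∀ i, a i ∈ R.arrows (A i)) : generate a ≤ R :=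
  fun Y _ hf => (generate_le_iff a R).2 h Y hf

theorem mem_generate {I : Type v₁} {X : C} {A : I → C} (a : ∀ i, A i ⟶ X) (i : I) :
    a i ∈ (generate (k := k) a).arrows (A i) := (generate_le_iff a _).1 (fun _ => le_rfl) i

theorem image_le {v : C ⥤ D} {X : C} {R : LinSieve k X} {S : LinSieve k (v.obj X)}
    (h : ∀ ⦃Y : C⦄ ⦃f : Y ⟶ X⦄, f ∈ R.arrows Y → v.map f ∈ S.arrows (v.obj Y)) : R.image v ≤ S :=
  generate_le fun i => h i.2.2

theorem map_mem_image (v : C ⥤ D) {X Y : C} {R : LinSieve k X} {f : Y ⟶ X} (hf : f ∈ R.arrows Y) :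
    v.map f ∈ (R.image v).arrows (v.obj Y) :=
  mem_generate (I := Σ Y : C, R.arrows Y) (fun i => v.map (i.2 : i.1 ⟶ X)) ⟨Y, f, hf⟩

/-- The intersection of two sieves. -/
def inter {X : C} (R S : LinSieve k X) : LinSieve k X where
  arrows Y := R.arrows Y ⊓ S.arrows Y
  precomp_mem g _ hf := ⟨R.precomp_mem g hf.1, S.precomp_mem g hf.2⟩

end LinSieve

/-! ### Local membership and the closure of a subpresheaf -/

namespace LinTopology

open LinPsh

variable {k : Type u} [CommRing k] {C : Type u} [SmallCategory C] [Preadditive C] [Linear k C]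
  (T : LinTopology k C)

variable {T} in
-- Pulled back along a member of `R`, the larger sieve is maximal, so glueing applies.
theorem mono {X : C} {R S : LinSieve k X} (hR : R ∈ T.covers X) (h : R ≤ S) : S ∈ T.covers X := by
  refine T.glue S hR fun Y f hf => ?_
  have : S.pullback f = LinSieve.maximal k Y := by
    ext Z g
    exact ⟨fun _ => Submodule.mem_top, fun _ => h (R.precomp_mem g hf)⟩
  rw [this]
  exact T.maximal_mem Y

variable {T} in
theorem inter_mem {X : C} {R S : LinSieve k X} (hR : R ∈ T.covers X) (hS : S ∈ T.covers X) :
    R.inter S ∈ T.covers X :=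
  T.glue _ hR fun _ f hf => mono (T.pullback_mem f hS) fun _ g hg => ⟨R.precomp_mem g hf, hg⟩

variable {M : LinPsh k C}

theorem colon_of_mem {N : M.Sub} {X : C} {x : M.obj X} (hx : x ∈ N.carrier X) :
    N.colon x ∈ T.covers X :=
  mono (T.maximal_mem X) fun _ f _ => N.res_mem f hx

theorem colon_res {N : M.Sub} {X Y : C} (f : Y ⟶ X) {x : M.obj X} (hx : N.colon x ∈ T.covers X) :
    N.colon (M.res f x) ∈ T.covers Y :=
  mono (T.pullback_mem f hx) fun Z g hg => by
    rw [Sub.mem_colon, ← M.res_comp]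
    exact hg

/-- The closure of a subpresheaf: the elements which are locally in it. -/
def closure (N : M.Sub) : M.Sub where
  carrier X :=
    { carrier := {x | N.colon x ∈ T.covers X}
      add_mem' := fun {x y} hx hy => mono (inter_mem hx hy) fun Y f hf => by
        rw [Sub.mem_colon, map_add]
        exact add_mem hf.1 hf.2
      zero_mem' := T.colon_of_mem (zero_mem _)
      smul_mem' := fun c x hx => mono hx fun Y f hf => by
        rw [Sub.mem_colon, map_smul]
        exact Submodule.smul_mem _ c hf }
  res_mem f _ hx := T.colon_res f hx

/-- Being locally in `N` is a local condition, which is the glueing axiom; in other words the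
closure is idempotent. -/
theorem colon_of_colon_closure {N : M.Sub} {X : C} {x : M.obj X}
    (hx : (T.closure N).colon x ∈ T.covers X) : N.colon x ∈ T.covers X :=
  T.glue _ hx fun Y f hf => mono hf fun Z g hg => by
    rw [LinSieve.mem_pullback, Sub.mem_colon, M.res_comp]
    exact hg

/-- The sieve as a subpresheaf of the representable presheaf. -/
def _root_.LinSieve.toSub {X : C} (R : LinSieve k X) : (yoneda (k := k) X).Sub where
  carrier Y := R.arrows Y
  res_mem f _ hx := R.precomp_mem f hx

variable {T} in
-- The glueing axiom asks for all members of the generated sieve, linear combinations included. The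
-- morphisms along which `S` pulls back to a covering sieve form a sieve, namely the closure of `S`,
-- so the generators are enough.
theorem of_generate {I : Type v₁} {X : C} {A : I → C} {a : ∀ i, A i ⟶ X}
    (ha : LinSieve.generate a ∈ T.covers X) {S : LinSieve k X}
    (h : ∀ i, S.pullback (a i) ∈ T.covers (A i)) : S ∈ T.covers X := by
  refine T.glue S ha fun Y f hf => ?_
  let J : LinSieve k X :=
    { arrows := (T.closure S.toSub).carrier
      precomp_mem := fun g _ hf => (T.closure S.toSub).res_mem g hf }
  exact LinSieve.generate_le (R := J) h hf

/-- The torsion subpresheaf: the elements which are locally zero. -/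
abbrev torsion (M : LinPsh k C) : M.Sub := T.closure (Sub.zero M)

end LinTopology

/-! ### Sheaves and densely defined relations -/

namespace LinPsh

variable {k : Type u} [CommRing k] {C : Type u} [SmallCategory C] [Preadditive C] [Linear k C]

/-- A subpresheaf is dense if every element of the presheaf is locally in it. -/
def Sub.Dense {M : LinPsh k C} (N : M.Sub) (T : LinTopology k C) : Prop :=
  ∀ ⦃X : C⦄ (x : M.obj X), N.colon x ∈ T.covers X

/-- The sheaf condition. -/
structure IsSheaf (T : LinTopology k C) (F : LinPsh k C) : Prop where
  -- A torsion element is one which vanishes on a covering sieve, so this is separatedness.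
  sep : ∀ {X : C} {x : F.obj X}, x ∈ (T.torsion F).carrier X → x = 0
  exists_glue : ∀ {X : C} (R : LinSieve k X), R ∈ T.covers X →
    ∀ x : ∀ Y : C, R.arrows Y →ₗ[k] F.obj Y,
      (∀ {Y Z : C} (g : Z ⟶ Y) (f : R.arrows Y),
        x Z ⟨g ≫ f, R.precomp_mem g f.2⟩ = F.res g (x Y f)) →
      ∃ s : F.obj X, ∀ (Y : C) (f : R.arrows Y), x Y f = F.res (f : Y ⟶ X) s

variable {T : LinTopology k C} {M F : LinPsh k C}

theorem IsSheaf.eq_of_locally (hF : IsSheaf T F) {X : C} {x y : F.obj X} {R : LinSieve k X}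
    (hR : R ∈ T.covers X) (h : ∀ ⦃Y : C⦄ (f : Y ⟶ X), f ∈ R.arrows Y → F.res f x = F.res f y) :
    x = y := by
  refine sub_eq_zero.1 (hF.sep (LinTopology.mono hR fun Y f hf => ?_))
  rw [Sub.mem_colon, map_sub, h f hf, sub_self]
  exact zero_mem _

theorem IsSheaf.hom_ext (hF : IsSheaf T F) {N : M.Sub} (hN : N.Dense T) {φ ψ : Hom M F}
    (h : ∀ ⦃X : C⦄ (x : M.obj X), x ∈ N.carrier X → φ.app X x = ψ.app X x) : φ = ψ := by
  ext X x
  refine hF.eq_of_locally (hN x) fun Y f hf => ?_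
  rw [← φ.naturality, ← ψ.naturality]
  exact h _ hf

/-- The relation defined by a subpresheaf of a product. -/
def Sub.Rel (Γ : (M.prod F).Sub) {X : C} (x : M.obj X) (y : F.obj X) : Prop :=
  ((x, y) : M.obj X × F.obj X) ∈ Γ.carrier X

namespace Sub.Rel

variable {Γ : (M.prod F).Sub} {X : C} {x x' : M.obj X} {y y' : F.obj X}

theorem add (h : Γ.Rel x y) (h' : Γ.Rel x' y') : Γ.Rel (x + x') (y + y') := add_mem h h'

theorem sub (h : Γ.Rel x y) (h' : Γ.Rel x' y') : Γ.Rel (x - x') (y - y') := sub_mem h h'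

theorem smul (c : k) (h : Γ.Rel x y) : Γ.Rel (c • x) (c • y) := Submodule.smul_mem _ c h

theorem res {Y : C} (f : Y ⟶ X) (h : Γ.Rel x y) : Γ.Rel (M.res f x) (F.res f y) := Γ.res_mem f h

end Sub.Rel

/-- The domain of a relation. -/
def Sub.dom (Γ : (M.prod F).Sub) : M.Sub := Γ.map (fst M F)

theorem Sub.mem_dom {Γ : (M.prod F).Sub} {X : C} {x : M.obj X} :
    x ∈ Γ.dom.carrier X ↔ ∃ y, Γ.Rel x y :=
  ⟨by rintro ⟨⟨x, y⟩, h, rfl⟩; exact ⟨y, h⟩, fun ⟨_, h⟩ => ⟨_, h, rfl⟩⟩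

/-- A densely defined single-valued relation from a presheaf to a sheaf extends to a natural
transformation. -/
theorem IsSheaf.exists_hom (hF : IsSheaf T F) (Γ : (M.prod F).Sub)
    (hΓ : ∀ ⦃X : C⦄ (y : F.obj X), Γ.Rel 0 y → y = 0) (hd : Γ.dom.Dense T) :
    ∃ φ : Hom M F, ∀ ⦃X : C⦄ (x : M.obj X) (y : F.obj X), Γ.Rel x y → φ.app X x = y := by
  have huniq : ∀ ⦃X : C⦄ (x : M.obj X) (y y' : F.obj X), Γ.Rel x y → Γ.Rel x y' → y = y' :=
    fun X x y y' h h' => sub_eq_zero.1 (hΓ _ (by simpa using h.sub h'))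
  -- The restrictions of the value at `x` are prescribed on the covering sieve of those `f` for
  -- which the restriction of `x` along `f` is in the domain. Single-valuedness makes them linear
  -- and natural, so they glue.
  have key : ∀ (X : C) (x : M.obj X), ∃ s : F.obj X, ∀ ⦃Y : C⦄ (f : Y ⟶ X) (y : F.obj Y),
      Γ.Rel (M.res f x) y → F.res f s = y := by
    intro X x
    choose g hg using fun (Y : C) (f : (Γ.dom.colon x).arrows Y) => Sub.mem_dom.1 f.2
    have hg : ∀ (Y : C) (f : (Γ.dom.colon x).arrows Y), Γ.Rel (M.res f x) (g Y f) := hg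
    obtain ⟨s, hs⟩ := hF.exists_glue (Γ.dom.colon x) (hd x)
      (fun Y =>
        { toFun := g Y
          map_add' := fun f f' => huniq _ _ _ (hg Y (f + f')) (by
            simpa using (hg Y f).add (hg Y f'))
          map_smul' := fun c f => huniq _ _ _ (hg Y (c • f)) (by
            simpa using (hg Y f).smul c) })
      (fun {Y Z} h f => huniq _ _ _ (hg Z _) (by simpa using (hg Y f).res h))
    refine ⟨s, fun Y f y hy => ?_⟩
    have hf : f ∈ (Γ.dom.colon x).arrows Y := Sub.mem_dom.2 ⟨_, hy⟩
    rw [← hs Y ⟨f, hf⟩]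
    exact huniq _ _ _ (hg Y ⟨f, hf⟩) hy
  choose s hs using key
  have hd' : ∀ ⦃X Y : C⦄ (x : M.obj X) (f : Y ⟶ X), f ∈ (Γ.dom.colon x).arrows Y →
      ∃ y, Γ.Rel (M.res f x) y := fun X Y x f hf => Sub.mem_dom.1 hf
  refine ⟨Hom.mk (fun X =>
    { toFun := s X
      map_add' := fun x x' => ?_
      map_smul' := fun c x => ?_ }) fun {X Y} f x => ?_, fun X x y hy => ?_⟩
  · refine hF.eq_of_locally (LinTopology.inter_mem (hd x) (hd x')) fun Y f hf => ?_
    obtain ⟨y, hy⟩ := hd' x f hf.1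
    obtain ⟨y', hy'⟩ := hd' x' f hf.2
    rw [map_add, hs X x f y hy, hs X x' f y' hy']
    exact hs X _ f _ (by simpa using hy.add hy')
  · refine hF.eq_of_locally (hd x) fun Y f hf => ?_
    obtain ⟨y, hy⟩ := hd' x f hf
    rw [RingHom.id_apply, map_smul, hs X x f y hy]
    exact hs X _ f _ (by simpa using hy.smul c)
  · refine hF.eq_of_locally (hd (M.res f x)) fun Z g hg => ?_
    obtain ⟨y, hy⟩ := hd' _ g hg
    change F.res g (s Y (M.res f x)) = F.res g (F.res f (s X x))
    rw [hs _ _ g y hy, ← F.res_comp]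
    rw [← M.res_comp] at hy
    exact (hs X x _ y hy).symm
  · have := hs X x (𝟙 X) y (by rwa [M.res_id])
    rwa [F.res_id] at this

end LinPsh
/-! ## LC functors and extension of natural transformations along them -/

section GenerateFrom

variable {k : Type u} [CommRing k] {C : Type u} [SmallCategory C]
  {D : Type u} [SmallCategory D] [Preadditive D] [Linear k D]

/-- The sieve generated by all morphisms from objects in the image of `v`. -/
def generateFrom (k : Type u) [CommRing k] [Linear k D] (v : C ⥤ D) (d : D) : LinSieve k d :=
  LinSieve.generate (I := Σ a : C, (v.obj a ⟶ d)) (A := fun i => v.obj i.1) fun i => i.2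

theorem mem_generateFrom (v : C ⥤ D) {a : C} {d : D} (y : v.obj a ⟶ d) :
    y ∈ (generateFrom k v d).arrows (v.obj a) :=
  LinSieve.mem_generate (I := Σ a : C, (v.obj a ⟶ d)) (A := fun i => v.obj i.1) (fun i => i.2) ⟨a, y⟩

end GenerateFrom

section IsLC

open LinPsh LinTopology

variable {k : Type u} [CommRing k] {C : Type u} [SmallCategory C] [Preadditive C] [Linear k C]
  {D : Type u} [SmallCategory D] [Preadditive D] [Linear k D]

/-- The action of a linear functor on morphisms, as a natural transformation. -/
def LinPsh.yonedaMap (v : C ⥤ D) [v.Additive] [v.Linear k] (X : C) :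
    Hom (yoneda (k := k) X) (pull v (yoneda (v.obj X))) :=
  Hom.mk (fun _ => v.mapLinearMap k) fun f x => v.map_comp f x

variable (S : LinTopology k C) (T : LinTopology k D) (v : C ⥤ D) [v.Additive] [v.Linear k]

/-- The LC conditions in terms of sieves. -/
structure IsLC : Prop where
  generating : ∀ d : D, generateFrom k v d ∈ T.covers d
  full : ∀ X : C, (Sub.range (yonedaMap (k := k) v X)).Dense S
  faithful : ∀ {X Y : C} (f : Y ⟶ X), v.map f = 0 → f ∈ (S.torsion (yoneda X)).carrier Y
  covers_iff : ∀ (X : C) (R : LinSieve k X), R ∈ S.covers X ↔ R.image v ∈ T.covers (v.obj X)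

variable {S T v}

theorem IsLC.exists_map (h : IsLC S T v) {X Y : C} (c : v.obj Y ⟶ v.obj X) :
    ∃ R ∈ S.covers Y, ∀ ⦃Z : C⦄ (r : Z ⟶ Y), r ∈ R.arrows Z → ∃ g : Z ⟶ X, v.map g = v.map r ≫ c :=
  ⟨_, h.full X c, fun _ _ hr => hr⟩

/-- The morphisms along which a given lifting or vanishing problem is solved form a linear sieve, so
it contains the sieve generated by a solving family. Conversely, the members of a sieve serve as a
family. -/
theorem isLC_iff : SatisfiesLC S.covers T.covers v ↔ IsLC S T v := by
  constructor
  · intro h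
    refine ⟨fun d => ?_, fun X Y c => ?_, fun {X Y} f hf => ?_, h.covers_iff⟩
    · obtain ⟨I, A, c, hc⟩ := h.G d
      exact mono hc (LinSieve.generate_le fun i => mem_generateFrom v (c i))
    · obtain ⟨I, B, a, b, ha, hab⟩ := h.F Y X c
      exact mono ha (LinSieve.generate_le fun i => ⟨b i, (hab i).symm⟩)
    · obtain ⟨I, B, b, hb, hb'⟩ := h.FF Y X f hf
      exact mono hb (LinSieve.generate_le fun i => hb' i)
  · intro h
    refine ⟨fun d => ⟨_, _, _, h.generating d⟩, fun Y X c => ?_, fun Y X f hf => ?_, h.covers_iff⟩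
    · obtain ⟨R, hR, hR'⟩ := h.exists_map c
      choose g hg using fun i : Σ Z, R.arrows Z => hR' (i.2 : i.1 ⟶ Y) i.2.2
      refine ⟨Σ Z, R.arrows Z, fun i => i.1, fun i => i.2, g, mono hR fun Z r hr => ?_,
        fun i => (hg i).symm⟩
      exact LinSieve.mem_generate (fun i : Σ Z, R.arrows Z => (i.2 : i.1 ⟶ Y)) ⟨Z, r, hr⟩
    · have hR : (Sub.zero (yoneda (k := k) X)).colon (X := Y) f ∈ S.covers Y := h.faithful f hf
      refine ⟨Σ Z, ((Sub.zero (yoneda (k := k) X)).colon (X := Y) f).arrows Z, fun i => i.1,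
        fun i => i.2, mono hR fun Z r hr => ?_, fun i => i.2.2⟩
      exact LinSieve.mem_generate (fun i : Σ Z, ((Sub.zero (yoneda (k := k) X)).colon
        (X := Y) f).arrows Z => (i.2 : i.1 ⟶ Y)) ⟨Z, r, hr⟩

/-- The largest subpresheaf whose restriction along `v` is locally contained in `N`. -/
def LinPsh.Sub.extend (S : LinTopology k C) {P : LinPsh k D} (N : (pull v P).Sub) : P.Sub where
  carrier d := ⨅ (a : C) (y : v.obj a ⟶ d), ((S.closure N).carrier a).comap (P.res y)
  res_mem f x hx := by
    simp only [Submodule.mem_iInf, Submodule.mem_comap] at hx ⊢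
    intro a y
    rw [← P.res_comp]
    exact hx a _

theorem LinPsh.Sub.mem_extend {P : LinPsh k D} {N : (pull v P).Sub} {d : D} {x : P.obj d} :
    x ∈ (N.extend S).carrier d ↔
      ∀ (a : C) (y : v.obj a ⟶ d), P.res y x ∈ (S.closure N).carrier a := by
  simp only [extend, Submodule.mem_iInf, Submodule.mem_comap]

/-- A morphism `y : v b → v a` is locally of the form `v g`, and `N` is stable under restriction
along `g`. -/
theorem LinPsh.Sub.mem_extend_of_mem (hv : ∀ X : C, (Sub.range (yonedaMap (k := k) v X)).Dense S)
    {P : LinPsh k D} {N : (pull v P).Sub} {a : C} {x : P.obj (v.obj a)}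
    (hx : x ∈ N.carrier a) : x ∈ (N.extend S).carrier (v.obj a) := by
  refine Sub.mem_extend.2 fun b y => mono (hv a y) fun c r hr => ?_
  obtain ⟨g, hg⟩ := hr
  have hg : v.map g = v.map r ≫ y := hg
  rw [Sub.mem_colon, pull_res, ← P.res_comp, ← hg]
  exact N.res_mem g hx

/-- A member of `R.image v` is a combination of composites through objects of `D` and need not come
from `R`, but locally it does: the subpresheaf `Sub.extend` of the image of `R` is a sieve
containing the generators. -/
theorem LinSieve.colon_of_mem_image
    (hv : ∀ X : C, (Sub.range (yonedaMap (k := k) v X)).Dense S) {X Y : C} {R : LinSieve k X}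
    {y : v.obj Y ⟶ v.obj X} (hy : y ∈ (R.image v).arrows (v.obj Y)) :
    (R.toSub.map (yonedaMap v X)).colon y ∈ S.covers Y := by
  let J : LinSieve k (v.obj X) :=
    { arrows := ((R.toSub.map (yonedaMap v X)).extend S).carrier
      precomp_mem := fun g _ hf => Sub.res_mem _ g hf }
  have hJ : R.image v ≤ J :=
    LinSieve.image_le fun Z f hf => Sub.mem_extend_of_mem hv ⟨f, hf, rfl⟩
  have := Sub.mem_extend.1 (hJ hy) Y (𝟙 _)
  rwa [res_id] at this

/-! ### Sheaves on the target of an LC functor -/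

namespace IsLC

variable (h : IsLC S T v) {M G : LinPsh k D} (hG : IsSheaf T G)

include h in
theorem mem_extend_of_mem {P : LinPsh k D} {N : (pull v P).Sub} {a : C} {x : P.obj (v.obj a)}
    (hx : x ∈ N.carrier a) : x ∈ (N.extend S).carrier (v.obj a) :=
  Sub.mem_extend_of_mem h.full hx

include h in
theorem covers_of_forall {d : D} {R : LinSieve k d}
    (hR : ∀ (a : C) (y : v.obj a ⟶ d), R.pullback y ∈ T.covers (v.obj a)) : R ∈ T.covers d :=
  of_generate (h.generating d) fun i => hR i.1 i.2

include h in
theorem covers_obj_of {X : C} {R : LinSieve k (v.obj X)} {Q : LinSieve k X} (hQ : Q ∈ S.covers X)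
    (hR : ∀ ⦃Y : C⦄ (f : Y ⟶ X), f ∈ Q.arrows Y → v.map f ∈ R.arrows (v.obj Y)) :
    R ∈ T.covers (v.obj X) :=
  mono ((h.covers_iff X Q).1 hQ) (LinSieve.image_le hR)

include h hG in
theorem eq_zero_of_torsion {X : C} {x : G.obj (v.obj X)}
    (hx : x ∈ (S.torsion (pull v G)).carrier X) : x = 0 :=
  hG.sep (h.covers_obj_of hx fun _ _ hf => hf)

include h hG in
theorem eq_zero_of_forall {d : D} {x : G.obj d}
    (hx : ∀ (a : C) (y : v.obj a ⟶ d), G.res y x = 0) : x = 0 :=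
  hG.sep (mono (h.generating d) (LinSieve.generate_le fun i => hx i.1 i.2))

include h hG in
theorem eq_of_forall {d : D} {x x' : G.obj d}
    (hx : ∀ (a : C) (y : v.obj a ⟶ d), G.res y x = G.res y x') : x = x' :=
  sub_eq_zero.1 (h.eq_zero_of_forall hG fun a y => by rw [map_sub, hx, sub_self])

include h hG in
/-- Extension of a relation along an LC functor. -/
theorem exists_hom (N : ((pull v M).prod (pull v G)).Sub)
    (hN : ∀ ⦃X : C⦄ (y : G.obj (v.obj X)), N.Rel 0 y → y ∈ (S.torsion (pull v G)).carrier X)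
    (hd : N.dom.Dense S) :
    ∃ φ : Hom M G, ∀ ⦃X : C⦄ (x : M.obj (v.obj X)) (y : G.obj (v.obj X)), N.Rel x y →
      φ.app (v.obj X) x = y := by
  -- The restriction of a product is the product of the restrictions; this only changes the way `N`
  -- is typed.
  let N' : (pull v (M.prod G)).Sub := ⟨N.carrier, N.res_mem⟩
  -- Single-valuedness: on objects `v a` a value of `0` is locally torsion, hence zero since `G` is
  -- a sheaf, and these objects generate.
  have h₁ : ∀ ⦃d : D⦄ (y : G.obj d), Sub.Rel (M := M) (F := G) (N'.extend S) 0 y → y = 0 := by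
    intro d y hy
    refine h.eq_zero_of_forall hG fun a z => h.eq_zero_of_torsion hG ?_
    refine S.colon_of_colon_closure (mono (Sub.mem_extend.1 hy a z) fun b f hf => ?_)
    have h₂ : N.Rel (M.res (v.map f) (M.res z 0)) (G.res (v.map f) (G.res z y)) := hf
    rw [map_zero, map_zero] at h₂
    exact hN _ h₂
  have h₂ : (Sub.dom (M := M) (F := G) (N'.extend S)).Dense T := by
    intro d x
    refine h.covers_of_forall fun a y => h.covers_obj_of (hd (X := a) (M.res y x)) fun b f hf => ?_
    obtain ⟨z, hz⟩ := Sub.mem_dom.1 hf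
    rw [LinSieve.mem_pullback, Sub.mem_colon, M.res_comp]
    exact Sub.mem_dom.2 ⟨z, h.mem_extend_of_mem (P := M.prod G) (N := N') hz⟩
  obtain ⟨φ, hφ⟩ := hG.exists_hom _ h₁ h₂
  exact ⟨φ, fun X x y hxy => hφ _ _ (h.mem_extend_of_mem (P := M.prod G) (N := N') hxy)⟩

include h hG in
/-- Restriction along an LC functor is full on natural transformations to sheaves. -/
theorem exists_hom_pull (φ : Hom (pull v M) (pull v G)) : ∃ ψ : Hom M G, ψ.pull v = φ := by
  obtain ⟨ψ, hψ⟩ := h.exists_hom hG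
    { carrier := fun X => (φ.app X).graph
      res_mem := fun {X Y} f x hx => by
        have hx : x.2 = φ.app X x.1 := hx
        change G.res (v.map f) x.2 = φ.app Y ((pull v M).res f x.1)
        rw [hx, φ.naturality] } (fun X y hy => by
      have hy : y = φ.app X 0 := hy
      rw [hy, map_zero]
      exact zero_mem _) fun X x => colon_of_mem _ (Sub.mem_dom.2 ⟨φ.app X x, rfl⟩)
  exact ⟨ψ, Hom.ext fun X x => hψ _ _ rfl⟩

include h hG in
/-- An LC functor is continuous. -/
theorem isSheaf_pull : IsSheaf S (pull v G) where
  sep hx := h.eq_zero_of_torsion hG hx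
  exists_glue {X} R hR x hx := by
    -- The matching family, read as the relation `v f ↦ x f` on the sieve `R.image v`. Local
    -- faithfulness makes it single-valued modulo torsion and `LinSieve.colon_of_mem_image` makes it
    -- densely defined. Its extension is a matching family on a covering sieve of `v X`, which glues
    -- in `G`.
    let N : ((pull v (R.image v).toSub.toPsh).prod (pull v G)).Sub :=
      { carrier := fun Y =>
          { carrier := {p | ∃ f : R.arrows Y, v.map (f : Y ⟶ X) = p.1.1 ∧ x Y f = p.2}
            add_mem' := by
              rintro p q ⟨f, hf, hf'⟩ ⟨g, hg, hg'⟩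
              exact ⟨f + g, by simp [hf, hg, v.map_add], by simp [hf', hg']⟩
            zero_mem' := ⟨0, by simp, by simp⟩
            smul_mem' := by
              rintro c p ⟨f, hf, hf'⟩
              exact ⟨c • f, by simp [hf, v.map_smul], by simp [hf']⟩ }
        res_mem := by
          rintro Y Z g p ⟨f, hf, hf'⟩
          exact ⟨⟨g ≫ f, R.precomp_mem g f.2⟩, (v.map_comp _ _).trans (congrArg (v.map g ≫ ·) hf),
            (hx g f).trans (congrArg (G.res (v.map g)) hf')⟩ }
    obtain ⟨φ, hφ⟩ := h.exists_hom hG N (by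
      rintro Y y ⟨f, hf, rfl⟩
      refine mono (h.faithful _ hf) fun Z g hg => ?_
      have hg : g ≫ (f : Y ⟶ X) = 0 := hg
      have := hx g f
      rw [show (⟨g ≫ f, R.precomp_mem g f.2⟩ : R.arrows Z) = 0 from Subtype.ext hg, map_zero] at this
      exact this.symm) (fun Y y => by
      refine mono (LinSieve.colon_of_mem_image h.full y.2) fun Z g hg => ?_
      obtain ⟨f, hf, hf'⟩ := hg
      exact Sub.mem_dom.2 ⟨x Z ⟨f, hf⟩, ⟨f, hf⟩, hf', rfl⟩)
    obtain ⟨s, hs⟩ := hG.exists_glue (R.image v) ((h.covers_iff X R).1 hR) (fun d => φ.app d)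
      fun g f => φ.naturality g f
    refine ⟨s, fun Y f => ?_⟩
    have hf := LinSieve.map_mem_image v f.2
    exact (hφ ⟨_, hf⟩ _ ⟨f, rfl, rfl⟩).symm.trans (hs _ ⟨_, hf⟩)

end IsLC

end IsLC
/-! ## Sheafification -/

namespace LinPsh

open LinTopology

variable {k : Type u} [CommRing k] {C : Type u} [SmallCategory C] [Preadditive C] [Linear k C]
  {T : LinTopology k C}

section LocalIso

variable {M N F : LinPsh k C}

/-- A natural transformation is a local isomorphism if its kernel is torsion and its image is
dense. -/
structure LocalIso (T : LinTopology k C) (η : Hom M N) : Prop where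
  ker : ∀ ⦃X : C⦄ (x : M.obj X), η.app X x = 0 → x ∈ (T.torsion M).carrier X
  dense : (Sub.range η).Dense T

theorem Hom.app_mem_torsion (φ : Hom M N) {X : C} {x : M.obj X}
    (hx : x ∈ (T.torsion M).carrier X) : φ.app X x ∈ (T.torsion N).carrier X := by
  refine mono hx fun Y f hf => ?_
  have hf : M.res f x = 0 := hf
  change N.res f (φ.app X x) = 0
  rw [← φ.naturality, hf, map_zero]

theorem IsSheaf.app_eq_zero (hF : IsSheaf T F) (φ : Hom M F) {X : C} {x : M.obj X}
    (hx : x ∈ (T.torsion M).carrier X) : φ.app X x = 0 := hF.sep (φ.app_mem_torsion hx)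

/-- Natural transformations to a sheaf extend along local isomorphisms. -/
theorem LocalIso.exists_lift {η : Hom M N} (h : LocalIso T η) (hF : IsSheaf T F) (φ : Hom M F) :
    ∃ ψ : Hom N F, ∀ ⦃X : C⦄ (x : M.obj X), ψ.app X (η.app X x) = φ.app X x := by
  let Γ : (N.prod F).Sub := Sub.range (Hom.mk (fun X => (η.app X).prod (φ.app X)) fun f x =>
    Prod.ext (η.naturality f x) (φ.naturality f x) : Hom M (N.prod F))
  obtain ⟨ψ, hψ⟩ := hF.exists_hom Γ
    (by
      rintro X y ⟨x, hx⟩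
      obtain ⟨hx₁, hx₂⟩ := Prod.mk.inj hx
      rw [← hx₂]
      exact hF.app_eq_zero φ (h.ker x hx₁))
    (fun X x => mono (h.dense x) fun Y f hf => by
      obtain ⟨y, hy⟩ := hf
      exact Sub.mem_dom.2 ⟨φ.app Y y, y, Prod.ext hy rfl⟩)
  exact ⟨ψ, fun X x => hψ _ _ ⟨x, rfl⟩⟩

theorem LocalIso.hom_ext {η : Hom M N} (h : LocalIso T η) (hF : IsSheaf T F) {φ ψ : Hom N F}
    (e : ∀ ⦃X : C⦄ (x : M.obj X), φ.app X (η.app X x) = ψ.app X (η.app X x)) : φ = ψ :=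
  hF.hom_ext h.dense (by
    rintro X _ ⟨x, rfl⟩
    exact e x)

end LocalIso

namespace Sheafification

variable (T) (M : LinPsh k C)

/-- Families of elements of `M` indexed by all morphisms to `X`. -/
abbrev Family (X : C) : Type u := ∀ Y : C, (Y ⟶ X) → M.obj Y

/-- Families which are linear and natural modulo torsion on a sieve. -/
structure IsSection {X : C} (R : LinSieve k X) (s : Family M X) : Prop where
  -- Asking for equalities only modulo torsion makes a single step sufficient, where the plus
  -- construction would have to be applied twice. Values outside `R` are irrelevant, so sections
  -- over different sieves live in one module and no colimit over sieves is needed.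
  add : ∀ {Y : C} {f g : Y ⟶ X}, f ∈ R.arrows Y → g ∈ R.arrows Y →
    s Y (f + g) - (s Y f + s Y g) ∈ (T.torsion M).carrier Y
  smul : ∀ {Y : C} (c : k) {f : Y ⟶ X}, f ∈ R.arrows Y →
    s Y (c • f) - c • s Y f ∈ (T.torsion M).carrier Y
  res : ∀ {Y Z : C} (g : Z ⟶ Y) {f : Y ⟶ X}, f ∈ R.arrows Y →
    s Z (g ≫ f) - M.res g (s Y f) ∈ (T.torsion M).carrier Z

/-- The local sections of `M` modulo torsion. -/
def sections (X : C) : Submodule k (Family M X) where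
  carrier := {s | ∃ R ∈ T.covers X, IsSection T M R s}
  add_mem' := by
    rintro s t ⟨R, hR, hs⟩ ⟨S, hS, ht⟩
    refine ⟨R.inter S, inter_mem hR hS, fun hf hg => ?_, fun c f hf => ?_, fun g f hf => ?_⟩
    · convert add_mem (hs.add hf.1 hg.1) (ht.add hf.2 hg.2) using 1
      simp only [Pi.add_apply]
      abel
    · convert add_mem (hs.smul c hf.1) (ht.smul c hf.2) using 1
      simp only [Pi.add_apply, smul_add]
      abel
    · convert add_mem (hs.res g hf.1) (ht.res g hf.2) using 1
      simp only [Pi.add_apply, map_add]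
      abel
  zero_mem' := ⟨_, T.maximal_mem X, by constructor <;> intros <;> simp⟩
  smul_mem' := by
    rintro c s ⟨R, hR, hs⟩
    refine ⟨R, hR, fun hf hg => ?_, fun d f hf => ?_, fun g f hf => ?_⟩
    · convert Submodule.smul_mem _ c (hs.add hf hg) using 1
      simp only [Pi.smul_apply, smul_sub, smul_add]
    · convert Submodule.smul_mem _ c (hs.smul d hf) using 1
      simp only [Pi.smul_apply, smul_sub, smul_comm c d]
    · convert Submodule.smul_mem _ c (hs.res g hf) using 1
      simp only [Pi.smul_apply, smul_sub, map_smul]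

/-- The families which are torsion on a covering sieve. -/
def null (X : C) : Submodule k (Family M X) where
  carrier := {s | ∃ R ∈ T.covers X, ∀ {Y : C} {f : Y ⟶ X}, f ∈ R.arrows Y →
    s Y f ∈ (T.torsion M).carrier Y}
  add_mem' := by
    rintro s t ⟨R, hR, hs⟩ ⟨S, hS, ht⟩
    exact ⟨R.inter S, inter_mem hR hS, fun hf => add_mem (hs hf.1) (ht hf.2)⟩
  zero_mem' := ⟨_, T.maximal_mem X, fun _ => zero_mem _⟩
  smul_mem' := by
    rintro c s ⟨R, hR, hs⟩
    exact ⟨R, hR, fun hf => Submodule.smul_mem _ c (hs hf)⟩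

/-- The restriction of families. -/
def familyRes {X Y : C} (f : Y ⟶ X) : Family M X →ₗ[k] Family M Y where
  toFun s Z g := s Z (g ≫ f)
  map_add' _ _ := rfl
  map_smul' _ _ := rfl

variable {T M} in
theorem IsSection.familyRes {X Y : C} (f : Y ⟶ X) {R : LinSieve k X} {s : Family M X}
    (hs : IsSection T M R s) : IsSection T M (R.pullback f) (familyRes M f s) where
  add {Z g h} hg hh := by
    change s Z ((g + h) ≫ f) - (s Z (g ≫ f) + s Z (h ≫ f)) ∈ _
    rw [Preadditive.add_comp]
    exact hs.add hg hh
  smul {Z} c g hg := by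
    change s Z ((c • g) ≫ f) - c • s Z (g ≫ f) ∈ _
    rw [Linear.smul_comp]
    exact hs.smul c hg
  res {Z V} h g hg := by
    change s V ((h ≫ g) ≫ f) - M.res h (s Z (g ≫ f)) ∈ _
    rw [Category.assoc]
    exact hs.res h hg

theorem familyRes_mem_sections {X Y : C} (f : Y ⟶ X) (s : Family M X) (hs : s ∈ sections T M X) :
    familyRes M f s ∈ sections T M Y := by
  obtain ⟨R, hR, hs⟩ := hs
  exact ⟨_, T.pullback_mem f hR, hs.familyRes f⟩

theorem familyRes_mem_null {X Y : C} (f : Y ⟶ X) {s : Family M X} (hs : s ∈ null T M X) :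
    familyRes M f s ∈ null T M Y := by
  obtain ⟨R, hR, hs⟩ := hs
  exact ⟨_, T.pullback_mem f hR, fun hg => hs hg⟩

/-- The null sections. -/
abbrev nullSections (X : C) : Submodule k (sections T M X) :=
  (null T M X).comap (sections T M X).subtype

/-- The class of a local section. -/
abbrev classOf {X : C} (s : Family M X) (hs : s ∈ sections T M X) : sections T M X ⧸ nullSections T M X :=
  Submodule.Quotient.mk ⟨s, hs⟩

variable {T M} in
theorem classOf_eq_classOf {X : C} {s t : Family M X} {hs : s ∈ sections T M X} {ht : t ∈ sections T M X} :
    classOf T M s hs = classOf T M t ht ↔ s - t ∈ null T M X :=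
  Submodule.Quotient.eq _

variable {T M} in
theorem classOf_congr {X : C} {s t : Family M X} {hs : s ∈ sections T M X} {ht : t ∈ sections T M X}
    (h : ∀ Y f, s Y f = t Y f) : classOf T M s hs = classOf T M t ht := by
  obtain rfl : s = t := funext fun Y => funext (h Y)
  rfl

variable {T M} in
theorem classOf_eq_zero {X : C} {s : Family M X} {hs : s ∈ sections T M X} :
    classOf T M s hs = 0 ↔ s ∈ null T M X := Submodule.Quotient.mk_eq_zero _

variable {T M} in
theorem classOf_surjective {X : C} (x : sections T M X ⧸ nullSections T M X) :
    ∃ s hs, classOf T M s hs = x := by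
  obtain ⟨⟨s, hs⟩, rfl⟩ := Submodule.Quotient.mk_surjective _ x
  exact ⟨s, hs, rfl⟩

/-- The restriction of classes of local sections. -/
def resQ {X Y : C} (f : Y ⟶ X) :
    (sections T M X ⧸ nullSections T M X) →ₗ[k] (sections T M Y ⧸ nullSections T M Y) :=
  Submodule.mapQ _ _ ((familyRes M f).restrict (familyRes_mem_sections T M f))
    fun _ hs => familyRes_mem_null T M f hs

theorem resQ_classOf {X Y : C} (f : Y ⟶ X) (s : Family M X) (hs : s ∈ sections T M X) :
    resQ T M f (classOf T M s hs) = classOf T M (familyRes M f s) (familyRes_mem_sections T M f s hs) := rfl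

end Sheafification

open Sheafification

variable (T) (M : LinPsh k C)

/-- The sheafification of a linear presheaf. -/
def sheafify : LinPsh k C where
  obj X := sections T M X ⧸ nullSections T M X
  res f := resQ T M f
  res_id x := by
    obtain ⟨s, hs, rfl⟩ := classOf_surjective x
    rw [resQ_classOf]
    exact classOf_congr fun Y f => congrArg (s Y) (Category.comp_id f)
  res_comp g f x := by
    obtain ⟨s, hs, rfl⟩ := classOf_surjective x
    rw [resQ_classOf, resQ_classOf, resQ_classOf]
    exact classOf_congr fun Y h => congrArg (s Y) (Category.assoc h g f).symm
  res_add f g x := by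
    obtain ⟨s, hs, rfl⟩ := classOf_surjective x
    obtain ⟨R, hR, hs'⟩ := id hs
    rw [resQ_classOf, resQ_classOf, resQ_classOf]
    refine classOf_eq_classOf.2 ⟨_, inter_mem (T.pullback_mem f hR) (T.pullback_mem g hR), fun {Y h} hh => ?_⟩
    change s Y (h ≫ (f + g)) - (s Y (h ≫ f) + s Y (h ≫ g)) ∈ _
    rw [Preadditive.comp_add]
    exact hs'.add hh.1 hh.2
  res_smul c f x := by
    obtain ⟨s, hs, rfl⟩ := classOf_surjective x
    obtain ⟨R, hR, hs'⟩ := id hs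
    rw [resQ_classOf, resQ_classOf]
    refine classOf_eq_classOf.2 ⟨_, T.pullback_mem f hR, fun {Y h} hh => ?_⟩
    change s Y (h ≫ (c • f)) - c • s Y (h ≫ f) ∈ _
    rw [Linear.comp_smul]
    exact hs'.smul c hh

theorem sections_of_mem {X : C} (x : M.obj X) :
    (fun _ f => M.res f x : Family M X) ∈ sections T M X :=
  ⟨_, T.maximal_mem X, by constructor <;> intros <;> simp⟩

/-- The unit of sheafification. -/
def toSheafify : Hom M (sheafify T M) :=
  Hom.mk (fun _ =>
    { toFun := fun x => classOf T M _ (sections_of_mem T M x)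
      map_add' := fun x y => classOf_congr fun _ f => map_add (M.res f) x y
      map_smul' := fun c x => classOf_congr fun _ f => map_smul (M.res f) c x })
    fun f x => classOf_congr fun _ g => (M.res_comp g f x).symm

variable {T M} in
-- Naturality of `s` modulo torsion says exactly that along members of `R` the class of `s` comes
-- from an element of `M`.
theorem sheafify_res_classOf {X : C} {R : LinSieve k X} {s : Family M X} (hs : s ∈ sections T M X)
    (hs' : IsSection T M R s) {Y : C} {f : Y ⟶ X} (hf : f ∈ R.arrows Y) :
    (sheafify T M).res f (classOf T M s hs) = (toSheafify T M).app Y (s Y f) :=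
  classOf_eq_classOf.2 ⟨_, T.maximal_mem Y, fun {_} g _ => hs'.res g hf⟩

variable {T M} in
theorem mem_torsion_of_toSheafify_eq_zero {X : C} {x : M.obj X}
    (hx : (toSheafify T M).app X x = 0) : x ∈ (T.torsion M).carrier X := by
  obtain ⟨R, hR, hx⟩ := classOf_eq_zero.1 hx
  exact T.colon_of_colon_closure (mono hR fun Y f hf => hx hf)

theorem localIso_toSheafify : LocalIso T (toSheafify T M) where
  ker _ _ hx := mem_torsion_of_toSheafify_eq_zero hx
  dense X x := by
    obtain ⟨s, hs, rfl⟩ := classOf_surjective x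
    obtain ⟨R, hR, hs'⟩ := id hs
    exact mono hR fun Y f hf => ⟨s Y f, (sheafify_res_classOf hs hs' hf).symm⟩

/-- Since `toSheafify` is a local isomorphism, values of a matching family lift locally to `M`.
Arbitrary lifts form a section because their ambiguity is torsion, and torsion is what the
construction ignores. -/
theorem isSheaf_sheafify : IsSheaf T (sheafify T M) := by
  have hsep : ∀ {X : C} {x : (sheafify T M).obj X},
      x ∈ (T.torsion (sheafify T M)).carrier X → x = 0 := by
    intro X x hx
    obtain ⟨s, hs, rfl⟩ := classOf_surjective x
    obtain ⟨R, hR, hs'⟩ := id hs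
    refine classOf_eq_zero.2 ⟨_, inter_mem hR hx, fun {Y f} hf =>
      mem_torsion_of_toSheafify_eq_zero ?_⟩
    rw [← sheafify_res_classOf hs hs' hf.1]
    exact hf.2
  refine ⟨hsep, fun {X} R hR x hx => ?_⟩
  let η := toSheafify T M
  -- The members of `R` at which the matching family takes values coming from `M`.
  let S : LinSieve k X :=
    { arrows := fun Y => (((Sub.range η).carrier Y).comap (x Y)).map (R.arrows Y).subtype
      precomp_mem := by
        rintro Y Z g _ ⟨f, hf, rfl⟩
        refine ⟨⟨g ≫ f, R.precomp_mem g f.2⟩, ?_, rfl⟩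
        have := (Sub.range η).res_mem g hf
        rwa [← hx g f] at this }
  have hS : S ∈ T.covers X := T.glue S hR fun Y f hf =>
    mono ((localIso_toSheafify T M).dense (x Y ⟨f, hf⟩)) fun Z g hg => by
      refine ⟨⟨g ≫ f, R.precomp_mem g hf⟩, ?_, rfl⟩
      have hg : (sheafify T M).res g (x Y ⟨f, hf⟩) ∈ (Sub.range η).carrier Z := hg
      rwa [← hx g ⟨f, hf⟩] at hg
  have hS' : ∀ {Y : C} {f : Y ⟶ X}, f ∈ S.arrows Y → ∃ (hf : f ∈ R.arrows Y) (m : M.obj Y),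
      η.app Y m = x Y ⟨f, hf⟩ := by
    rintro Y _ ⟨f, ⟨m, hm⟩, rfl⟩
    exact ⟨f.2, m, hm⟩
  classical
  -- The value `0` outside `S` is arbitrary.
  let s : Family M X := fun Y f => if h : f ∈ S.arrows Y then (hS' h).2.choose else 0
  have hs : ∀ {Y : C} {f : Y ⟶ X} (hf : f ∈ S.arrows Y),
      η.app Y (s Y f) = x Y ⟨f, (hS' hf).1⟩ := by
    intro Y f hf
    simp only [s, dif_pos hf]
    exact (hS' hf).2.choose_spec
  have hsec : IsSection T M S s := by
    refine ⟨fun {Y f g} hf hg => ?_, fun {Y} c f hf => ?_, fun {Y Z} g f hf => ?_⟩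
    · refine mem_torsion_of_toSheafify_eq_zero ?_
      change η.app Y _ = 0
      rw [map_sub, map_add, hs hf, hs hg, hs (add_mem hf hg), ← map_add, sub_eq_zero]
      rfl
    · refine mem_torsion_of_toSheafify_eq_zero ?_
      change η.app Y _ = 0
      rw [map_sub, map_smul, hs hf, hs (Submodule.smul_mem _ c hf), ← map_smul, sub_eq_zero]
      rfl
    · refine mem_torsion_of_toSheafify_eq_zero ?_
      change η.app Z _ = 0
      rw [map_sub, η.naturality, hs hf, hs (S.precomp_mem g hf), ← hx, sub_self]
  have hmem : s ∈ sections T M X := ⟨S, hS, hsec⟩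
  obtain ⟨σ, hσ⟩ : ∃ σ : (sheafify T M).obj X, ∀ {Y : C} {f : Y ⟶ X} (hf : f ∈ S.arrows Y),
      (sheafify T M).res f σ = x Y ⟨f, (hS' hf).1⟩ :=
    ⟨classOf T M s hmem, fun hf => (sheafify_res_classOf hmem hsec hf).trans (hs hf)⟩
  -- The class `σ` glues the family on `S`; separatedness carries this over to all of `R`.
  refine ⟨σ, fun Y f => sub_eq_zero.1 (hsep ?_)⟩
  refine mono (T.pullback_mem (f : Y ⟶ X) hS) fun Z g hg => ?_
  have hg : g ≫ (f : Y ⟶ X) ∈ S.arrows Z := hg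
  change (sheafify T M).res g (x Y f - (sheafify T M).res (f : Y ⟶ X) σ) = 0
  rw [map_sub, ← hx, ← (sheafify T M).res_comp, hσ hg, sub_self]

end LinPsh

/-! ## Comparison with presheaves of modules -/

namespace LinPsh

open LinTopology

variable {k : Type u} [CommRing k] {C : Type u} [SmallCategory C] [Preadditive C] [Linear k C]

/-- The functor associated with a linear presheaf. -/
def toFunctor (M : LinPsh k C) : Cᵒᵖ ⥤ ModuleCat.{u} k where
  obj X := ModuleCat.of k (M.obj X.unop)
  map f := ModuleCat.ofHom (M.res f.unop)
  map_id X := by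
    ext x
    exact M.res_id x
  map_comp f g := by
    ext x
    exact M.res_comp g.unop f.unop x

/-- The linear presheaf associated with a functor. -/
def ofFunctor (F : Cᵒᵖ ⥤ ModuleCat.{u} k) (hF : IsLinPresheaf F) : LinPsh k C where
  obj X := F.obj (op X)
  res f := (F.map f.op).hom
  res_id x := by simp
  res_comp g f x := by simp
  res_add f g x := congrArg (fun t => t.hom x) (hF.map_add f g)
  res_smul c f x := congrArg (fun t => t.hom x) (hF.map_smul c f)

theorem isLinPresheaf_toFunctor (M : LinPsh k C) : IsLinPresheaf M.toFunctor where
  map_add f g := by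
    ext x
    exact M.res_add f g x
  map_smul c f := by
    ext x
    exact M.res_smul c f x

variable {T : LinTopology k C}

theorem isLinSheaf_toFunctor_iff (M : LinPsh k C) :
    IsLinSheaf T.covers M.toFunctor ↔ IsSheaf T M := by
  constructor
  · intro h
    refine ⟨fun {X x} hx => ?_, fun R hR x hx => (h.existsUnique _ R hR x hx).exists⟩
    -- Both `x` and `0` glue the zero family on the covering sieve where `x` vanishes.
    refine (h.existsUnique X _ hx (fun _ => 0) fun g f => (map_zero (M.res g)).symm).unique
      (y₁ := x) (y₂ := (0 : M.obj X)) (fun Y f => ?_) fun Y f => (map_zero (M.res _)).symm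
    exact (Eq.symm f.2 :)
  · intro h
    refine ⟨M.isLinPresheaf_toFunctor, fun X R hR x hx => ?_⟩
    obtain ⟨s, hs⟩ := h.exists_glue R hR x hx
    refine ⟨s, hs, fun t ht => h.eq_of_locally hR fun Y f hf => ?_⟩
    exact (ht Y ⟨f, hf⟩).symm.trans (hs Y ⟨f, hf⟩)

variable {D : Type u} [SmallCategory D] [Preadditive D] [Linear k D] {S : LinTopology k D}

theorem isContinuousLin_iff (v : C ⥤ D) [v.Additive] [v.Linear k] :
    IsContinuousLin T.covers S.covers v ↔ ∀ F : LinPsh k D, IsSheaf S F → IsSheaf T (pull v F) := by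
  constructor
  · intro h F hF
    exact (isLinSheaf_toFunctor_iff _).1 (h _ ((isLinSheaf_toFunctor_iff F).2 hF))
  · intro h F hF
    exact (isLinSheaf_toFunctor_iff (pull v (ofFunctor F hF.linear))).2
      (h _ ((isLinSheaf_toFunctor_iff (ofFunctor F hF.linear)).1 hF))

end LinPsh
/-! ## The topology coinduced by a functor -/

section Coinduced

open LinPsh LinTopology

variable {k : Type u} [CommRing k] {C : Type u} [SmallCategory C] [Preadditive C] [Linear k C]
  {D : Type u} [SmallCategory D] [Preadditive D] [Linear k D]
  (v : C ⥤ D) [v.Additive] [v.Linear k]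

/-- The sieve of all morphisms which `v` maps into a given sieve. -/
def LinSieve.comap {X : C} (R : LinSieve k (v.obj X)) : LinSieve k X where
  arrows Y := (R.arrows (v.obj Y)).comap (v.mapLinearMap k)
  precomp_mem g f hf := by
    have hf : v.map f ∈ R.arrows _ := hf
    change v.map (g ≫ f) ∈ R.arrows _
    rw [v.map_comp]
    exact R.precomp_mem _ hf

theorem LinSieve.mem_comap {X Y : C} {R : LinSieve k (v.obj X)} {f : Y ⟶ X} :
    f ∈ (R.comap v).arrows Y ↔ v.map f ∈ R.arrows (v.obj Y) := Iff.rfl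

/-- A sieve is covering for the coinduced topology if its pullbacks to all objects in the image of
`v` are covering. -/
def LinTopology.coinduced (S : LinTopology k C) : LinTopology k D where
  covers d := {R | ∀ (a : C) (x : v.obj a ⟶ d), (R.pullback x).comap v ∈ S.covers a}
  maximal_mem d a x := mono (S.maximal_mem a) fun _ _ _ => Submodule.mem_top
  pullback_mem f R hR a x := mono (hR a (x ≫ f)) fun b r hr => by
    rw [LinSieve.mem_comap, LinSieve.mem_pullback, LinSieve.mem_pullback, Category.assoc]
    exact hr
  glue {X R} Q hR hQ a x := S.glue _ (hR a x) fun b r hr =>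
    mono (hQ _ _ hr b (𝟙 _)) fun c s hs => by
      have hs : (v.map s ≫ 𝟙 _) ≫ v.map r ≫ x ∈ Q.arrows _ := hs
      change v.map (s ≫ r) ≫ x ∈ Q.arrows _
      simpa using hs

variable {v} {S : LinTopology k C}

/-- A locally full and locally faithful functor is LC for the coinduced topology. -/
theorem isLC_coinduced (hfull : ∀ X : C, (Sub.range (yonedaMap (k := k) v X)).Dense S)
    (hfaithful : ∀ {X Y : C} (f : Y ⟶ X), v.map f = 0 → f ∈ (S.torsion (yoneda X)).carrier Y) :
    IsLC S (S.coinduced v) v where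
  generating d a x := mono (S.maximal_mem a) fun b r _ => mem_generateFrom v (v.map r ≫ x)
  full := hfull
  faithful := hfaithful
  covers_iff X R := by
    constructor
    -- Locally `x` is of the form `v g`, and there the pullback along `g` of the covering sieve `R`
    -- does the job.
    · intro hR a x
      refine S.glue _ (hfull X x) fun b r hr => ?_
      obtain ⟨g, hg⟩ := hr
      have hg : v.map g = v.map r ≫ x := hg
      refine mono (S.pullback_mem g hR) fun c s hs => ?_
      change v.map (s ≫ r) ≫ x ∈ (R.image v).arrows _
      rw [v.map_comp, Category.assoc, ← hg, ← v.map_comp]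
      exact LinSieve.map_mem_image v hs
    · intro hR
      -- If `v r` is in the image of `R`, then locally `v (s ≫ r) = v g` with `g` in `R`, and by
      -- local faithfulness `s ≫ r` and `g` agree after a further refinement. Each of these
      -- localizations is one use of a covering sieve.
      refine S.glue _ (hR X (𝟙 _)) fun Y r hr => ?_
      have hr : v.map r ≫ 𝟙 _ ∈ (R.image v).arrows (v.obj Y) := hr
      rw [Category.comp_id] at hr
      refine S.glue _ (LinSieve.colon_of_mem_image hfull hr) fun Z s hs => ?_
      obtain ⟨g, hg, hgs⟩ := hs
      have hgs : v.map g = v.map s ≫ v.map r := hgs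
      have h0 : v.map (s ≫ r - g) = 0 := by rw [v.map_sub, v.map_comp, hgs, sub_self]
      refine mono (hfaithful _ h0) fun V t ht => ?_
      have ht : t ≫ (s ≫ r - g) = 0 := ht
      rw [Preadditive.comp_sub, sub_eq_zero] at ht
      change (t ≫ s) ≫ r ∈ R.arrows V
      rw [Category.assoc, ht]
      exact R.precomp_mem t hg

end Coinduced

/-! ## Adjoining sheaves to a site -/

section SheafExt

open LinPsh LinTopology

variable {k : Type u} [CommRing k] {C : Type u} [SmallCategory C] [Preadditive C] [Linear k C]
  {T : LinTopology k C}

namespace LinPsh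

/-- The element of the sheafification of a representable presheaf which represents it. -/
def univElem (T : LinTopology k C) (X : C) : (sheafify T (yoneda X)).obj X :=
  (toSheafify T (yoneda X)).app X (𝟙 X)

theorem app_toSheafify_yoneda {F : LinPsh k C} {X Y : C} (φ : Hom (sheafify T (yoneda X)) F)
    (f : Y ⟶ X) : φ.app Y ((toSheafify T (yoneda X)).app Y f) = F.res f (φ.app X (univElem T X)) := by
  rw [← φ.naturality]
  refine congrArg (φ.app Y) ?_
  refine Eq.trans ?_ ((toSheafify T (yoneda (k := k) X)).naturality f (𝟙 X))
  rw [yoneda_res, Category.comp_id]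

/-- With `IsSheaf.univElem_ext`, the Yoneda lemma for sheafified representables: `toSheafify` is a
local isomorphism, so morphisms to a sheaf may be computed before sheafifying. -/
theorem IsSheaf.exists_univElem {F : LinPsh k C} (hF : IsSheaf T F) {X : C} (x : F.obj X) :
    ∃ φ : Hom (sheafify T (yoneda X)) F, φ.app X (univElem T X) = x := by
  obtain ⟨φ, hφ⟩ := (localIso_toSheafify T (yoneda X)).exists_lift hF (yonedaHom F x)
  exact ⟨φ, (hφ (𝟙 X)).trans (F.res_id x)⟩

theorem IsSheaf.univElem_ext {F : LinPsh k C} (hF : IsSheaf T F) {X : C}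
    {φ ψ : Hom (sheafify T (yoneda X)) F} (h : φ.app X (univElem T X) = ψ.app X (univElem T X)) :
    φ = ψ :=
  (localIso_toSheafify T (yoneda X)).hom_ext hF fun Y f => by
    rw [app_toSheafify_yoneda, app_toSheafify_yoneda, h]

/-- The action of morphisms on sheafified representable presheaves. -/
noncomputable def univMap (T : LinTopology k C) {X Y : C} (f : Y ⟶ X) :
    Hom (sheafify T (yoneda Y)) (sheafify T (yoneda X)) :=
  ((isSheaf_sheafify T (yoneda X)).exists_univElem ((toSheafify T (yoneda X)).app Y f)).choose

theorem univMap_univElem {X Y : C} (f : Y ⟶ X) :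
    (univMap T f).app Y (univElem T Y) = (toSheafify T (yoneda X)).app Y f :=
  ((isSheaf_sheafify T (yoneda X)).exists_univElem _).choose_spec

end LinPsh

variable {J : Type u}

/-- The objects of the site obtained by adjoining a family of sheaves to a site. -/
inductive SheafExt (T : LinTopology k C) (ψ : J → LinPsh k C) : Type u
  | base (a : C) : SheafExt T ψ
  | new (j : J) : SheafExt T ψ

namespace SheafExt

variable {ψ : J → LinPsh k C}

/-- The sheaf corresponding to an object. -/
def sheaf : SheafExt T ψ → LinPsh k C
  | base a => sheafify T (yoneda a)
  | new j => ψ j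

instance : SmallCategory (SheafExt T ψ) where
  Hom d d' := Hom d.sheaf d'.sheaf
  id d := Hom.id d.sheaf
  comp f g := Hom.comp f g

/-- The natural transformation corresponding to a morphism. -/
def hom {d d' : SheafExt T ψ} (f : d ⟶ d') : Hom d.sheaf d'.sheaf := f

instance : Preadditive (SheafExt T ψ) where
  homGroup d d' := inferInstanceAs (AddCommGroup (Hom d.sheaf d'.sheaf))
  add_comp _ _ _ _ _ g := Hom.ext fun X _ => map_add ((hom g).app X) _ _
  comp_add _ _ _ _ _ _ := rfl

instance : Linear k (SheafExt T ψ) where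
  homModule d d' := inferInstanceAs (Module k (Hom d.sheaf d'.sheaf))
  smul_comp _ _ _ c _ g := Hom.ext fun X _ => map_smul ((hom g).app X) c _
  comp_smul _ _ _ _ _ _ := rfl

variable (T ψ) in
/-- The functor from a site to its extension. -/
noncomputable def incl : C ⥤ SheafExt T ψ where
  obj a := base a
  map f := univMap T f
  map_id a := (isSheaf_sheafify T (yoneda a)).univElem_ext (univMap_univElem (𝟙 a))
  map_comp {a b c} f g := (isSheaf_sheafify T (yoneda c)).univElem_ext <| by
    refine (univMap_univElem (f ≫ g)).trans (Eq.symm ?_)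
    refine (congrArg ((univMap T g).app a) (univMap_univElem f)).trans ?_
    rw [app_toSheafify_yoneda, univMap_univElem, ← Hom.naturality]
    rfl

/-- The evaluation of a morphism at the universal element. -/
noncomputable def eval {a : C} {d : SheafExt T ψ} : ((incl T ψ).obj a ⟶ d) →ₗ[k] d.sheaf.obj a where
  toFun x := (hom x).app a (univElem T a)
  map_add' _ _ := rfl
  map_smul' _ _ := rfl

theorem eval_comp {a : C} {d d' : SheafExt T ψ} (x : (incl T ψ).obj a ⟶ d) (f : d ⟶ d') :
    eval (x ≫ f) = (hom f).app a (eval x) := rfl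

theorem eval_map {a b : C} (f : b ⟶ a) :
    eval ((incl T ψ).map f) = (toSheafify T (yoneda a)).app b f := univMap_univElem f

/-- So `eval` is a morphism of presheaves from morphisms `incl a ⟶ d` to `d.sheaf`; when the
adjoined presheaves are sheaves it is an isomorphism, by `eval_injective` and `eval_surjective`. -/
theorem eval_map_comp {a b : C} {d : SheafExt T ψ} (f : b ⟶ a) (x : (incl T ψ).obj a ⟶ d) :
    eval ((incl T ψ).map f ≫ x) = d.sheaf.res f (eval x) := by
  rw [eval_comp, eval_map]
  exact app_toSheafify_yoneda (hom x) f

instance : (incl T ψ).Additive where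
  map_add {b a f g} := (isSheaf_sheafify T (yoneda a)).univElem_ext <| by
    refine (univMap_univElem (f + g)).trans ?_
    rw [map_add, ← univMap_univElem, ← univMap_univElem]
    rfl

instance : (incl T ψ).Linear k where
  map_smul {b a} f c := (isSheaf_sheafify T (yoneda a)).univElem_ext <| by
    refine (univMap_univElem (c • f)).trans ?_
    rw [map_smul, ← univMap_univElem]
    rfl

variable (T ψ) in
/-- The topology on the extension of a site. -/
noncomputable abbrev topology : LinTopology k (SheafExt T ψ) := T.coinduced (incl T ψ)

section

variable (hψ : ∀ j, IsSheaf T (ψ j))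

include hψ in
theorem isSheaf_sheaf (d : SheafExt T ψ) : IsSheaf T d.sheaf := by
  cases d with
  | base a => exact isSheaf_sheafify T _
  | new j => exact hψ j

include hψ in
theorem eval_injective {a : C} {d : SheafExt T ψ} {x y : (incl T ψ).obj a ⟶ d}
    (h : eval x = eval y) : x = y := (isSheaf_sheaf hψ d).univElem_ext h

include hψ in
theorem eval_surjective {a : C} {d : SheafExt T ψ} (m : d.sheaf.obj a) :
    ∃ x : (incl T ψ).obj a ⟶ d, eval x = m := (isSheaf_sheaf hψ d).exists_univElem m

-- Through `eval`, the action of `incl` on morphisms becomes the unit of sheafification of a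
-- representable. This is a local isomorphism, so `incl` is locally full and locally faithful, and
-- the topology is coinduced.
include hψ in
theorem isLC_incl : IsLC T (topology T ψ) (incl T ψ) := by
  refine isLC_coinduced (fun X Y c => ?_) fun {X Y} f hf => ?_
  · refine mono ((localIso_toSheafify T (yoneda X)).dense (eval c)) fun Z r hr => ?_
    obtain ⟨g, hg⟩ := hr
    refine ⟨g, eval_injective hψ ?_⟩
    refine (eval_map (ψ := ψ) g).trans (hg.trans ?_)
    exact (eval_map_comp r c).symm
  · refine (localIso_toSheafify T (yoneda X)).ker f ?_
    rw [← eval_map (ψ := ψ), hf, map_zero]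
    rfl

include hψ in
/-- The extension is subcanonical. -/
theorem isSheaf_yoneda (d : SheafExt T ψ) : IsSheaf (topology T ψ) (yoneda d) where
  sep {d' x} hx := Hom.ext fun a m => by
    obtain ⟨y, rfl⟩ := eval_surjective hψ m
    refine (isSheaf_sheaf hψ d).sep (mono (hx a y) fun b r hr => ?_)
    have hr : ((incl T ψ).map r ≫ y) ≫ x = 0 := hr
    change d.sheaf.res r (eval (y ≫ x)) = 0
    rw [← eval_map_comp, ← Category.assoc, hr, map_zero]
  exists_glue {d'} R hR x hx := by
    -- A glueing is a morphism of sheaves, so it is built from the relation `eval y ↦ eval (x y)`,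
    -- where `y` runs over the members of `R` whose source is in the image of `incl`.
    let Γ : (d'.sheaf.prod d.sheaf).Sub :=
      { carrier := fun a => (LinearMap.range
          ((eval.comp (R.arrows ((incl T ψ).obj a)).subtype).prod
            (eval.comp (x ((incl T ψ).obj a)))))
        res_mem := by
          rintro a b f _ ⟨y, rfl⟩
          refine ⟨⟨(incl T ψ).map f ≫ y, R.precomp_mem _ y.2⟩, Prod.ext (eval_map_comp f y.1) ?_⟩
          refine (congrArg eval (hx _ y)).trans (eval_map_comp f _) }
    obtain ⟨σ, hσ⟩ := (isSheaf_sheaf hψ d).exists_hom Γ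
      (by
        rintro a e ⟨y, hy⟩
        obtain ⟨hy₁, hy₂⟩ := Prod.mk.inj hy
        have : y = 0 := Subtype.ext (eval_injective hψ (hy₁.trans (map_zero _).symm))
        rw [← hy₂, this, map_zero])
      (fun a m => by
        obtain ⟨y, rfl⟩ := eval_surjective hψ m
        refine mono (hR a y) fun b r hr => Sub.mem_dom.2 ⟨eval (x _ ⟨_, hr⟩), ⟨_, hr⟩, ?_⟩
        exact Prod.ext (eval_map_comp r y) rfl)
    refine ⟨σ, fun e f => Hom.ext fun a m => ?_⟩
    obtain ⟨y, rfl⟩ := eval_surjective hψ m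
    change eval (y ≫ x e f) = σ.app a (eval (y ≫ (f : e ⟶ d')))
    exact ((hσ _ _ ⟨⟨y ≫ f, R.precomp_mem y f.2⟩, rfl⟩).trans (congrArg eval (hx y f))).symm

include hψ in
/-- An element of a presheaf on the extension defines a natural transformation on the original
site. -/
theorem exists_hom_of_obj (F : LinPsh k (SheafExt T ψ)) {d : SheafExt T ψ} (e : F.obj d) :
    ∃ φ : Hom d.sheaf (pull (incl T ψ) F), ∀ (a : C) (y : (incl T ψ).obj a ⟶ d),
      φ.app a (eval y) = F.res y e := by
  let E : ∀ a : C, ((incl T ψ).obj a ⟶ d) ≃ₗ[k] d.sheaf.obj a := fun a =>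
    LinearEquiv.ofBijective eval ⟨fun _ _ => eval_injective hψ, eval_surjective hψ⟩
  refine ⟨Hom.mk (fun a => (F.resAt e _).comp (E a).symm.toLinearMap) fun {a b} r m => ?_,
    fun a y => congrArg (fun z => F.res z e) ((E a).symm_apply_apply y)⟩
  obtain ⟨y, rfl⟩ := (E a).surjective m
  change F.res ((E b).symm (d.sheaf.res r (eval y))) e =
    F.res ((incl T ψ).map r) (F.res ((E a).symm (E a y)) e)
  rw [← F.res_comp, ← eval_map_comp, (E a).symm_apply_apply]
  exact congrArg (fun z => F.res z e) ((E b).symm_apply_apply _)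

include hψ in
/-- For sheaves, all natural transformations are of this form. -/
theorem exists_obj_of_hom {F : LinPsh k (SheafExt T ψ)} (hF : IsSheaf (topology T ψ) F)
    {d : SheafExt T ψ} (φ : Hom d.sheaf (pull (incl T ψ) F)) :
    ∃ e : F.obj d, ∀ (a : C) (y : (incl T ψ).obj a ⟶ d), F.res y e = φ.app a (eval y) := by
  -- Through `eval`, `φ` is a morphism defined on the restriction of the presheaf represented by
  -- `d`. It extends along `incl`, and the element is the value at the identity of `d`.
  obtain ⟨χ, hχ⟩ := (isLC_incl hψ).exists_hom_pull hF (M := yoneda d)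
    (Hom.mk (fun a => (φ.app a).comp eval) fun {a b} r y => by
      refine (congrArg (φ.app b) (eval_map_comp r y)).trans (φ.naturality _ _))
  refine ⟨χ.app d (𝟙 d), fun a y => ?_⟩
  rw [← χ.naturality, yoneda_res, Category.comp_id]
  exact congrArg (fun ξ => Hom.app ξ a y) hχ

end

end SheafExt

end SheafExt
/-! ## Direct and inverse images -/

section Images

open LinPsh LinTopology

variable {k : Type u} [CommRing k] {C : Type u} [SmallCategory C] [Preadditive C] [Linear k C]
  {D : Type u} [SmallCategory D] [Preadditive D] [Linear k D]
  {S : LinTopology k C} {T : LinTopology k D} {v : C ⥤ D} [v.Additive] [v.Linear k]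

namespace IsLC

/-- For `f` in `R`, every composite `y ≫ f` with source in the image of `v` is locally of the form
`v g`, where `g` then lies in `R.comap v`; so the image of `R.comap v` covers. This is what makes
direct images preserve sheaves. -/
theorem comap_mem (h : IsLC S T v) {X : C} {R : LinSieve k (v.obj X)}
    (hR : R ∈ T.covers (v.obj X)) : R.comap v ∈ S.covers X := by
  refine (h.covers_iff _ _).2 (T.glue _ hR fun e f hf => h.covers_of_forall fun d y => ?_)
  obtain ⟨Q, hQ, hQ'⟩ := h.exists_map (y ≫ f)
  refine h.covers_obj_of hQ fun Z r hr => ?_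
  obtain ⟨g, hg⟩ := hQ' r hr
  change (v.map r ≫ y) ≫ f ∈ ((R.comap v).image v).arrows (v.obj Z)
  rw [Category.assoc, ← hg]
  refine LinSieve.map_mem_image v ?_
  rw [LinSieve.mem_comap, hg, ← Category.assoc]
  exact R.precomp_mem _ hf

theorem localIso_yonedaMap (h : IsLC S T v) (X : C) : LocalIso S (yonedaMap (k := k) v X) :=
  ⟨fun _ f hf => h.faithful f hf, h.full X⟩

end IsLC

namespace LinPsh

theorem IsSheaf.of_bijective {M N : LinPsh k C} (hN : IsSheaf S N) (φ : Hom M N)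
    (hφ : ∀ X, Function.Bijective (φ.app X)) : IsSheaf S M where
  sep {X x} hx := (hφ X).1 (by rw [hN.app_eq_zero φ hx, map_zero])
  exists_glue {X} R hR x hx := by
    obtain ⟨s, hs⟩ := hN.exists_glue R hR (fun Y => (φ.app Y).comp (x Y)) fun {Y Z} g f => by
      rw [LinearMap.comp_apply, hx, φ.naturality]
      rfl
    obtain ⟨t, rfl⟩ := (hφ X).2 s
    exact ⟨t, fun Y f => (hφ Y).1 ((hs Y f).trans (φ.naturality _ _).symm)⟩

variable (v) in
/-- The direct image of a presheaf along `v`, given by `d ↦ Hom(D(v -, d), M)`. -/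
def pushforward (M : LinPsh k C) : LinPsh k D where
  obj d := Hom (pull v (yoneda d)) M
  res {d _} f :=
    { toFun := fun θ => Hom.comp ((yonedaHom (yoneda d) f).pull v) θ
      map_add' := fun _ _ => rfl
      map_smul' := fun _ _ => rfl }
  res_id θ := Hom.ext fun X x => congrArg (θ.app X) (Category.comp_id x)
  res_comp g f θ := Hom.ext fun X x => congrArg (θ.app X) (Category.assoc x g f).symm
  res_add f g θ := Hom.ext fun X x =>
    (congrArg (θ.app X) (Preadditive.comp_add _ _ _ x f g)).trans (map_add _ _ _)
  res_smul c f θ := Hom.ext fun X x =>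
    (congrArg (θ.app X) (Linear.comp_smul _ _ _ x c f)).trans (map_smul _ _ _)

/-- An element over `v c` can be evaluated at the identity to give an element of `M c`. A matching
family on `R` thus becomes a relation from `D(v -, d)` to `M`, densely defined by `IsLC.comap_mem`,
and its extension is the glueing. -/
theorem _root_.IsLC.isSheaf_pushforward (h : IsLC S T v) {M : LinPsh k C} (hM : IsSheaf S M) :
    IsSheaf T (pushforward v M) where
  sep {d θ} hθ := Hom.ext fun X (x : v.obj X ⟶ d) => hM.sep <| by
    refine mono (h.comap_mem (T.pullback_mem x hθ)) fun Y r hr => ?_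
    have hr : (pushforward v M).res (v.map r ≫ x) θ = 0 := hr
    have : θ.app Y (𝟙 (v.obj Y) ≫ v.map r ≫ x) = 0 :=
      congrArg (fun φ => Hom.app φ Y (𝟙 (v.obj Y))) hr
    rw [Category.id_comp] at this
    exact (θ.naturality r x).symm.trans this
  exists_glue {d} R hR x hx := by
    let ev : ∀ c : C, (pushforward v M).obj (v.obj c) →ₗ[k] M.obj c := fun c =>
      { toFun := fun θ => Hom.app θ c (𝟙 (v.obj c))
        map_add' := fun _ _ => rfl
        map_smul' := fun _ _ => rfl }
    have hev : ∀ {c : C} {e : D} (f : R.arrows e) (y : v.obj c ⟶ e),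
        ev c (x _ ⟨y ≫ f, R.precomp_mem y f.2⟩) = Hom.app (x e f) c y := by
      intro c e f y
      rw [hx]
      exact congrArg (Hom.app (x e f) c) (Category.id_comp y)
    let Γ : ((pull v (yoneda d)).prod M).Sub :=
      { carrier := fun c => LinearMap.range
          ((R.arrows (v.obj c)).subtype.prod ((ev c).comp (x (v.obj c))))
        res_mem := by
          rintro c c' g _ ⟨y, rfl⟩
          refine ⟨⟨v.map g ≫ y, R.precomp_mem _ y.2⟩, Prod.ext rfl ((hev y (v.map g)).trans ?_)⟩
          refine Eq.trans ?_ (Hom.naturality (x (v.obj c) y) g (𝟙 (v.obj c)))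
          exact congrArg (Hom.app (x (v.obj c) y) c') (Category.comp_id _).symm }
    obtain ⟨θ, hθ⟩ := hM.exists_hom Γ
      (by
        rintro c m ⟨y, hy⟩
        obtain ⟨hy₁, hy₂⟩ := Prod.mk.inj hy
        have : y = 0 := Subtype.ext hy₁
        rw [← hy₂, this, map_zero])
      (fun c y => mono (h.comap_mem (T.pullback_mem y hR)) fun c' r hr =>
        Sub.mem_dom.2 ⟨_, ⟨_, hr⟩, rfl⟩)
    exact ⟨θ, fun e f => Hom.ext fun c y =>
      ((hθ _ _ ⟨⟨y ≫ f, R.precomp_mem y f.2⟩, rfl⟩).trans (hev f y)).symm⟩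

/-! ### Inverse images by generators and relations -/

namespace InverseImage

variable (v) (T) (P : LinPsh k C)

/-- The generators of the inverse image. -/
noncomputable abbrev Gen (d : D) : Type u := (Σ c : C, P.obj c × (d ⟶ v.obj c)) →₀ k

variable {v T P} in
/-- The evaluation of generators. -/
noncomputable def evalGen {M : LinPsh k D} (θ : Hom P (pull v M)) (d : D) : Gen v P d →ₗ[k] M.obj d :=
  Finsupp.linearCombination k fun i => M.res i.2.2 (θ.app i.1 i.2.1)

/-- The relations between generators which hold in all sheaves. -/
noncomputable def relations (d : D) : Submodule k (Gen v P d) :=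
  -- Imposing everything that holds in all sheaves avoids listing relations: an identity in the
  -- quotient is checked by evaluating in sheaves. The intersection ranges over a large collection
  -- but is a submodule of a small module.
  ⨅ (M : LinPsh k D) (_ : IsSheaf T M) (θ : Hom P (pull v M)), LinearMap.ker (evalGen θ d)

variable {v T P} in
theorem mem_relations {d : D} {z : Gen v P d} : z ∈ relations T v P d ↔
    ∀ M : LinPsh k D, IsSheaf T M → ∀ θ : Hom P (pull v M), evalGen θ d z = 0 := by
  simp only [relations, Submodule.mem_iInf, LinearMap.mem_ker]

/-- The restriction of generators. -/
noncomputable def resGen {d d' : D} (f : d' ⟶ d) : Gen v P d →ₗ[k] Gen v P d' :=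
  Finsupp.lmapDomain k k fun i => ⟨i.1, i.2.1, f ≫ i.2.2⟩

variable {v T P} in
theorem evalGen_resGen {M : LinPsh k D} (θ : Hom P (pull v M)) {d d' : D} (f : d' ⟶ d)
    (z : Gen v P d) : evalGen θ d' (resGen v P f z) = M.res f (evalGen θ d z) := by
  have : (evalGen θ d').comp (resGen v P f) = (M.res f).comp (evalGen θ d) := by
    refine Finsupp.lhom_ext fun i a => ?_
    simp [evalGen, resGen, Finsupp.lmapDomain_apply, Finsupp.mapDomain_single]
  exact LinearMap.congr_fun this z

variable {v T P} in
theorem mk_eq_of_forall {d : D} {z z' : Gen v P d}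
    (h : ∀ M : LinPsh k D, IsSheaf T M → ∀ θ : Hom P (pull v M), evalGen θ d z = evalGen θ d z') :
    Submodule.Quotient.mk (p := relations T v P d) z = Submodule.Quotient.mk z' :=
  (Submodule.Quotient.eq _).2 <| mem_relations.2 fun M hM θ => by rw [map_sub, h M hM θ, sub_self]

/-- The inverse image of a presheaf, before sheafification. -/
noncomputable def presheaf : LinPsh k D where
  obj d := Gen v P d ⧸ relations T v P d
  res {d d'} f := Submodule.mapQ _ _ (resGen v P f) fun z hz => mem_relations.2 fun M hM θ => by
    rw [evalGen_resGen, mem_relations.1 hz M hM θ, map_zero]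
  res_id x := by
    obtain ⟨z, rfl⟩ := Submodule.Quotient.mk_surjective _ x
    exact mk_eq_of_forall fun M _ θ => by rw [evalGen_resGen, M.res_id]
  res_comp g f x := by
    obtain ⟨z, rfl⟩ := Submodule.Quotient.mk_surjective _ x
    exact mk_eq_of_forall fun M _ θ => by simp only [evalGen_resGen, M.res_comp]
  res_add f g x := by
    obtain ⟨z, rfl⟩ := Submodule.Quotient.mk_surjective _ x
    refine mk_eq_of_forall (z' := resGen v P f z + resGen v P g z) fun M _ θ => ?_
    simp only [map_add, evalGen_resGen, M.res_add]
  res_smul c f x := by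
    obtain ⟨z, rfl⟩ := Submodule.Quotient.mk_surjective _ x
    refine mk_eq_of_forall (z' := c • resGen v P f z) fun M _ θ => ?_
    simp only [map_smul, evalGen_resGen, M.res_smul]

/-- The generator corresponding to an element. -/
noncomputable def gen {c : C} (p : P.obj c) : Gen v P (v.obj c) := Finsupp.single ⟨c, p, 𝟙 _⟩ 1

variable {v T P} in
theorem evalGen_gen {M : LinPsh k D} (θ : Hom P (pull v M)) {c : C} (p : P.obj c) :
    evalGen θ (v.obj c) (gen v P p) = θ.app c p := by
  simp [evalGen, gen]

/-- The unit of the inverse image, before sheafification. -/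
noncomputable def unit : Hom P (pull v (presheaf T v P)) :=
  Hom.mk (fun c =>
    { toFun := fun p => Submodule.Quotient.mk (gen v P p)
      map_add' := fun p q => mk_eq_of_forall (z' := gen v P p + gen v P q) fun M _ θ => by
        simp only [map_add, evalGen_gen]
      map_smul' := fun a p => mk_eq_of_forall (z' := a • gen v P p) fun M _ θ => by
        simp only [map_smul, evalGen_gen] })
    fun {c c'} f p => mk_eq_of_forall (z' := resGen v P (v.map f) (gen v P p)) fun M _ θ => by
      rw [evalGen_resGen, evalGen_gen, evalGen_gen, θ.naturality]

variable {v T P} in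
theorem exists_desc {M : LinPsh k D} (hM : IsSheaf T M) (θ : Hom P (pull v M)) :
    ∃ φ : Hom (presheaf T v P) M, Hom.comp (unit T v P) (φ.pull v) = θ :=
  ⟨Hom.mk (fun d => Submodule.liftQ _ (evalGen θ d) fun z hz => mem_relations.1 hz M hM θ)
    fun {d d'} f x => by
      obtain ⟨z, rfl⟩ := Submodule.Quotient.mk_surjective _ x
      exact evalGen_resGen θ f z, Hom.ext fun c p => evalGen_gen θ p⟩

variable {v T P} in
theorem desc_ext {M : LinPsh k D} {φ ψ : Hom (presheaf T v P) M}
    (h : Hom.comp (unit T v P) (φ.pull v) = Hom.comp (unit T v P) (ψ.pull v)) : φ = ψ := by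
  refine Hom.ext fun d x => ?_
  obtain ⟨z, rfl⟩ := Submodule.Quotient.mk_surjective _ x
  have : (φ.app d).comp (Submodule.mkQ (relations T v P d)) =
      (ψ.app d).comp (Submodule.mkQ (relations T v P d)) := by
    refine Finsupp.lhom_ext fun ⟨c, p, q⟩ a => ?_
    -- A generator `(c, p, q)` is the restriction along `q` of the image of `p` under the unit, so
    -- the unit generates the inverse image.
    have hz : Submodule.mkQ (relations T v P d) (Finsupp.single ⟨c, p, q⟩ a) =
        a • (presheaf T v P).res q ((unit T v P).app c p) :=
      mk_eq_of_forall (z' := a • resGen v P q (gen v P p)) fun M _ θ => by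
        rw [map_smul, evalGen_resGen, evalGen_gen]
        simp [evalGen]
    have hp : φ.app _ ((unit T v P).app c p) = ψ.app _ ((unit T v P).app c p) :=
      congrArg (fun χ => Hom.app χ c p) h
    refine (congrArg (φ.app d) hz).trans (Eq.trans ?_ (congrArg (ψ.app d) hz).symm)
    rw [map_smul, map_smul, φ.naturality, ψ.naturality, hp]
  exact LinearMap.congr_fun this z

end InverseImage

variable (T v) in
/-- The existence of inverse images. -/
theorem exists_inverseImage (P : LinPsh k C) : ∃ (G : LinPsh k D) (η : Hom P (pull v G)),
    IsSheaf T G ∧ ∀ M : LinPsh k D, IsSheaf T M → ∀ θ : Hom P (pull v M),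
      ∃! φ : Hom G M, Hom.comp η (φ.pull v) = θ := by
  refine ⟨sheafify T (InverseImage.presheaf T v P),
    Hom.comp (InverseImage.unit T v P) ((toSheafify T _).pull v), isSheaf_sheafify _ _,
    fun M hM θ => ?_⟩
  obtain ⟨φ, rfl⟩ := InverseImage.exists_desc hM θ
  obtain ⟨ψ, hψ⟩ := (localIso_toSheafify T _).exists_lift hM φ
  have hψ' : Hom.comp (toSheafify T _) ψ = φ := Hom.ext fun X x => hψ x
  refine ⟨ψ, congrArg (fun χ => Hom.comp (InverseImage.unit T v P) (Hom.pull v χ)) hψ',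
    fun ξ hξ => (localIso_toSheafify T _).hom_ext hM fun X x => ?_⟩
  have : Hom.comp (toSheafify T _) ξ = φ := InverseImage.desc_ext hξ
  exact (congrArg (fun χ => Hom.app χ X x) this).trans (hψ x).symm

end LinPsh

end Images
/-! ## Completing spans to squares -/

section OreSquare

open LinPsh LinTopology

variable {k : Type u} [CommRing k] {A : Type u} [SmallCategory A] [Preadditive A] [Linear k A]
  {B : Type u} [SmallCategory B] [Preadditive B] [Linear k B]
  {C : Type u} [SmallCategory C] [Preadditive C] [Linear k C]
  (TA : LinTopology k A) (f : C ⥤ A) (w : C ⥤ B) [f.Additive] [f.Linear k] [w.Additive] [w.Linear k]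

namespace OreSquare

/-- The inverse image along `f` of the presheaf `B(w -, b)`. -/
noncomputable def sheaf (b : B) : LinPsh k A :=
  (exists_inverseImage TA f (pull w (yoneda (k := k) b))).choose

/-- The unit of the inverse image. -/
noncomputable def unit (b : B) : Hom (pull w (yoneda (k := k) b)) (pull f (sheaf TA f w b)) :=
  (exists_inverseImage TA f (pull w (yoneda (k := k) b))).choose_spec.choose

theorem isSheaf_sheaf (b : B) : IsSheaf TA (sheaf TA f w b) :=
  (exists_inverseImage TA f (pull w (yoneda (k := k) b))).choose_spec.choose_spec.1

variable {TA f w}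

theorem exists_desc {M : LinPsh k A} (hM : IsSheaf TA M) {b : B}
    (θ : Hom (pull w (yoneda b)) (pull f M)) : ∃ φ : Hom (sheaf TA f w b) M,
      ∀ (c : C) (x : w.obj c ⟶ b), φ.app (f.obj c) ((unit TA f w b).app c x) = θ.app c x := by
  obtain ⟨φ, hφ, -⟩ := (exists_inverseImage TA f
    (pull w (yoneda (k := k) b))).choose_spec.choose_spec.2 M hM θ
  exact ⟨φ, fun c x => congrArg (fun χ => Hom.app χ c x) hφ⟩

theorem desc_ext {M : LinPsh k A} (hM : IsSheaf TA M) {b : B} {φ ψ : Hom (sheaf TA f w b) M}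
    (h : ∀ (c : C) (x : w.obj c ⟶ b), φ.app (f.obj c) ((unit TA f w b).app c x) =
      ψ.app (f.obj c) ((unit TA f w b).app c x)) : φ = ψ :=
  ((exists_inverseImage TA f (pull w (yoneda (k := k) b))).choose_spec.choose_spec.2 M hM
    (Hom.comp (unit TA f w b) (ψ.pull f))).unique (Hom.ext fun c x => h c x) rfl

variable (TA f w) in
/-- The action of morphisms on inverse images of representable presheaves. -/
noncomputable def map {b b' : B} (y : b ⟶ b') : Hom (sheaf TA f w b) (sheaf TA f w b') :=
  (exists_desc (isSheaf_sheaf TA f w b')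
    (Hom.comp ((yonedaHom (yoneda b') y).pull w) (unit TA f w b'))).choose

theorem map_unit {b b' : B} (y : b ⟶ b') {c : C} (x : w.obj c ⟶ b) :
    (map TA f w y).app (f.obj c) ((unit TA f w b).app c x) = (unit TA f w b').app c (x ≫ y) :=
  (exists_desc (isSheaf_sheaf TA f w b')
    (Hom.comp ((yonedaHom (yoneda b') y).pull w) (unit TA f w b'))).choose_spec c x

variable (TA f w)

/-- The target of the square. -/
abbrev Target : Type u := SheafExt TA (sheaf TA f w)

/-- The functor `B ⥤ Target`. -/
noncomputable def right : B ⥤ Target TA f w where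
  obj b := .new b
  map y := map TA f w y
  map_id b := desc_ext (isSheaf_sheaf TA f w b) fun c x => by
    rw [map_unit, Category.comp_id]
    rfl
  map_comp {b b' b''} y z := desc_ext (isSheaf_sheaf TA f w b'') fun c x => by
    rw [map_unit, ← Category.assoc, ← map_unit, ← map_unit]
    rfl

instance : (right TA f w).Additive where
  map_add {b b' y z} := desc_ext (isSheaf_sheaf TA f w b') fun c x => by
    refine (map_unit _ _).trans ?_
    rw [Preadditive.comp_add, map_add, ← map_unit, ← map_unit]
    rfl

instance : (right TA f w).Linear k where
  map_smul {b b'} y a := desc_ext (isSheaf_sheaf TA f w b') fun c x => by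
    refine (map_unit _ _).trans ?_
    rw [Linear.comp_smul, map_smul, ← map_unit]
    rfl

/-- The functor `A ⥤ Target`. -/
noncomputable abbrev left : A ⥤ Target TA f w := SheafExt.incl TA (sheaf TA f w)

theorem isLC_left : IsLC TA (SheafExt.topology TA (sheaf TA f w)) (left TA f w) :=
  SheafExt.isLC_incl (isSheaf_sheaf TA f w)

variable {TA f w}

theorem exists_leg {b : B} {c : C} (x : w.obj c ⟶ b) :
    ∃ q : (left TA f w).obj (f.obj c) ⟶ (right TA f w).obj b,
      SheafExt.eval q = (unit TA f w b).app c x :=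
  SheafExt.eval_surjective (isSheaf_sheaf TA f w) (d := (right TA f w).obj b)
    ((unit TA f w b).app c x)

/-- The morphism in the target of the square corresponding to `w c ⟶ b`. -/
noncomputable def leg {b : B} {c : C} (x : w.obj c ⟶ b) :
    (left TA f w).obj (f.obj c) ⟶ (right TA f w).obj b := (exists_leg x).choose

theorem eval_leg {b : B} {c : C} (x : w.obj c ⟶ b) :
    SheafExt.eval (leg (TA := TA) (f := f) x) = (unit TA f w b).app c x := (exists_leg x).choose_spec

theorem leg_comp {b b' : B} {c : C} (x : w.obj c ⟶ b) (y : b ⟶ b') :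
    leg (TA := TA) (f := f) x ≫ (right TA f w).map y = leg (x ≫ y) := by
  refine SheafExt.eval_injective (isSheaf_sheaf TA f w) ?_
  rw [SheafExt.eval_comp, eval_leg, eval_leg]
  exact map_unit y x

theorem map_comp_leg {b : B} {c c' : C} (r : c' ⟶ c) (x : w.obj c ⟶ b) :
    (left TA f w).map (f.map r) ≫ leg (TA := TA) (f := f) x = leg (w.map r ≫ x) := by
  refine SheafExt.eval_injective (isSheaf_sheaf TA f w) ?_
  rw [SheafExt.eval_map_comp, eval_leg, eval_leg]
  exact ((unit TA f w b).naturality r x).symm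

variable {TB : LinTopology k B} {TC : LinTopology k C} (hw : IsLC TC TB w)
  (hf : ∀ F : LinPsh k A, IsSheaf TA F → IsSheaf TC (pull f F))

-- Since `w` is LC, `C(-, c) → B(w -, w c)` is a local isomorphism. As `f` is continuous, morphisms
-- from either presheaf to the restriction of a sheaf `M` on `A` are the same, so the inverse image
-- of `B(w -, w c)` classifies elements of `M (f c)`, as does the sheafification of `A(-, f c)`.
include hw hf in
theorem isIso_leg (c : C) : IsIso (leg (TA := TA) (f := f) (𝟙 (w.obj c))) := by
  have hψ := isSheaf_sheaf TA f w
  have hs := isSheaf_sheafify TA (yoneda (k := k) (f.obj c))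
  -- The inverse of the leg comes from `C(-, c) → A(f -, f c)` followed by sheafification, extended
  -- along the local isomorphism to `B(w -, w c)`.
  obtain ⟨θ, hθ⟩ := (hw.localIso_yonedaMap c).exists_lift (hf _ hs)
    (Hom.comp (yonedaMap f c) ((toSheafify TA (yoneda (f.obj c))).pull f))
  obtain ⟨φ, hφ⟩ := exists_desc hs θ
  let φ' : (right TA f w).obj (w.obj c) ⟶ (left TA f w).obj (f.obj c) := φ
  refine ⟨φ', SheafExt.eval_injective hψ ?_, desc_ext (hψ _) fun c' x => ?_⟩
  · rw [SheafExt.eval_comp, eval_leg]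
    refine (hφ c (𝟙 _)).trans ?_
    rw [← w.map_id]
    refine (hθ (𝟙 c)).trans ?_
    exact congrArg ((toSheafify TA (yoneda (f.obj c))).app (f.obj c)) (f.map_id c)
  · have h : Hom.comp (unit TA f w (w.obj c))
          (Hom.pull f (SheafExt.hom (φ' ≫ leg (TA := TA) (f := f) (𝟙 (w.obj c))))) =
        unit TA f w (w.obj c) :=
      (hw.localIso_yonedaMap c).hom_ext (hf _ (hψ _)) fun c' r => by
        change (SheafExt.hom (leg (TA := TA) (f := f) (𝟙 (w.obj c)))).app _
          (φ.app _ ((unit TA f w (w.obj c)).app c' (w.map r))) =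
            (unit TA f w (w.obj c)).app c' (w.map r)
        rw [hφ c' (w.map r)]
        refine (congrArg _ (hθ r)).trans ?_
        have h₁ := SheafExt.eval_comp ((left TA f w).map (f.map r)) (leg (𝟙 (w.obj c)))
        rw [map_comp_leg, Category.comp_id, eval_leg] at h₁
        refine Eq.trans ?_ h₁.symm
        exact congrArg _ (SheafExt.eval_map (ψ := sheaf TA f w) (f.map r)).symm
    exact congrArg (fun χ => Hom.app χ c' x) h

include hw hf in
theorem nonempty_iso : Nonempty (w ⋙ right TA f w ≅ f ⋙ left TA f w) :=
  ⟨(NatIso.ofComponents (F := f ⋙ left TA f w) (G := w ⋙ right TA f w)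
    (fun c => @asIso _ _ _ _ (leg (TA := TA) (f := f) (𝟙 (w.obj c))) (isIso_leg hw hf c))
    fun {c c'} r => by
      change (left TA f w).map (f.map r) ≫ leg (𝟙 _) = leg (𝟙 _) ≫ (right TA f w).map (w.map r)
      rw [map_comp_leg, leg_comp, Category.id_comp, Category.comp_id]).symm⟩

variable (TA f w) in
/-- The morphisms `leg x` depend linearly on `x`. -/
noncomputable def legHom (b : B) (c : C) :
    (w.obj c ⟶ b) →ₗ[k] ((left TA f w).obj (f.obj c) ⟶ (right TA f w).obj b) where
  toFun := leg
  map_add' x y := SheafExt.eval_injective (isSheaf_sheaf TA f w) <| by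
    rw [map_add, eval_leg, eval_leg, eval_leg]
    exact map_add ((unit TA f w b).app c) x y
  map_smul' a x := SheafExt.eval_injective (isSheaf_sheaf TA f w) <| by
    rw [map_smul, eval_leg, eval_leg, RingHom.id_apply]
    exact map_smul ((unit TA f w b).app c) a x

/-- The comparison of restriction along `right` with the direct image. -/
noncomputable def comparison (F : LinPsh k (Target TA f w)) :
    Hom (pull (right TA f w) F) (pushforward w (pull f (pull (left TA f w) F))) :=
  Hom.mk (fun b =>
    { toFun := fun e => Hom.mk (fun c => (F.resAt e _).comp (legHom TA f w b c)) fun {c c'} r x => by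
        change F.res (leg (w.map r ≫ x)) e = F.res ((left TA f w).map (f.map r)) (F.res (leg x) e)
        rw [← F.res_comp, map_comp_leg]
      map_add' := fun e e' => Hom.ext fun c x => map_add (F.res (leg x)) e e'
      map_smul' := fun a e => Hom.ext fun c x => map_smul (F.res (leg x)) a e })
    fun {b b'} y e => Hom.ext fun c x => by
      change F.res (leg x) (F.res ((right TA f w).map y) e) = F.res (leg (x ≫ y)) e
      rw [← F.res_comp, leg_comp]

-- The value of `F` at the object adjoined for `b` is the module of morphisms from the inverse image
-- of `B(w -, b)` to the restriction of `F` to `A`. By adjunction these are the morphisms from `B(w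
-- -, b)` to the restriction of `F` to `C`, so `comparison` is bijective onto a direct image of a
-- sheaf.
include hw hf in
theorem isSheaf_pull_right {F : LinPsh k (Target TA f w)}
    (hF : IsSheaf (SheafExt.topology TA (sheaf TA f w)) F) :
    IsSheaf TB (pull (right TA f w) F) := by
  have hψ := isSheaf_sheaf TA f w
  have hv := isLC_left TA f w
  have hFv := hv.isSheaf_pull hF
  refine (hw.isSheaf_pushforward (hf _ hFv)).of_bijective (comparison F) fun b =>
    ⟨(injective_iff_map_eq_zero _).2 fun e he => hv.eq_zero_of_forall hF fun a z => ?_, fun θ => ?_⟩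
  · obtain ⟨φ, hφ⟩ := SheafExt.exists_hom_of_obj hψ F e
    have h0 : φ = 0 := desc_ext (b := b) hFv fun c x => by
      rw [← eval_leg]
      exact (hφ _ (leg x)).trans (congrArg (fun χ => Hom.app χ c x) he)
    rw [← hφ, h0]
    rfl
  · obtain ⟨φ, hφ⟩ := exists_desc hFv θ
    obtain ⟨e, he⟩ := SheafExt.exists_obj_of_hom hψ hF (d := (right TA f w).obj b) φ
    refine ⟨e, Hom.ext fun c x => (he _ (leg x)).trans ?_⟩
    rw [eval_leg]
    exact hφ c x

end OreSquare

end OreSquare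
/-! ## Extension of natural transformations to subcanonical sites -/

section Extension

open LinPsh LinTopology

variable {k : Type u} [CommRing k] {B : Type u} [SmallCategory B] [Preadditive B] [Linear k B]
  {B' : Type u} [SmallCategory B'] [Preadditive B'] [Linear k B']
  {E : Type u} [SmallCategory E] [Preadditive E] [Linear k E]
  {S : LinTopology k B'} {T : LinTopology k B} {w : B' ⥤ B} [w.Additive] [w.Linear k]
  (hw : IsLC S T w) {P Q : B ⥤ E} [P.Additive] [P.Linear k] [Q.Additive] [Q.Linear k]

namespace IsLC

include hw in
theorem eq_of_map_comp (hP : ∀ e : E, IsSheaf T (pull P (yoneda (k := k) e))) {b : B} {e : E}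
    {y z : P.obj b ⟶ e} (h : ∀ (c : B') (x : w.obj c ⟶ b), P.map x ≫ y = P.map x ≫ z) : y = z :=
  hw.eq_of_forall (hP e) (d := b) h

omit [Q.Additive] [Q.Linear k] in
include hw in
theorem natTrans_ext (hP : ∀ e : E, IsSheaf T (pull P (yoneda (k := k) e))) {β β' : P ⟶ Q}
    (h : ∀ c : B', β.app (w.obj c) = β'.app (w.obj c)) : β = β' := by
  ext b
  refine hw.eq_of_map_comp hP fun c x => ?_
  rw [β.naturality, β'.naturality, h]

include hw in
/-- Natural transformations of continuous functors to a subcanonical site extend along LC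
functors. -/
theorem exists_natTrans (hP : ∀ e : E, IsSheaf T (pull P (yoneda (k := k) e)))
    (α : w ⋙ P ⟶ w ⋙ Q) : ∃ β : P ⟶ Q, ∀ c : B', β.app (w.obj c) = α.app c := by
  -- The assignment `x ↦ α.app c ≫ Q.map x` is a morphism from `B(w -, b)` to the restriction along
  -- `w` of the sheaf `E(P -, Q b)`. It extends along `w`, and its value at the identity of `b` is
  -- the component.
  have key : ∀ b : B, ∃ β : P.obj b ⟶ Q.obj b, ∀ (c : B') (x : w.obj c ⟶ b),
      P.map x ≫ β = α.app c ≫ Q.map x := by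
    intro b
    obtain ⟨ψ, hψ⟩ := hw.exists_hom_pull (hP (Q.obj b)) (M := yoneda b)
      (Hom.mk (fun c => (Linear.leftComp k _ (α.app c)).comp (Q.mapLinearMap k)) fun {c c'} r x => by
        change α.app c' ≫ Q.map (w.map r ≫ x) = P.map (w.map r) ≫ α.app c ≫ Q.map x
        rw [Q.map_comp, ← Category.assoc, ← Category.assoc]
        exact congrArg (· ≫ Q.map x) (α.naturality r).symm)
    refine ⟨ψ.app b (𝟙 b), fun c x => ?_⟩
    have h₁ := ψ.naturality x (𝟙 b)
    rw [yoneda_res, Category.comp_id] at h₁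
    exact h₁.symm.trans (congrArg (fun ξ => Hom.app ξ c x) hψ)
  choose β hβ using key
  refine ⟨{ app := β, naturality := fun b b' y => ?_ }, fun c => ?_⟩
  · refine hw.eq_of_map_comp hP fun c x => ?_
    rw [← Category.assoc, ← P.map_comp, hβ, ← Category.assoc, hβ, Q.map_comp, Category.assoc]
  · have := hβ _ c (𝟙 _)
    rw [P.map_id, Q.map_id, Category.id_comp] at this
    exact this.trans (Category.comp_id (α.app c))

include hw in
theorem isIso_of_isIso (hP : ∀ e : E, IsSheaf T (pull P (yoneda (k := k) e)))
    (hQ : ∀ e : E, IsSheaf T (pull Q (yoneda (k := k) e))) {α : w ⋙ P ⟶ w ⋙ Q} [IsIso α] {β : P ⟶ Q}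
    (hβ : ∀ c : B', β.app (w.obj c) = α.app c) : IsIso β := by
  obtain ⟨γ, hγ⟩ := hw.exists_natTrans (P := Q) (Q := P) hQ (inv α)
  refine ⟨γ, hw.natTrans_ext hP fun c => ?_, hw.natTrans_ext hQ fun c => ?_⟩
  · rw [NatTrans.comp_app, hβ, hγ, ← NatTrans.comp_app, IsIso.hom_inv_id]
    rfl
  · rw [NatTrans.comp_app, hβ, hγ, ← NatTrans.comp_app, IsIso.inv_hom_id]
    rfl

end IsLC

end Extension

/-! ## Closure properties of LC functors -/

section Closure

open LinPsh LinTopology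

variable {k : Type u} [CommRing k] {A : Type u} [SmallCategory A] [Preadditive A] [Linear k A]
  {B : Type u} [SmallCategory B] [Preadditive B] [Linear k B]
  {C : Type u} [SmallCategory C] [Preadditive C] [Linear k C]
  {S : LinTopology k A} {T : LinTopology k B} {U : LinTopology k C}

theorem LinSieve.image_comp_le (f : A ⥤ B) (g : B ⥤ C) {X : A} (R : LinSieve k X) :
    R.image (f ⋙ g) ≤ (R.image f).image g :=
  image_le fun _ _ hr => map_mem_image g (map_mem_image f hr)

theorem LinSieve.image_image_le (f : A ⥤ B) (g : B ⥤ C) [g.Additive] [g.Linear k] {X : A}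
    (R : LinSieve k X) : (R.image f).image g ≤ R.image (f ⋙ g) := by
  have h : R.image f ≤ (R.image (f ⋙ g)).comap g := image_le fun _ _ hr => map_mem_image (f ⋙ g) hr
  exact image_le fun _ _ hr => h hr

theorem LinTopology.image_mem_of_iso {f g : A ⥤ B} (e : f ≅ g) {X : A} {R : LinSieve k X}
    (hR : R.image f ∈ T.covers (f.obj X)) : R.image g ∈ T.covers (g.obj X) := by
  have h : R.image f ≤ (R.image g).pullback (e.hom.app X) := LinSieve.image_le fun Y r hr => by
    rw [LinSieve.mem_pullback, e.hom.naturality]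
    exact LinSieve.precomp_mem _ _ (LinSieve.map_mem_image g hr)
  refine mono (T.pullback_mem (e.inv.app X) (mono hR h)) fun Y y hy => ?_
  have hy : (y ≫ e.inv.app X) ≫ e.hom.app X ∈ (R.image g).arrows Y := hy
  rwa [Category.assoc, e.inv_hom_id_app, Category.comp_id] at hy

namespace IsLC

variable {f g : A ⥤ B} [f.Additive] [f.Linear k] [g.Additive] [g.Linear k]

theorem of_iso (h : IsLC S T f) (e : f ≅ g) : IsLC S T g where
  generating d := mono (h.generating d) <| LinSieve.generate_le fun i => by
    have := (generateFrom k g d).precomp_mem (e.hom.app i.1)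
      (mem_generateFrom g (e.inv.app i.1 ≫ i.2))
    rwa [← Category.assoc, e.hom_inv_id_app, Category.id_comp] at this
  full X Y c := mono (h.full X (e.hom.app Y ≫ c ≫ e.inv.app X : f.obj Y ⟶ f.obj X)) fun Z r hr => by
    obtain ⟨x, hx⟩ := hr
    refine ⟨x, ?_⟩
    have hx : f.map x = f.map r ≫ e.hom.app Y ≫ c ≫ e.inv.app X := hx
    change g.map x = g.map r ≫ c
    rw [← cancel_epi (e.hom.app Z), ← e.hom.naturality, hx, ← e.hom.naturality_assoc]
    simp
  faithful {X Y} x hx := h.faithful x <| by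
    rw [← cancel_mono (e.hom.app X), e.hom.naturality, hx, Limits.comp_zero, Limits.zero_comp]
  covers_iff X R := (h.covers_iff X R).trans ⟨image_mem_of_iso e, image_mem_of_iso e.symm⟩

variable {g : B ⥤ C} [g.Additive] [g.Linear k]

/-- Lifting and vanishing are done in two stages: a covering sieve in `B` on which `g` solves the
problem is pulled back to `A` by `comap_mem`, where `f` takes over. -/
theorem comp (hf : IsLC S T f) (hg : IsLC T U g) : IsLC S U (f ⋙ g) where
  generating d := of_generate (hg.generating d) fun i => by
    refine hg.covers_obj_of (hf.generating i.1) fun Y y hy => ?_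
    have h : generateFrom k f i.1 ≤ ((generateFrom k (f ⋙ g) d).pullback i.2).comap g :=
      LinSieve.generate_le fun j => mem_generateFrom (f ⋙ g) (g.map j.2 ≫ i.2)
    exact h hy
  full X Y c := by
    refine S.glue _ (hf.comap_mem (hg.full (f.obj X) (c : g.obj (f.obj Y) ⟶ g.obj (f.obj X)))) fun Z r hr => ?_
    obtain ⟨z, hz⟩ := hr
    have hz : g.map z = g.map (f.map r) ≫ c := hz
    refine mono (hf.full X z) fun V s hs => ?_
    obtain ⟨x, hx⟩ := hs
    refine ⟨x, ?_⟩
    have hx : f.map x = f.map s ≫ z := hx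
    change g.map (f.map x) = g.map (f.map (s ≫ r)) ≫ c
    rw [hx, g.map_comp, hz, f.map_comp, g.map_comp, Category.assoc]
  faithful {X Y} x hx := by
    refine S.colon_of_colon_closure (mono (hf.comap_mem (hg.faithful (f.map x) hx)) fun Z r hr => ?_)
    have hr : f.map r ≫ f.map x = 0 := hr
    refine hf.faithful (r ≫ x) ?_
    rw [f.map_comp, hr]
  covers_iff X R := by
    rw [hf.covers_iff, hg.covers_iff]
    exact ⟨fun h => mono h (LinSieve.image_image_le f g R),
      fun h => mono h (LinSieve.image_comp_le f g R)⟩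

end IsLC

/-- The quotient of a presheaf by a subpresheaf. -/
def LinPsh.Sub.quotient {M : LinPsh k A} (N : M.Sub) : LinPsh k A where
  obj X := M.obj X ⧸ N.carrier X
  res f := Submodule.mapQ _ _ (M.res f) fun _ hx => N.res_mem f hx
  res_id x := by
    obtain ⟨x, rfl⟩ := Submodule.Quotient.mk_surjective _ x
    exact congrArg Submodule.Quotient.mk (M.res_id x)
  res_comp g f x := by
    obtain ⟨x, rfl⟩ := Submodule.Quotient.mk_surjective _ x
    exact congrArg Submodule.Quotient.mk (M.res_comp g f x)
  res_add f g x := by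
    obtain ⟨x, rfl⟩ := Submodule.Quotient.mk_surjective _ x
    exact congrArg Submodule.Quotient.mk (M.res_add f g x)
  res_smul c f x := by
    obtain ⟨x, rfl⟩ := Submodule.Quotient.mk_surjective _ x
    exact congrArg Submodule.Quotient.mk (M.res_smul c f x)

/-- The quotient map. -/
def LinPsh.Sub.toQuotient {M : LinPsh k A} (N : M.Sub) : Hom M N.quotient :=
  Hom.mk (fun X => (N.carrier X).mkQ) fun _ _ => rfl

theorem LinPsh.Sub.toQuotient_eq_zero {M : LinPsh k A} (N : M.Sub) {X : A} {x : M.obj X} :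
    N.toQuotient.app X x = 0 ↔ x ∈ N.carrier X := Submodule.Quotient.mk_eq_zero _

/-- Continuous functors preserve covering sieves. -/
theorem LinTopology.image_mem_of_continuous {f : A ⥤ B} [f.Additive] [f.Linear k]
    (hf : ∀ F : LinPsh k B, IsSheaf T F → IsSheaf S (pull f F)) {X : A} {R : LinSieve k X}
    (hR : R ∈ S.covers X) : R.image f ∈ T.covers (f.obj X) := by
  let N := (R.image f).toSub
  -- Sheafify the quotient of the representable at `f X` by `R.image f`. The class of the identity
  -- vanishes along the members of `R`, hence vanishes by continuity of `f`; so the identity is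
  -- locally in `R.image f`, which therefore covers.
  have h₁ : ((toSheafify T N.quotient).app _ (N.toQuotient.app _ (𝟙 (f.obj X)))) = 0 := by
    refine (hf _ (isSheaf_sheafify T N.quotient)).sep (X := X) (mono hR fun Y r hr => ?_)
    have h₂ := (toSheafify T N.quotient).naturality (f.map r) (N.toQuotient.app _ (𝟙 (f.obj X)))
    rw [← Hom.naturality, yoneda_res, Category.comp_id,
      N.toQuotient_eq_zero.2 (LinSieve.map_mem_image f hr), map_zero] at h₂
    exact h₂.symm
  refine mono ((localIso_toSheafify T _).ker _ h₁) fun Y y hy => ?_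
  have hy : N.quotient.res y (N.toQuotient.app _ (𝟙 (f.obj X))) = 0 := hy
  rw [← Hom.naturality, N.toQuotient_eq_zero, yoneda_res, Category.comp_id] at hy
  exact hy

/-- Equivalences of sites are LC. -/
theorem isLC_of_equivalence {f : A ⥤ B} {g : B ⥤ A} [f.Additive] [f.Linear k] [g.Additive]
    [g.Linear k] (hf : ∀ F : LinPsh k B, IsSheaf T F → IsSheaf S (pull f F))
    (hg : ∀ F : LinPsh k A, IsSheaf S F → IsSheaf T (pull g F)) (unitIso : 𝟭 A ≅ f ⋙ g)
    (counitIso : g ⋙ f ≅ 𝟭 B) :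
    IsLC S T f := by
  have hfe : f.IsEquivalence := (CategoryTheory.Equivalence.mk f g unitIso counitIso).isEquivalence_functor
  refine ⟨fun d => ?_, fun X Y c => ?_, fun {X Y} x hx => ?_, fun X R => ?_⟩
  · refine mono (T.maximal_mem d) fun Y y _ => ?_
    have h : y ≫ counitIso.inv.app d ≫ counitIso.hom.app d ∈ (generateFrom k f d).arrows Y :=
      LinSieve.precomp_mem _ _ (LinSieve.precomp_mem _ _ (mem_generateFrom f (counitIso.hom.app d)))
    rw [counitIso.inv_hom_id_app] at h
    simpa using h
  · exact S.colon_of_mem ⟨f.preimage c, f.map_preimage c⟩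
  · rw [f.map_injective (hx.trans (f.map_zero _ _).symm)]
    exact zero_mem _
  -- For the converse, `g` is continuous as well, and `f ⋙ g` is isomorphic to the identity.
  · refine ⟨image_mem_of_continuous hf, fun hR => ?_⟩
    have h₁ := mono (image_mem_of_continuous hg hR) (LinSieve.image_image_le f g R)
    exact mono (image_mem_of_iso unitIso.symm h₁) (LinSieve.image_le fun Y r hr => hr)

end Closure
/-! ## The calculus of fractions for LC morphisms -/

namespace LinSite

open LinPsh Bicategory

variable {k : Type u} [CommRing k]

attribute [instance] Hom.additive Hom.linear

theorem LC_iff {A B : LinSite k} (f : Hom A B) :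
    LC k (show A ⟶ B from f) ↔ IsLC A.topology B.topology f.functor := isLC_iff

theorem Hom.isSheaf_pull {A B : LinSite k} (f : Hom A B) (F : LinPsh k B.carrier)
    (hF : IsSheaf B.topology F) : IsSheaf A.topology (pull f.functor F) :=
  (isContinuousLin_iff f.functor).1 f.continuous F hF

/-- A linear functor which preserves sheaves, as a 1-morphism of sites. -/
def homMk {A B : LinSite k} (f : A.carrier ⥤ B.carrier) [f.Additive] [f.Linear k]
    (hf : ∀ F : LinPsh k B.carrier, IsSheaf B.topology F → IsSheaf A.topology (pull f F)) : A ⟶ B :=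
  (⟨f, inferInstance, inferInstance, (isContinuousLin_iff f).2 hf⟩ : Hom A B)

/-- The natural transformation underlying a 2-morphism. -/
abbrev toNatTrans {A B : LinSite k} {f g : A ⟶ B} (α : f ⟶ g) :
    Hom.functor f ⟶ Hom.functor g := Hom₂.natTrans α

/-- The natural isomorphism underlying an invertible 2-morphism. -/
def toNatIso {A B : LinSite k} {f g : A ⟶ B} (e : f ≅ g) : Hom.functor f ≅ Hom.functor g where
  hom := toNatTrans e.hom
  inv := toNatTrans e.inv
  hom_inv_id := congrArg Hom₂.natTrans e.hom_inv_id
  inv_hom_id := congrArg Hom₂.natTrans e.inv_hom_id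

/-- A site is subcanonical if the representable presheaves are sheaves. -/
def IsSubcanonical (A : LinSite k) : Prop := ∀ X : A.carrier, IsSheaf A.topology (yoneda X)

theorem LC_comp {A B C : LinSite k} {f : A ⟶ B} {g : B ⟶ C} (hf : LC k f) (hg : LC k g) :
    LC k (f ≫ g) := (LC_iff _).2 (((LC_iff f).1 hf).comp ((LC_iff g).1 hg))

theorem LC_of_iso {A B : LinSite k} {f g : A ⟶ B} (e : f ≅ g) (hf : LC k f) : LC k g :=
  (LC_iff _).2 (((LC_iff f).1 hf).of_iso (toNatIso e))

theorem LC_of_isEquivalence₁ {A B : LinSite k} {f : A ⟶ B} (hf : IsEquivalence₁ f) : LC k f := by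
  obtain ⟨e, rfl⟩ := hf
  exact (LC_iff _).2 (isLC_of_equivalence (Hom.isSheaf_pull e.hom) (Hom.isSheaf_pull e.inv)
    (toNatIso e.unit) (toNatIso e.counit))

/-- Spans with one leg in `LC` can be completed to squares with a subcanonical corner. -/
theorem exists_square {A B C : LinSite k} (f : C ⟶ A) (w : C ⟶ B) (hw : LC k w) :
    ∃ (D : LinSite k) (v : A ⟶ D) (g : B ⟶ D), LC k v ∧ Nonempty (w ≫ g ≅ f ≫ v) ∧
      D.IsSubcanonical := by
  have hw := (LC_iff w).1 hw
  let f' := Hom.functor f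
  let w' := Hom.functor w
  have hf := Hom.isSheaf_pull f
  have hv := OreSquare.isLC_left A.topology f' w'
  let D : LinSite k := ⟨OreSquare.Target A.topology f' w', SheafExt.topology A.topology _⟩
  obtain ⟨e⟩ := OreSquare.nonempty_iso hw hf
  exact ⟨D, homMk (B := D) (OreSquare.left A.topology f' w') fun F hF => hv.isSheaf_pull hF,
    homMk (B := D) (OreSquare.right A.topology f' w')
      fun F hF => OreSquare.isSheaf_pull_right hw hf hF,
    (LC_iff _).2 hv, ⟨isoMk e⟩, SheafExt.isSheaf_yoneda (OreSquare.isSheaf_sheaf A.topology f' w')⟩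

/-- Every site is LC equivalent to a subcanonical one. -/
theorem exists_subcanonical (A : LinSite k) :
    ∃ (D : LinSite k) (v : A ⟶ D), LC k v ∧ D.IsSubcanonical := by
  -- With nothing adjoined, `SheafExt` is the site of sheafified representables.
  let ψ : PEmpty.{u + 1} → LinPsh k A.carrier := PEmpty.elim
  have hψ : ∀ j, IsSheaf A.topology (ψ j) := fun j => j.elim
  let D : LinSite k := ⟨SheafExt A.topology ψ, SheafExt.topology A.topology ψ⟩
  have hv := SheafExt.isLC_incl hψ
  exact ⟨D, homMk (B := D) (SheafExt.incl A.topology ψ) fun F hF => hv.isSheaf_pull hF,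
    (LC_iff _).2 hv, SheafExt.isSheaf_yoneda hψ⟩

/-- Associators have identity components, so the equation prescribes `β` exactly on the objects in
the image of `w`. -/
theorem whiskerRight_eq_iff {A B B' A' : LinSite k} {f g : B ⟶ A} {w : B' ⟶ B} (α : w ≫ f ⟶ w ≫ g)
    (v : A ⟶ A') (β : f ≫ v ⟶ g ≫ v) :
    α ▷ v = (α_ w f v).hom ≫ w ◁ β ≫ (α_ w g v).inv ↔
      ∀ c : B'.carrier, (toNatTrans β).app ((Hom.functor w).obj c) =
        (Hom.functor v).map ((toNatTrans α).app c) := by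
  have h : ∀ c : B'.carrier, (toNatTrans ((α_ w f v).hom ≫ w ◁ β ≫ (α_ w g v).inv)).app c =
      (toNatTrans β).app ((Hom.functor w).obj c) := fun c => by
    change 𝟙 _ ≫ (toNatTrans β).app ((Hom.functor w).obj c) ≫ 𝟙 _ = _
    simp
  constructor
  · intro e c
    rw [← h, ← e]
    rfl
  · intro e
    refine Hom₂.ext (NatTrans.ext (funext fun c => ?_))
    exact (e c).symm.trans (h c).symm

theorem LC_admitsLeftCalculusOfFractions : AdmitsLeftCalculusOfFractions (LC k) where
  LF1 _ hf := LC_of_isEquivalence₁ hf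
  LF2 _ _ hf hg := LC_comp hf hg
  LF3 f w hw := by
    obtain ⟨D, v, g, hv, e, -⟩ := exists_square f w hw
    exact ⟨D, v, g, hv, e⟩
  LF4_exists {A B B'} f g w hw α := by
    have hw := (LC_iff w).1 hw
    obtain ⟨D, v, hv, hD⟩ := exists_subcanonical A
    have hP : ∀ (p : B ⟶ D) (e : D.carrier), IsSheaf B.topology
        (pull (Hom.functor p) (yoneda (k := k) e)) := fun p e => Hom.isSheaf_pull p _ (hD e)
    let γ : Hom.functor w ⋙ Hom.functor (f ≫ v) ⟶ Hom.functor w ⋙ Hom.functor (g ≫ v) :=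
      Functor.whiskerRight (toNatTrans α) (Hom.functor v)
    obtain ⟨β, hβ⟩ := hw.exists_natTrans (hP _) γ
    refine ⟨D, v, ⟨β⟩, hv, (whiskerRight_eq_iff α v ⟨β⟩).2 hβ, fun hα => ?_⟩
    let α' : Hom.functor w ⋙ Hom.functor f ≅ Hom.functor w ⋙ Hom.functor g := toNatIso (asIso α)
    have : IsIso γ := (Functor.isoWhiskerRight α' (Hom.functor v)).isIso_hom
    have := hw.isIso_of_isIso (hP _) (hP _) hβ
    exact (isoMk (f := f ≫ v) (g := g ≫ v) (asIso β)).isIso_hom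
  LF4_unique {A B B'} f g w hw α {A₁ A₂} v β v' β' hv hβ hv' hβ' := by
    have hw := (LC_iff w).1 hw
    -- Only `u'` is known to be LC; `v ≫ u` is LC because it is isomorphic to `v' ≫ u'`.
    obtain ⟨D, u', u, hu', ⟨e⟩, hD⟩ := exists_square v' v hv
    have hvu' := LC_comp hv' hu'
    refine ⟨D, u, u', e, LC_of_iso e.symm hvu', hvu', ?_⟩
    have hβ := (whiskerRight_eq_iff α v β).1 hβ
    have hβ' := (whiskerRight_eq_iff α v' β').1 hβ'
    -- As `D` is subcanonical, it suffices to compare on objects `w c`, where `β` and `β'` are the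
    -- images of `α.app c` and the equation is naturality of `e`.
    refine Hom₂.ext (hw.natTrans_ext (P := Hom.functor (f ≫ v ≫ u))
      (Q := Hom.functor (g ≫ v' ≫ u')) (fun x => Hom.isSheaf_pull _ _ (hD x)) fun c => ?_)
    have h₁ := (toNatTrans e.hom).naturality ((toNatTrans α).app c)
    change (𝟙 _ ≫ (Hom.functor u).map ((toNatTrans β).app _) ≫ 𝟙 _) ≫ (toNatTrans e.hom).app _ =
      (toNatTrans e.hom).app _ ≫ 𝟙 _ ≫ (Hom.functor u').map ((toNatTrans β').app _) ≫ 𝟙 _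
    rw [hβ, hβ']
    simp only [Category.id_comp, Category.comp_id]
    exact h₁.trans (congrArg ((toNatTrans e.hom).app _ ≫ ·) (Category.comp_id _).symm)
  LF5 e hf := LC_of_iso e hf

end LinSite

/-- The words and terms over `LinSite k` live in `Type (u + 1)`, whence the universes of the
bilocalization. -/
theorem mainTheorem2 (k : Type u) [CommRing k] :
    AdmitsLeftCalculusOfFractions (LinSite.LC k) ∧
    ∃ (L : Type (u + 1)) (_ : Bicategory.{u + 1, u + 1} L) (Ψ : LinSite k ⥤ᵖ L),
      IsBilocalization.{u, u + 1, w₃, u, u + 1, v₃, u + 1, u + 1, u₃} (LinSite.LC k) Ψ :=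
  ⟨LinSite.LC_admitsLeftCalculusOfFractions, BiLocalization (LinSite.LC k), inferInstance,
    BiLocalization.toLocalization _, BiLocalization.isBilocalization_toLocalization _⟩
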